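/- Let $m\ge 0$, let $\mathcal F=\{1,\dots,m\}$ be a set of features with associated Boolean variables $x_1,\dots,x_m$, and let $\kappa:\{0,1\}^m\to\{0,1\}$ be a classifier. Given $\mathbf v\in\{0,1\}^m$, an \emph{abductive explanation} (AXp) of the decision $\kappa(\mathbf v)$ is a subset-minimal set $\mathcal S\subseteq\mathcal F$ such that every $\mathbf x\in\{0,1\}^m$ with $x_i=v_i$ for all $i\in\mathcal S$ satisfies $\kappa(\mathbf x)=\kappa(\mathbf v)$. For each language $\mathbf L$ in the list below there is an algorithm that, given a representation $\Delta\in\mathbf L$ of a classifier $\kappa$ on $\{0,1\}^m$ and a point $\mathbf v\in\{0,1\}^m$, computes one AXp of the decision $\kappa(\mathbf v)$ in time polynomial in the size of the input $(\Delta,\mathbf v)$. \begin{itemize} \item \textbf{cd-PDAG}: rooted directed acyclic graphs with leaves $\top$, $\bot$ or $x_i$ and inner nodes $\neg$, $\wedge$, $\vee$, in which the children of each $\wedge$-node share no variables and the children of each $\vee$-node are pairwise contradictory. \item \textbf{SDD}: sentential decision diagrams (with shared nodes). A vtree is a full binary tree whose leaves are labelled with distinct variables. A constant is an SDD that respects every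 vtree; a literal of $x_i$ respects the leaf $x_i$; $\{(p_1,s_1),\dots,(p_n,s_n)\}$, which represents $\bigvee_j (p_j\wedge s_j)$, respects an inner vtree node if each $p_j$ respects some subtree of its left subtree, each $s_j$ some subtree of its right subtree, and the $p_j$ are consistent, pairwise contradictory, and have a valid disjunction. \item \textbf{OBDD}: binary decision diagrams (not necessarily reduced) in which, for some total order of the variables, the variables of the decision nodes increase along every path. \item \textbf{PI}: CNF formulas (no clause mentions a variable twice) such that every entailed non-tautological clause is subsumed by a clause of the formula and no clause of the formula is subsumed by another one. \item \textbf{IP}: DNF formulas (no term mentions a variable twice) such that every consistent term that entails the formula is subsumed by a term of the formula and no term of the formula is subsumed by another one. \item \textbf{renH-C}: CNF formulas for which there is a set of variables such that complementing all literals over these variables leaves at most one positive literal in each clause. \item \textbf{AFF}: conjunctions of XOR-clauses, i.e. of exclusive disjunctions of literals and constants. \item \textbf{dFSD}: deterministic focusing set-labelled diagrams, here over Boolean variables: rooted directed acyclic graphs with a sink; each inner node is labelled with a variable or with a purely disjunctive symbol, and each edge with a set of values (empty or full if it leaves a disjunctive node). A point is accepted iff there is a path from the root to the sink on which the value of each tested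 variable belongs to the label of the edge and no edge leaving a disjunctive node has an empty label (the empty graph accepts no point). Deterministic: the labels of the edges leaving a node are pairwise disjoint. Focusing: the label of an edge leaving a node for a variable $x_i$ is contained in the label of every earlier edge for $x_i$ on any path. \item \textbf{EADT}: extended affine decision trees, i.e. trees with leaves $\top,\bot$, binary decision nodes labelled with XOR-clauses, and affine decomposable $\wedge$- and $\vee$-nodes of any arity. Such a node $N$ with children $N_1,\dots,N_k$ is affine decomposable if the variables can be partitioned into blocks such that the variables of each $N_j$ lie in a block of their own (distinct children in distinct blocks) and the variables of the label of each decision node that is an ancestor of $N$ lie in a single block. \end{itemize} -/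

import Mathlib

namespace KC

/-! ### Machine model: first-order functional programs over binary trees, with a step count -/

/-- The data that programs work on: binary trees. The empty tree stands for "false". -/
inductive SExp where
  | nil : SExp
  | cons : SExp → SExp → SExp

namespace SExp

/-- The length of a datum: its number of nodes. -/
def size : SExp → ℕ
  | nil => 1
  | cons a b => a.size + b.size + 1

def hd : SExp → SExp
  | nil => nil
  | cons a _ => a

def tl : SExp → SExp
  | nil => nil
  | cons _ b => b

end SExp

/-- Program expressions. Every function of a program has one parameter, `arg`. The primitives are
the empty tree, pairing, the two projections, a test for emptiness and (recursive) calls. -/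
inductive Code where
  | arg : Code
  | nil : Code
  | cons : Code → Code → Code
  | hd : Code → Code
  | tl : Code → Code
  | ite : Code → Code → Code → Code
  | call : ℕ → Code → Code

/-- A program is the finite list of the bodies of its functions; function `0` is the main one. -/
abbrev Program := List Code

/-- `Eval P d e w t`: in the program `P`, when the parameter has the value `d`, the expression `e`
evaluates (call by value) to `w` in exactly `t` steps. Every evaluation of a primitive and every
call is one step. No primitive looks further than one node into a tree, and a step creates at
most one new node, so that a pointer machine carries out a step in constant time; these programs
are therefore polynomially equivalent to Turing machines. -/
inductive Eval (P : Program) : SExp → Code → SExp → ℕ → Prop where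
  | arg (d : SExp) : Eval P d Code.arg d 1
  | nil (d : SExp) : Eval P d Code.nil SExp.nil 1
  | cons {d u w : SExp} {a b : Code} {s t : ℕ} (ha : Eval P d a u s) (hb : Eval P d b w t) :
      Eval P d (Code.cons a b) (SExp.cons u w) (s + t + 1)
  | hd {d u : SExp} {a : Code} {s : ℕ} (ha : Eval P d a u s) :
      Eval P d (Code.hd a) u.hd (s + 1)
  | tl {d u : SExp} {a : Code} {s : ℕ} (ha : Eval P d a u s) :
      Eval P d (Code.tl a) u.tl (s + 1)
  | iteTrue {d u u' w : SExp} {c a b : Code} {s t : ℕ} (hc : Eval P d c (SExp.cons u u') s)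
      (ha : Eval P d a w t) : Eval P d (Code.ite c a b) w (s + t + 1)
  | iteFalse {d w : SExp} {c a b : Code} {s t : ℕ} (hc : Eval P d c SExp.nil s)
      (hb : Eval P d b w t) : Eval P d (Code.ite c a b) w (s + t + 1)
  | call {d u w : SExp} {f : ℕ} {e body : Code} {s t : ℕ} (he : Eval P d e u s)
      (hf : P[f]? = some body) (hb : Eval P u body w t) :
      Eval P d (Code.call f e) w (s + t + 1)

/-- On the input `d` the program `P` halts with the output `w` after `t` steps. -/
def Runs (P : Program) (d w : SExp) (t : ℕ) : Prop :=
  Eval P d (Code.call 0 Code.arg) w t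

/-! ### Encodings of the inputs and outputs

Natural numbers are written in unary. In the inputs below they are only names of features
(and the input holds one bit for each feature), or numbers of nodes of a graph (and the input
lists these nodes), so that this changes the length of an input at most polynomially. -/

class Encode (α : Type) where
  code : α → SExp

open Encode (code)

instance : Encode Bool where
  code b := if b then SExp.cons SExp.nil SExp.nil else SExp.nil

def codeNat : ℕ → SExp
  | 0 => SExp.nil
  | n + 1 => SExp.cons SExp.nil (codeNat n)

instance : Encode ℕ where
  code := codeNat

instance (m : ℕ) : Encode (Fin m) where
  code i := codeNat i

instance {α β : Type} [Encode α] [Encode β] : Encode (α × β) where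
  code p := SExp.cons (code p.1) (code p.2)

def codeList {α : Type} [Encode α] : List α → SExp
  | [] => SExp.nil
  | a :: l => SExp.cons (code a) (codeList l)

instance {α : Type} [Encode α] : Encode (List α) where
  code := codeList

instance {α : Type} [Encode α] : Encode (Option α) where
  code
    | none => SExp.nil
    | some a => SExp.cons SExp.nil (code a)

/-- A set of truth values is written as its characteristic vector. -/
instance : Encode (Finset Bool) where
  code S := code (decide (false ∈ S), decide (true ∈ S))

/-! ### Classifiers and abductive explanations -/

/-- Boolean functions of `m` variables. The features are the elements of `Fin m`. -/
abbrev BoolFn (m : ℕ) := (Fin m → Bool) → Bool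

/-- Fixing the features in `S` to their values in `v` suffices for the prediction `κ v`. -/
def IsWeakAXp {m : ℕ} (κ : BoolFn m) (v : Fin m → Bool) (S : Finset (Fin m)) : Prop :=
  ∀ x : Fin m → Bool, (∀ i ∈ S, x i = v i) → κ x = κ v

/-- An abductive explanation (AXp): a subset-minimal weak one. -/
def IsAXp {m : ℕ} (κ : BoolFn m) (v : Fin m → Bool) (S : Finset (Fin m)) : Prop :=
  Minimal (IsWeakAXp κ v) S

/-- A knowledge compilation language: `Rep m` holds the representations over the variables
`x₀, …, x₍ₘ₋₁₎`, `Mem` picks out those that belong to the language, `eval` gives the function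
that is represented, and `enc` the representation as it is given to a program. -/
structure Language where
  Rep : ℕ → Type
  Mem : {m : ℕ} → Rep m → Prop
  eval : {m : ℕ} → Rep m → BoolFn m
  enc : {m : ℕ} → Rep m → SExp

/-- The instance `(Δ, v)` of the problem of finding one AXp. -/
def axpInput (L : Language) {m : ℕ} (Δ : L.Rep m) (v : Fin m → Bool) : SExp :=
  SExp.cons (L.enc Δ) (code (List.ofFn v))

/-- A set of features is returned as its characteristic vector. -/
def axpOutput {m : ℕ} (S : Finset (Fin m)) : SExp :=
  code (List.ofFn fun i => decide (i ∈ S))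

/-- Finding one AXp of a decision taken by a classifier that is given in the language `L` is
polynomial-time. -/
def OneAXpInPolyTime (L : Language) : Prop :=
  ∃ (P : Program) (p : Polynomial ℕ), ∀ (m : ℕ) (Δ : L.Rep m), L.Mem Δ → ∀ v : Fin m → Bool,
    ∃ (S : Finset (Fin m)) (t : ℕ), IsAXp (L.eval Δ) v S ∧
      Runs P (axpInput L Δ v) (axpOutput S) t ∧ t ≤ p.eval (axpInput L Δ v).size

/-! ### Rooted directed acyclic graphs

A graph is the list of its nodes in a topological order, the root first; an arc with the
number `k` leads from a node to the `k`-th node (counted from `0`) among those that come after it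
in the list. So if the graph is `g :: gs`, then `gs.drop k` is the subgraph below the arc `k`
of the root `g`. -/

namespace Dag

variable {γ β : Type*}

/-- Bottom-up computation of one value for each node. `step g f` is the value at a node with the
label `g` when `f k` is the value at the end of its arc `k`. -/
def values (step : γ → (ℕ → β) → β) (dflt : β) : List γ → List β
  | [] => []
  | g :: gs => step g (fun k => (values step dflt gs).getD k dflt) :: values step dflt gs

/-- The value at the root. -/
def value (step : γ → (ℕ → β) → β) (dflt : β) (gs : List γ) : β :=
  (values step dflt gs).headD dflt

/-- `Q g below` holds for every node, where `g` is its label and `below` the list of the nodes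
that come after it. -/
def EveryNode (Q : γ → List γ → Prop) : List γ → Prop
  | [] => True
  | g :: gs => Q g gs ∧ EveryNode Q gs

/-- All arcs lead to existing nodes. -/
def ArcsInRange (arcs : γ → List ℕ) : List γ → Prop :=
  EveryNode fun g below => ∀ k ∈ arcs g, k < below.length

end Dag

/-! ### cd-PDAG: decomposable and deterministic propositional directed acyclic graphs -/

inductive PGate (m : ℕ) where
  | const (b : Bool)
  | var (i : Fin m)
  | neg (k : ℕ)
  | conj (ks : List ℕ)
  | disj (ks : List ℕ)

namespace PGate

variable {m : ℕ}

def arcs : PGate m → List ℕ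
  | const _ => []
  | var _ => []
  | neg k => [k]
  | conj ks => ks
  | disj ks => ks

def evalStep : PGate m → (ℕ → BoolFn m) → BoolFn m
  | const b, _ => fun _ => b
  | var i, _ => fun x => x i
  | neg k, f => fun x => !(f k x)
  | conj ks, f => fun x => ks.all fun k => f k x
  | disj ks, f => fun x => ks.any fun k => f k x

def varsStep : PGate m → (ℕ → Set (Fin m)) → Set (Fin m)
  | const _, _ => ∅
  | var i, _ => {i}
  | neg k, f => f k
  | conj ks, f => {i | ∃ k ∈ ks, i ∈ f k}
  | disj ks, f => {i | ∃ k ∈ ks, i ∈ f k}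

instance : Encode (PGate m) where
  code
    | const b => code ((0 : ℕ), b)
    | var i => code ((1 : ℕ), i)
    | neg k => code ((2 : ℕ), k)
    | conj ks => code ((3 : ℕ), ks)
    | disj ks => code ((4 : ℕ), ks)

end PGate

abbrev PDag (m : ℕ) := List (PGate m)

namespace PDag

variable {m : ℕ}

def eval (G : PDag m) : BoolFn m := Dag.value PGate.evalStep (fun _ => false) G

def vars (G : PDag m) : Set (Fin m) := Dag.value PGate.varsStep ∅ G

/-- The children of every conjunction have pairwise no common variable. -/
def Decomposable (G : PDag m) : Prop :=
  Dag.EveryNode (fun g below => ∀ ks, g = PGate.conj ks →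
    ks.Pairwise fun k l => Disjoint (vars (below.drop k)) (vars (below.drop l))) G

/-- The children of every disjunction are pairwise logically contradictory. -/
def Deterministic (G : PDag m) : Prop :=
  Dag.EveryNode (fun g below => ∀ ks, g = PGate.disj ks →
    ks.Pairwise fun k l =>
      ∀ x, ¬ (eval (below.drop k) x = true ∧ eval (below.drop l) x = true)) G

end PDag

def cdPDAG : Language where
  Rep := PDag
  Mem G := G ≠ [] ∧ Dag.ArcsInRange PGate.arcs G ∧ G.Decomposable ∧ G.Deterministic
  eval := PDag.eval
  enc G := code G

/-! ### SDD: sentential decision diagrams -/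

/-- Full binary trees whose leaves are labelled with variables. -/
inductive Vtree (m : ℕ) where
  | leaf (i : Fin m)
  | node (l r : Vtree m)

namespace Vtree

variable {m : ℕ}

def leaves : Vtree m → List (Fin m)
  | leaf i => [i]
  | node l r => l.leaves ++ r.leaves

/-- `s.IsSub t`: `s` is the subtree of `t` that is rooted at some node of `t`. -/
def IsSub (s : Vtree m) : Vtree m → Prop
  | leaf i => s = leaf i
  | node l r => s = node l r ∨ s.IsSub l ∨ s.IsSub r

end Vtree

/-- A node is a constant, a literal (`lit i true` is `xᵢ`, and `lit i false` is `¬ xᵢ`), or a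
decomposition: a list of elements, each a pair of a prime and a sub. -/
inductive SGate (m : ℕ) where
  | const (b : Bool)
  | lit (i : Fin m) (b : Bool)
  | decomp (es : List (ℕ × ℕ))

namespace SGate

variable {m : ℕ}

def arcs : SGate m → List ℕ
  | const _ => []
  | lit _ _ => []
  | decomp es => es.map Prod.fst ++ es.map Prod.snd

/-- A decomposition is the disjunction of the conjunctions `prime ∧ sub`. -/
def evalStep : SGate m → (ℕ → BoolFn m) → BoolFn m
  | const b, _ => fun _ => b
  | lit i b, _ => fun x => x i == b
  | decomp es, f => fun x => es.any fun e => f e.1 x && f e.2 x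

/-- The vtrees that a node respects. -/
def respectsStep : SGate m → (ℕ → Vtree m → Prop) → Vtree m → Prop
  | const _, _ => fun _ => True
  | lit i _, _ => fun v => v = Vtree.leaf i
  | decomp es, f => fun v => ∃ l r, v = Vtree.node l r ∧
      ∀ e ∈ es, (∃ l', l'.IsSub l ∧ f e.1 l') ∧ (∃ r', r'.IsSub r ∧ f e.2 r')

instance : Encode (SGate m) where
  code
    | const b => code ((0 : ℕ), b)
    | lit i b => code ((1 : ℕ), i, b)
    | decomp es => code ((2 : ℕ), es)

end SGate

abbrev SDDag (m : ℕ) := List (SGate m)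

namespace SDDag

variable {m : ℕ}

def eval (G : SDDag m) : BoolFn m := Dag.value SGate.evalStep (fun _ => false) G

def Respects (G : SDDag m) : Vtree m → Prop := Dag.value SGate.respectsStep (fun _ => False) G

/-- The primes of every decomposition form a partition: each of them is consistent, they are
pairwise contradictory, and their disjunction is valid. -/
def Partitions (G : SDDag m) : Prop :=
  Dag.EveryNode (fun g below => ∀ es, g = SGate.decomp es →
    (∀ e ∈ es, ∃ x, eval (below.drop e.1) x = true) ∧
    (es.Pairwise fun e e' =>
      ∀ x, ¬ (eval (below.drop e.1) x = true ∧ eval (below.drop e'.1) x = true)) ∧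
    (∀ x, ∃ e ∈ es, eval (below.drop e.1) x = true)) G

end SDDag

def SDD : Language where
  Rep := SDDag
  Mem G := G ≠ [] ∧ Dag.ArcsInRange SGate.arcs G ∧ G.Partitions ∧
    ∃ v : Vtree _, v.leaves.Nodup ∧ G.Respects v
  eval := SDDag.eval
  enc G := code G

/-! ### OBDD: ordered binary decision diagrams -/

/-- `dec i lo hi` is a decision on the variable `xᵢ`. -/
inductive BGate (m : ℕ) where
  | const (b : Bool)
  | dec (i : Fin m) (lo hi : ℕ)

namespace BGate

variable {m : ℕ}

def arcs : BGate m → List ℕ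
  | const _ => []
  | dec _ lo hi => [lo, hi]

def evalStep : BGate m → (ℕ → BoolFn m) → BoolFn m
  | const b, _ => fun _ => b
  | dec i lo hi, f => fun x => if x i then f hi x else f lo x

instance : Encode (BGate m) where
  code
    | const b => code ((0 : ℕ), b)
    | dec i lo hi => code ((1 : ℕ), i, lo, hi)

end BGate

abbrev BDag (m : ℕ) := List (BGate m)

/-- Along every arc between two decision nodes the variable increases in the order that is given
by the injective ranking `r`. -/
def BDag.OrderedBy {m : ℕ} (r : Fin m → ℕ) (G : BDag m) : Prop :=
  Dag.EveryNode (fun g below => ∀ i lo hi, g = BGate.dec i lo hi →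
    ∀ k ∈ [lo, hi], ∀ j lo' hi', below[k]? = some (BGate.dec j lo' hi') → r i < r j) G

def OBDD : Language where
  Rep := BDag
  Mem G := G ≠ [] ∧ Dag.ArcsInRange BGate.arcs G ∧
    ∃ r : Fin _ → ℕ, Function.Injective r ∧ G.OrderedBy r
  eval G := Dag.value BGate.evalStep (fun _ => false) G
  enc G := code G

/-! ### PI, IP and renH-C: fragments of CNF and DNF -/

/-- The literal `(i, true)` is `xᵢ`, and `(i, false)` is `¬ xᵢ`. -/
abbrev Lit (m : ℕ) := Fin m × Bool

def Lit.eval {m : ℕ} (l : Lit m) : BoolFn m := fun x => x l.1 == l.2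

def clauseEval {m : ℕ} (C : List (Lit m)) : BoolFn m := fun x => C.any fun l => l.eval x

def termEval {m : ℕ} (T : List (Lit m)) : BoolFn m := fun x => T.all fun l => l.eval x

def cnfEval {m : ℕ} (Φ : List (List (Lit m))) : BoolFn m := fun x => Φ.all fun C => clauseEval C x

def dnfEval {m : ℕ} (Φ : List (List (Lit m))) : BoolFn m := fun x => Φ.any fun T => termEval T x

/-- No variable occurs twice. -/
def Simple {m : ℕ} (C : List (Lit m)) : Prop := (C.map Prod.fst).Nodup

/-- A CNF formula that consists of its prime implicates: every clause that it entails is subsumed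
by one of its clauses, and no clause of it is subsumed by another one. -/
def PI : Language where
  Rep m := List (List (Lit m))
  Mem Φ := (∀ C ∈ Φ, Simple C) ∧
    (∀ D, Simple D → (∀ x, cnfEval Φ x = true → clauseEval D x = true) → ∃ C ∈ Φ, C ⊆ D) ∧
    Φ.Pairwise fun C D => ¬ C ⊆ D ∧ ¬ D ⊆ C
  eval := cnfEval
  enc Φ := code Φ

/-- A DNF formula that consists of its prime implicants: every term that entails it is subsumed
by one of its terms, and no term of it is subsumed by another one. -/
def IP : Language where
  Rep m := List (List (Lit m))
  Mem Φ := (∀ T ∈ Φ, Simple T) ∧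
    (∀ U, Simple U → (∀ x, termEval U x = true → dnfEval Φ x = true) → ∃ T ∈ Φ, T ⊆ U) ∧
    Φ.Pairwise fun T U => ¬ T ⊆ U ∧ ¬ U ⊆ T
  eval := dnfEval
  enc Φ := code Φ

/-- Renamable Horn CNF formulas: complementing the literals over some set `R` of variables
leaves at most one positive literal in each clause. A literal is positive after the renaming iff
its sign is `true` and its variable is not in `R`, or its sign is `false` and its variable is
in `R`. -/
def renHC : Language where
  Rep m := List (List (Lit m))
  Mem Φ := ∃ R : Set (Fin _), ∀ C ∈ Φ, ∀ l ∈ C, ∀ l' ∈ C,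
    (l.2 = true ↔ l.1 ∉ R) → (l'.2 = true ↔ l'.1 ∉ R) → l = l'
  eval := cnfEval
  enc Φ := code Φ

/-! ### AFF: affine formulas -/

/-- The XOR-clause `(ls, b)` is the exclusive disjunction of the literals `ls` and the
constant `b`. -/
abbrev XorClause (m : ℕ) := List (Lit m) × Bool

namespace XorClause

variable {m : ℕ}

def eval (δ : XorClause m) : BoolFn m := fun x => δ.1.foldr (fun l b => l.eval x ^^ b) δ.2

def vars (δ : XorClause m) : Set (Fin m) := {i | ∃ l ∈ δ.1, l.1 = i}

end XorClause

/-- Conjunctions of XOR-clauses. -/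
def AFF : Language where
  Rep m := List (XorClause m)
  Mem _ := True
  eval Φ := fun x => Φ.all fun δ => XorClause.eval δ x
  enc Φ := code Φ

/-! ### dFSD: deterministic focusing set-labelled diagrams (over two-valued variables) -/

/-- An inner node is labelled with a variable `some i`, or with `none`, which is the symbol for
a purely disjunctive node. Its edges are labelled with sets of values. -/
inductive FGate (m : ℕ) where
  | sink
  | inner (lab : Option (Fin m)) (edges : List (Finset Bool × ℕ))

namespace FGate

variable {m : ℕ}

def arcs : FGate m → List ℕ
  | sink => []
  | inner _ es => es.map Prod.snd

/-- There is a path to the sink along which the value of every tested variable lies in the label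
of the edge, and the labels of the edges that leave disjunctive nodes are not empty. -/
def evalStep : FGate m → (ℕ → BoolFn m) → BoolFn m
  | sink, _ => fun _ => true
  | inner (some i) es, f => fun x => es.any fun e => decide (x i ∈ e.1) && f e.2 x
  | inner none es, f => fun x => es.any fun e => decide (e.1 ≠ ∅) && f e.2 x

/-- The pairs `(i, S)` such that an edge with the label `S` leaves a node with the label `some i`
at or below the given node. -/
def testsStep : FGate m → (ℕ → Set (Fin m × Finset Bool)) → Set (Fin m × Finset Bool)
  | sink, _ => ∅
  | inner lab es, f => {q | ∃ e ∈ es, (lab = some q.1 ∧ e.1 = q.2) ∨ q ∈ f e.2}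

instance : Encode (FGate m) where
  code
    | sink => code ((0 : ℕ), (0 : ℕ))
    | inner lab es => code ((1 : ℕ), lab, es)

end FGate

abbrev FDag (m : ℕ) := List (FGate m)

namespace FDag

variable {m : ℕ}

/-- The empty graph represents the constant `false`. -/
def eval (G : FDag m) : BoolFn m := Dag.value FGate.evalStep (fun _ => false) G

def tests (G : FDag m) : Set (Fin m × Finset Bool) := Dag.value FGate.testsStep ∅ G

/-- Edges that leave disjunctive nodes are labelled with the empty set or with all values. -/
def LabelsOK (G : FDag m) : Prop :=
  Dag.EveryNode (fun g _ => ∀ es, g = FGate.inner none es →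
    ∀ e ∈ es, e.1 = ∅ ∨ e.1 = Finset.univ) G

/-- The labels of the edges that leave a node are pairwise disjoint. -/
def Deterministic (G : FDag m) : Prop :=
  Dag.EveryNode (fun g _ => ∀ lab es, g = FGate.inner lab es →
    es.Pairwise fun e e' => Disjoint e.1 e'.1) G

/-- The label of an edge is contained in the labels of all edges for the same variable that
precede it on a path. -/
def Focusing (G : FDag m) : Prop :=
  Dag.EveryNode (fun g below => ∀ i es, g = FGate.inner (some i) es →
    ∀ e ∈ es, ∀ S, (i, S) ∈ tests (below.drop e.2) → S ⊆ e.1) G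

end FDag

def dFSD : Language where
  Rep := FDag
  Mem G := Dag.ArcsInRange FGate.arcs G ∧ G.LabelsOK ∧ G.Deterministic ∧ G.Focusing
  eval := FDag.eval
  enc G := code G

/-! ### EADT: extended affine decision trees -/

/-- `dec δ lo hi` is a decision on the XOR-clause `δ`: `hi` if `δ` is true, `lo` if it is false. -/
inductive ATree (m : ℕ) where
  | leaf (b : Bool)
  | dec (δ : XorClause m) (lo hi : ATree m)
  | conj (cs : List (ATree m))
  | disj (cs : List (ATree m))

namespace ATree

variable {m : ℕ}

mutual

def eval : ATree m → BoolFn m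
  | leaf b => fun _ => b
  | dec δ lo hi => fun x => if XorClause.eval δ x then hi.eval x else lo.eval x
  | conj cs => fun x => evalAll cs x
  | disj cs => fun x => evalAny cs x

def evalAll : List (ATree m) → BoolFn m
  | [] => fun _ => true
  | c :: cs => fun x => c.eval x && evalAll cs x

def evalAny : List (ATree m) → BoolFn m
  | [] => fun _ => false
  | c :: cs => fun x => c.eval x || evalAny cs x

end

mutual

def vars : ATree m → Set (Fin m)
  | leaf _ => ∅
  | dec δ lo hi => XorClause.vars δ ∪ lo.vars ∪ hi.vars
  | conj cs => varsList cs
  | disj cs => varsList cs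

def varsList : List (ATree m) → Set (Fin m)
  | [] => ∅
  | c :: cs => c.vars ∪ varsList cs

end

mutual

def enc : ATree m → SExp
  | leaf b => code ((0 : ℕ), b)
  | dec δ lo hi => SExp.cons (code (1 : ℕ)) (SExp.cons (code δ) (SExp.cons lo.enc hi.enc))
  | conj cs => SExp.cons (code (2 : ℕ)) (encList cs)
  | disj cs => SExp.cons (code (3 : ℕ)) (encList cs)

def encList : List (ATree m) → SExp
  | [] => SExp.nil
  | c :: cs => SExp.cons c.enc (encList cs)

end

/-- Affine decomposability of a node with the children `cs`, below decision nodes with the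
labels `anc`: the children have pairwise no common variable, and they are not linked to one
another by the labels either. That is, the variables can be split into blocks, the `j`-th of
which holds the variables of the `j`-th child, such that no label of a decision node above
meets two blocks. -/
def AffineDecomposable (anc : List (XorClause m)) (cs : List (ATree m)) : Prop :=
  ∃ block : Fin m → ℕ,
    (∀ (j : ℕ) (c : ATree m), cs[j]? = some c → ∀ i ∈ c.vars, block i = j) ∧
    (∀ δ ∈ anc, ∀ i ∈ XorClause.vars δ, ∀ i' ∈ XorClause.vars δ, block i = block i')

mutual

/-- Every conjunction and every disjunction in the tree is affine decomposable, where `anc` lists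
the labels of the decision nodes above the tree. -/
def Extended (anc : List (XorClause m)) : ATree m → Prop
  | leaf _ => True
  | dec δ lo hi => lo.Extended (δ :: anc) ∧ hi.Extended (δ :: anc)
  | conj cs => AffineDecomposable anc cs ∧ ExtendedList anc cs
  | disj cs => AffineDecomposable anc cs ∧ ExtendedList anc cs

def ExtendedList (anc : List (XorClause m)) : List (ATree m) → Prop
  | [] => True
  | c :: cs => c.Extended anc ∧ ExtendedList anc cs

end

end ATree

def EADT : Language where
  Rep := ATree
  Mem T := T.Extended []
  eval := ATree.eval
  enc := ATree.enc

end KC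

namespace KC
open Encode (code)

/-! ### Polynomial-time computable functions -/

theorem polyEval_mono (p : Polynomial ℕ) {a b : ℕ} (h : a ≤ b) : p.eval a ≤ p.eval b := by
  induction p using Polynomial.induction_on' with
  | add p q hp hq => simpa using add_le_add hp hq
  | monomial n c => simpa using Nat.mul_le_mul_left c (Nat.pow_le_pow_left h n)

/-- Renumbering of the functions that are called. -/
def Code.shift (n : ℕ) : Code → Code
  | arg => arg
  | nil => nil
  | cons a b => cons (a.shift n) (b.shift n)
  | hd a => hd (a.shift n)
  | tl a => tl (a.shift n)
  | ite c a b => ite (c.shift n) (a.shift n) (b.shift n)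
  | call k e => call (k + n) (e.shift n)

theorem Eval.shift {P Q : Program} {n : ℕ}
    (h : ∀ k b, P[k]? = some b → Q[k + n]? = some (b.shift n)) {d w : SExp} {e : Code} {t : ℕ}
    (he : Eval P d e w t) : Eval Q d (e.shift n) w t := by
  induction he with
  | arg d => exact .arg d
  | nil d => exact .nil d
  | cons _ _ iha ihb => exact .cons iha ihb
  | hd _ ih => exact .hd ih
  | tl _ ih => exact .tl ih
  | iteTrue _ _ ihc iha => exact .iteTrue ihc iha
  | iteFalse _ _ ihc iha => exact .iteFalse ihc iha
  | call _ hf _ ihe ihb => exact .call ihe (h _ _ hf) ihb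

theorem Eval.mono {P Q : Program} (h : ∀ (k : ℕ) (b : Code), P[k]? = some b → Q[k]? = some b) {d w : SExp}
    {e : Code} {t : ℕ} (he : Eval P d e w t) : Eval Q d e w t := by
  induction he with
  | arg d => exact .arg d
  | nil d => exact .nil d
  | cons _ _ iha ihb => exact .cons iha ihb
  | hd _ ih => exact .hd ih
  | tl _ ih => exact .tl ih
  | iteTrue _ _ ihc iha => exact .iteTrue ihc iha
  | iteFalse _ _ ihc iha => exact .iteFalse ihc iha
  | call _ hf _ ihe ihb => exact .call ihe (h _ _ hf) ihb

/-- The expression `e` of the program `P` computes `f` with the bound `p` on the number of steps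
and on the size of the value. -/
def Realizes {α β : Type} [Encode α] [Encode β] (P : Program) (e : Code) (p : Polynomial ℕ)
    (f : α → β) : Prop :=
  ∀ a, (∃ t ≤ p.eval (code a).size, Eval P (code a) e (code (f a)) t) ∧
    (code (f a)).size ≤ p.eval (code a).size

/-- `f` is computable in polynomial time, with values of polynomial size. -/
@[fun_prop]
def PT {α β : Type} [Encode α] [Encode β] (f : α → β) : Prop :=
  ∃ P e p, Realizes P e p f

section core

variable {α β γ δ : Type} [Encode α] [Encode β] [Encode γ] [Encode δ]

theorem Realizes.mono {P Q : Program} {e : Code} {p q : Polynomial ℕ} {f : α → β}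
    (h : Realizes P e p f) (hPQ : P <+: Q) (hpq : ∀ n, p.eval n ≤ q.eval n) :
    Realizes Q e q f := by
  obtain ⟨R, rfl⟩ := hPQ
  intro a
  obtain ⟨⟨t, ht, he⟩, hs⟩ := h a
  refine ⟨⟨t, ht.trans (hpq _), he.mono fun k b hk => ?_⟩, hs.trans (hpq _)⟩
  rw [List.getElem?_append_left (List.getElem?_eq_some_iff.1 hk).1, hk]

/-- A computable function can be added to any program. -/
theorem PT.link {f : α → β} (hf : PT f) (P : Program) :
    ∃ Q e q, P <+: Q ∧ Realizes Q e q f := by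
  obtain ⟨R, e, p, h⟩ := hf
  refine ⟨P ++ R.map (Code.shift P.length), e.shift P.length, p, List.prefix_append _ _,
    fun a => ?_⟩
  obtain ⟨⟨t, ht, he⟩, hs⟩ := h a
  refine ⟨⟨t, ht, he.shift fun k b hk => ?_⟩, hs⟩
  rw [List.getElem?_append_right (by omega)]
  simp [hk]

theorem PT.link₂ {f : α → β} {g : γ → δ} (hf : PT f) (hg : PT g) :
    ∃ P e₁ e₂ p, Realizes P e₁ p f ∧ Realizes P e₂ p g := by
  obtain ⟨P, e₁, p, h₁⟩ := hf
  obtain ⟨Q, e₂, q, hPQ, h₂⟩ := hg.link P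
  exact ⟨Q, e₁, e₂, p + q, h₁.mono hPQ (by simp), h₂.mono (List.prefix_refl _) (by simp)⟩

theorem PT.link₃ {ε ζ : Type} [Encode ε] [Encode ζ] {f : α → β} {g : γ → δ} {h : ε → ζ}
    (hf : PT f) (hg : PT g) (hh : PT h) :
    ∃ P e₁ e₂ e₃ p, Realizes P e₁ p f ∧ Realizes P e₂ p g ∧ Realizes P e₃ p h := by
  obtain ⟨P, e₁, e₂, p, h₁, h₂⟩ := hf.link₂ hg
  obtain ⟨Q, e₃, q, hPQ, h₃⟩ := hh.link P
  exact ⟨Q, e₁, e₂, e₃, p + q, h₁.mono hPQ (by simp), h₂.mono hPQ (by simp),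
    h₃.mono (List.prefix_refl _) (by simp)⟩

theorem PT.congr_code {f : α → β} {g : α → γ} (hg : PT g) (h : ∀ a, code (f a) = code (g a)) :
    PT f := by
  obtain ⟨P, e, p, hp⟩ := hg
  exact ⟨P, e, p, fun a => by rw [h]; exact hp a⟩

theorem PT.of_code_eq {f : α → β} (h : ∀ a, code (f a) = code a) : PT f :=
  ⟨[], Code.arg, Polynomial.X + 1, fun a =>
    ⟨⟨1, by simp, by rw [h]; exact .arg _⟩, by simp [h]⟩⟩

@[fun_prop]
theorem PT.id : PT (fun a : α => a) := PT.of_code_eq fun _ => rfl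

theorem eval_const (P : Program) (s : SExp) : ∃ e t, ∀ d, Eval P d e s t := by
  induction s with
  | nil => exact ⟨_, _, fun d => .nil d⟩
  | cons a b iha ihb =>
    obtain ⟨e, t, h⟩ := iha
    obtain ⟨e', t', h'⟩ := ihb
    exact ⟨_, _, fun d => .cons (h d) (h' d)⟩

@[fun_prop]
theorem PT.const (b : β) : PT (fun _ : α => b) := by
  obtain ⟨e, t, h⟩ := eval_const [] (code b)
  exact ⟨[], e, Polynomial.C (t + (code b).size), fun a => ⟨⟨t, by simp, h _⟩, by simp⟩⟩

@[fun_prop]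
theorem PT.comp {g : β → γ} {f : α → β} (hg : PT g) (hf : PT f) : PT (fun a => g (f a)) := by
  obtain ⟨P, e₁, e₂, p, h₁, h₂⟩ := hf.link₂ hg
  refine ⟨P ++ [e₂], Code.call P.length e₁, p + p.comp p + 1, fun a => ?_⟩
  obtain ⟨⟨t, ht, he⟩, hs⟩ := h₁.mono (List.prefix_append P [e₂]) (fun _ => le_rfl) a
  obtain ⟨⟨t', ht', he'⟩, hs'⟩ := h₂.mono (List.prefix_append P [e₂]) (fun _ => le_rfl) (f a)
  have := polyEval_mono p hs
  refine ⟨⟨t + t' + 1, ?_, .call he (by simp) he'⟩, ?_⟩ <;> simp <;> omega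

instance : Encode SExp where
  code s := s

@[fun_prop]
theorem PT.toSExp : PT (Encode.code : α → SExp) := PT.of_code_eq fun _ => rfl

@[fun_prop]
theorem PT.mk {f : α → β} {g : α → γ} (hf : PT f) (hg : PT g) : PT (fun a => (f a, g a)) := by
  obtain ⟨P, e₁, e₂, p, h₁, h₂⟩ := hf.link₂ hg
  refine ⟨P, Code.cons e₁ e₂, p + p + 1, fun a => ?_⟩
  obtain ⟨⟨t, ht, he⟩, hs⟩ := h₁ a
  obtain ⟨⟨t', ht', he'⟩, hs'⟩ := h₂ a
  refine ⟨⟨t + t' + 1, ?_, .cons he he'⟩, ?_⟩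
  · simp; omega
  · simp [Encode.code, SExp.size] at *; omega

@[fun_prop]
theorem PT.sexp_cons {f g : α → SExp} (hf : PT f) (hg : PT g) :
    PT (fun a => SExp.cons (f a) (g a)) :=
  (hf.mk hg).congr_code fun _ => rfl

theorem SExp.size_pos (s : SExp) : 0 < s.size := by cases s <;> simp [SExp.size]

theorem SExp.size_hd_le (s : SExp) : s.hd.size ≤ s.size := by
  cases s <;> simp [SExp.size, SExp.hd]; omega

theorem SExp.size_tl_le (s : SExp) : s.tl.size ≤ s.size := by
  cases s <;> simp [SExp.size, SExp.tl]; omega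

@[fun_prop]
theorem PT.hd : PT SExp.hd :=
  ⟨[], Code.hd Code.arg, Polynomial.X + 2, fun a =>
    ⟨⟨2, by simp, .hd (.arg _)⟩, by have := a.size_hd_le; simp [Encode.code]; omega⟩⟩

@[fun_prop]
theorem PT.tl : PT SExp.tl :=
  ⟨[], Code.tl Code.arg, Polynomial.X + 2, fun a =>
    ⟨⟨2, by simp, .tl (.arg _)⟩, by have := a.size_tl_le; simp [Encode.code]; omega⟩⟩

@[fun_prop]
theorem PT.fst : PT (Prod.fst : α × β → α) :=
  (PT.hd.comp PT.toSExp).congr_code fun _ => rfl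

@[fun_prop]
theorem PT.snd : PT (Prod.snd : α × β → β) :=
  (PT.tl.comp PT.toSExp).congr_code fun _ => rfl

@[fun_prop]
theorem PT.bcond {c : α → Bool} {f g : α → β} (hc : PT c) (hf : PT f) (hg : PT g) :
    PT (fun a => cond (c a) (f a) (g a)) := by
  obtain ⟨P, e₁, e₂, e₃, p, h₁, h₂, h₃⟩ := hc.link₃ hf hg
  refine ⟨P, Code.ite e₁ e₂ e₃, p + p + 1, fun a => ?_⟩
  obtain ⟨⟨t, ht, he⟩, hs⟩ := h₁ a
  obtain ⟨⟨t', ht', he'⟩, hs'⟩ := h₂ a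
  obtain ⟨⟨t'', ht'', he''⟩, hs''⟩ := h₃ a
  cases hca : c a
  · rw [hca] at he
    simp only [hca, Bool.cond_false]
    refine ⟨⟨t + t'' + 1, ?_, .iteFalse he he''⟩, ?_⟩ <;> simp <;> omega
  · rw [hca] at he
    simp only [hca, Bool.cond_true]
    refine ⟨⟨t + t' + 1, ?_, .iteTrue he he'⟩, ?_⟩ <;> simp <;> omega

def SExp.isCons : SExp → Bool
  | nil => false
  | cons _ _ => true

@[fun_prop]
theorem PT.isCons : PT SExp.isCons :=
  ⟨[], Code.ite Code.arg (Code.cons Code.nil Code.nil) Code.nil, 5, fun a => by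
    cases a with
    | nil => exact ⟨⟨3, by simp, .iteFalse (.arg _) (.nil _)⟩, by simp [Encode.code, SExp.isCons, SExp.size]⟩
    | cons a b => exact ⟨⟨5, by simp, .iteTrue (.arg _) (.cons (.nil _) (.nil _))⟩,
        by simp [Encode.code, SExp.isCons, SExp.size]⟩⟩

theorem size_code_pos (a : α) : 0 < (code a).size := SExp.size_pos _

theorem size_code_pair (a : α) (b : β) :
    (code (a, b)).size = (code a).size + (code b).size + 1 := rfl

theorem size_code_cons (a : α) (l : List α) :
    (code (a :: l)).size = (code a).size + (code l).size + 1 := rfl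

theorem length_le_size (l : List α) : l.length ≤ (code l).size := by
  induction l with
  | nil => simp
  | cons a l ih => rw [size_code_cons]; simp; omega

theorem size_bool_le (b : Bool) : (code b).size ≤ 3 := by
  cases b <;> simp [Encode.code, SExp.size]

/-- Primitive recursion on lists. -/
def listRec {σ : Type} (init : σ) (step : β → List β → σ → σ) : List β → σ
  | [] => init
  | b :: l => step b l (listRec init step l)

omit [Encode β] in
theorem listRec_foldr {σ : Type} (init : σ) (step : β → σ → σ) (l : List β) :
    listRec init (fun b _ s => step b s) l = l.foldr step init := by
  induction l with
  | nil => rfl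
  | cons b l ih => simp [listRec, ih]

theorem PT.size_bound {f : α → β} (hf : PT f) :
    ∃ q : Polynomial ℕ, ∀ a, (Encode.code (f a)).size ≤ q.eval (Encode.code a).size := by
  obtain ⟨_, _, p, h⟩ := hf
  exact ⟨p, fun a => (h a).2⟩

/-- Recursion on lists, if all values have polynomial size. -/
theorem PT.listRecursion_of_bound {σ : Type} [Encode σ] {init : α → σ}
    {step : α → β → List β → σ → σ} {l : α → List β} (hi : PT init)
    (hs : PT (fun p : α × β × List β × σ => step p.1 p.2.1 p.2.2.1 p.2.2.2)) (hl : PT l)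
    (q : Polynomial ℕ)
    (hq : ∀ a t, (Encode.code (listRec (init a) (step a) t)).size ≤
      q.eval ((Encode.code a).size + (Encode.code t).size)) :
    PT (fun a => listRec (init a) (step a) (l a)) := by
  suffices h : PT (fun p : α × List β => KC.listRec (init p.1) (step p.1) p.2) from
    h.comp (PT.id.mk hl)
  obtain ⟨P, e₁, e₂, p, h₁, h₂⟩ := hi.link₂ hs
  set n := P.length with hn
  let A := Code.hd Code.arg
  let L := Code.tl Code.arg
  let body := Code.ite L
    (Code.call (n + 1) (Code.cons A (Code.cons (Code.hd L) (Code.cons (Code.tl L)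
      (Code.call (n + 2) (Code.cons A (Code.tl L)))))))
    (Code.call n A)
  let Q : Program := P ++ [e₁, e₂, body]
  have hPQ : P <+: Q := List.prefix_append _ _
  have H₁ := h₁.mono hPQ (fun _ => le_rfl)
  have H₂ := h₂.mono hPQ (fun _ => le_rfl)
  have q0 : Q[n]? = some e₁ := by simp [Q, n]
  have q1 : Q[n + 1]? = some e₂ := by simp [Q, n]
  have q2 : Q[n + 2]? = some body := by simp [Q, n]
  have htime : ∀ (a : α) (N : ℕ) (l : List β), (Encode.code a).size + (Encode.code l).size ≤ N →
      ∃ t, t ≤ (l.length + 1) * (p.eval (N + q.eval N + 3) + 30) ∧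
        Eval Q (Encode.code (a, l)) body
          (Encode.code (KC.listRec (init a) (step a) l)) t := by
    intro a N l
    induction l with
    | nil =>
      intro h
      obtain ⟨t, ht, he⟩ := (H₁ a).1
      have h' : (Encode.code a).size ≤ N + q.eval N + 3 := by omega
      have := polyEval_mono p h'
      refine ⟨_, ?_, .iteFalse (.tl (.arg _)) (.call (.hd (.arg _)) q0 he)⟩
      simp; omega
    | cons b l ih =>
      intro h
      rw [size_code_cons] at h
      have h1 := (hq a l).trans (polyEval_mono q (show _ ≤ N by omega))
      obtain ⟨t, ht, he⟩ := ih (by omega)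
      obtain ⟨t', ht', he'⟩ := (H₂ (a, b, l, KC.listRec (init a) (step a) l)).1
      have h4 : (Encode.code (a, b, l, KC.listRec (init a) (step a) l)).size ≤
          N + q.eval N + 3 := by
        simp only [size_code_pair]; omega
      have h5 := polyEval_mono p h4
      refine ⟨_, ?_, .iteTrue (.tl (.arg _)) (.call (.cons (.hd (.arg _)) (.cons (.hd (.tl (.arg _)))
        (.cons (.tl (.tl (.arg _))) (.call (.cons (.hd (.arg _)) (.tl (.tl (.arg _)))) q2 he))))
        q1 he')⟩
      simp only [List.length_cons]
      rw [Nat.add_mul (l.length + 1) 1]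
      omega
  let X : Polynomial ℕ := Polynomial.X
  refine ⟨Q, body, (X + 1) * (p.comp (X + q + 3) + 30) + q, fun ⟨a, l⟩ => ?_⟩
  have hN : (Encode.code a).size + (Encode.code l).size ≤ (Encode.code (a, l)).size := by
    rw [size_code_pair]; omega
  have hlen : l.length ≤ (Encode.code (a, l)).size := by
    have := length_le_size l
    omega
  obtain ⟨t, ht, he⟩ := htime a _ l hN
  have h1 := (hq a l).trans (polyEval_mono q hN)
  simp only [X, Polynomial.eval_add, Polynomial.eval_mul, Polynomial.eval_comp,
    Polynomial.eval_X, Polynomial.eval_one, Polynomial.eval_ofNat]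
  refine ⟨⟨t, ht.trans ?_, he⟩, h1.trans (Nat.le_add_left _ _)⟩
  exact (Nat.mul_le_mul_right _ (by omega)).trans (Nat.le_add_right _ _)

/-- Recursion on lists, if the sizes of the values grow slowly. -/
theorem PT.listRecursion {σ : Type} [Encode σ] {init : α → σ} {step : α → β → List β → σ → σ}
    {l : α → List β} (hi : PT init)
    (hs : PT (fun p : α × β × List β × σ => step p.1 p.2.1 p.2.2.1 p.2.2.2)) (hl : PT l)
    (q : Polynomial ℕ)
    (hq : ∀ a b t s, (Encode.code (step a b t s)).size ≤ (Encode.code s).size +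
      q.eval ((Encode.code a).size + (Encode.code (b :: t)).size)) :
    PT (fun a => listRec (init a) (step a) (l a)) := by
  obtain ⟨p, hp⟩ := hi.size_bound
  refine PT.listRecursion_of_bound hi hs hl (p + Polynomial.X * q) fun a l => ?_
  have hsize : ∀ (N : ℕ) (l : List β), (Encode.code a).size + (Encode.code l).size ≤ N →
      (Encode.code (KC.listRec (init a) (step a) l)).size ≤ p.eval N + l.length * q.eval N := by
    intro N l
    induction l with
    | nil =>
      intro h
      have := hp a
      have := polyEval_mono p (show (Encode.code a).size ≤ N by omega)
      simp [KC.listRec]; omega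
    | cons b l ih =>
      intro h
      have h1 := hq a b l (KC.listRec (init a) (step a) l)
      have h2 := polyEval_mono q h
      rw [size_code_cons] at h
      have h3 := ih (by omega)
      simp only [KC.listRec, List.length_cons, Nat.add_mul]; omega
  refine (hsize _ l le_rfl).trans ?_
  have hlen := length_le_size l
  simp only [Polynomial.eval_add, Polynomial.eval_mul, Polynomial.eval_X]
  exact Nat.add_le_add_left (Nat.mul_le_mul_right _ (by omega)) _

/-- Recursion on trees, where a context is handed down. -/
def treeRec {κ : Type} (base : κ → Bool) (down₁ down₂ : κ → SExp → SExp → κ)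
    (comb : κ → SExp → SExp → Bool → Bool → Bool) : SExp → κ → Bool
  | SExp.nil, k => base k
  | SExp.cons a b, k => comb k a b (treeRec base down₁ down₂ comb a (down₁ k a b))
      (treeRec base down₁ down₂ comb b (down₂ k a b))

theorem PT.treeRecursion {base : α → Bool} {down₁ down₂ : α → SExp → SExp → α}
    {comb : α → SExp → SExp → Bool → Bool → Bool} (hb : PT base)
    (h₁ : PT (fun p : α × SExp × SExp => down₁ p.1 p.2.1 p.2.2))
    (h₂ : PT (fun p : α × SExp × SExp => down₂ p.1 p.2.1 p.2.2))
    (hc : PT (fun p : α × SExp × SExp × Bool × Bool =>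
      comb p.1 p.2.1 p.2.2.1 p.2.2.2.1 p.2.2.2.2))
    (q : Polynomial ℕ)
    (hq₁ : ∀ k a b, (Encode.code (down₁ k a b)).size ≤
      (Encode.code k).size + q.eval (a.size + b.size))
    (hq₂ : ∀ k a b, (Encode.code (down₂ k a b)).size ≤
      (Encode.code k).size + q.eval (a.size + b.size)) :
    PT (fun p : SExp × α => treeRec base down₁ down₂ comb p.1 p.2) := by
  obtain ⟨P₀, e₀, e₁, e₂, p₀, H₀, H₁, H₂⟩ := hb.link₃ h₁ h₂
  obtain ⟨P, e₃, p₁, hP, H₃⟩ := hc.link P₀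
  let p := p₀ + p₁
  have hp₀ : ∀ n, p₀.eval n ≤ p.eval n := fun n => by simp [p]
  have hp₁ : ∀ n, p₁.eval n ≤ p.eval n := fun n => by simp [p]
  set n := P.length with hn
  let S := Code.hd Code.arg
  let K := Code.tl Code.arg
  let D := Code.cons K (Code.cons (Code.hd S) (Code.tl S))
  let body := Code.ite S
    (Code.call (n + 3) (Code.cons K (Code.cons (Code.hd S) (Code.cons (Code.tl S)
      (Code.cons (Code.call (n + 4) (Code.cons (Code.hd S) (Code.call (n + 1) D)))
        (Code.call (n + 4) (Code.cons (Code.tl S) (Code.call (n + 2) D))))))))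
    (Code.call n K)
  let Q : Program := P ++ [e₀, e₁, e₂, e₃, body]
  have hPQ : P <+: Q := List.prefix_append _ _
  replace H₀ := H₀.mono (hP.trans hPQ) hp₀
  replace H₁ := H₁.mono (hP.trans hPQ) hp₀
  replace H₂ := H₂.mono (hP.trans hPQ) hp₀
  replace H₃ := H₃.mono hPQ hp₁
  have g0 : Q[n]? = some e₀ := by simp [Q, n]
  have g1 : Q[n + 1]? = some e₁ := by simp [Q, n]
  have g2 : Q[n + 2]? = some e₂ := by simp [Q, n]
  have g3 : Q[n + 3]? = some e₃ := by simp [Q, n]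
  have g4 : Q[n + 4]? = some body := by simp [Q, n]
  have htime : ∀ (N B : ℕ) (s : SExp) (k : α), s.size ≤ N →
      (Encode.code k).size + s.size * q.eval N ≤ B →
      ∃ t, t ≤ s.size * (3 * p.eval (N + B + 10) + 60) ∧
        Eval Q (Encode.code (s, k)) body
          (Encode.code (treeRec base down₁ down₂ comb s k)) t := by
    intro N B s
    induction s with
    | nil =>
      intro k _ hB
      obtain ⟨t, ht, he⟩ := (H₀ k).1
      have := polyEval_mono p (show (Encode.code k).size ≤ N + B + 10 by omega)
      refine ⟨_, ?_, .iteFalse (.hd (.arg _)) (.call (.tl (.arg _)) g0 he)⟩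
      simp [SExp.size]; omega
    | cons a b iha ihb =>
      intro k hN hB
      simp only [SExp.size] at hN hB
      have hqN := polyEval_mono q (show a.size + b.size ≤ N by omega)
      have hk₁ := hq₁ k a b
      have hk₂ := hq₂ k a b
      rw [Nat.add_mul, Nat.add_mul, one_mul] at hB
      obtain ⟨ta, hta, hea⟩ := iha (down₁ k a b) (by omega) (by omega)
      obtain ⟨tb, htb, heb⟩ := ihb (down₂ k a b) (by omega) (by omega)
      obtain ⟨t1, ht1, he1⟩ := (H₁ (k, a, b)).1
      obtain ⟨t2, ht2, he2⟩ := (H₂ (k, a, b)).1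
      obtain ⟨t3, ht3, he3⟩ := (H₃ (k, a, b,
        treeRec base down₁ down₂ comb a (down₁ k a b),
        treeRec base down₁ down₂ comb b (down₂ k a b))).1
      have hab : (Encode.code a).size + (Encode.code b).size + 1 ≤ N := hN
      have hs1 : (Encode.code (k, a, b)).size ≤ N + B + 10 := by
        simp only [size_code_pair]; omega
      have hs3 : (Encode.code (k, a, b,
          treeRec base down₁ down₂ comb a (down₁ k a b),
          treeRec base down₁ down₂ comb b (down₂ k a b))).size ≤ N + B + 10 := by
        have := size_bool_le (treeRec base down₁ down₂ comb a (down₁ k a b))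
        have := size_bool_le (treeRec base down₁ down₂ comb b (down₂ k a b))
        simp only [size_code_pair]; omega
      have hp1 := polyEval_mono p hs1
      have hp3 := polyEval_mono p hs3
      have E1 := Eval.call (P := Q) (d := Encode.code (SExp.cons a b, k))
        (.cons (.tl (.arg _)) (.cons (.hd (.hd (.arg _))) (.tl (.hd (.arg _))))) g1 he1
      have E2 := Eval.call (P := Q) (d := Encode.code (SExp.cons a b, k))
        (.cons (.tl (.arg _)) (.cons (.hd (.hd (.arg _))) (.tl (.hd (.arg _))))) g2 he2
      have Ea := Eval.call (P := Q) (d := Encode.code (SExp.cons a b, k))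
        (.cons (.hd (.hd (.arg _))) E1) g4 hea
      have Eb := Eval.call (P := Q) (d := Encode.code (SExp.cons a b, k))
        (.cons (.tl (.hd (.arg _))) E2) g4 heb
      refine ⟨_, ?_, .iteTrue (.hd (.arg _)) (.call (.cons (.tl (.arg _))
        (.cons (.hd (.hd (.arg _))) (.cons (.tl (.hd (.arg _))) (.cons Ea Eb)))) g3 he3)⟩
      simp only [SExp.size, Nat.add_mul, one_mul]
      omega
  let X : Polynomial ℕ := Polynomial.X
  refine ⟨Q, body, X * (3 * p.comp (X + (X + X * q) + 10) + 60) + 3, fun ⟨s, k⟩ => ?_⟩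
  have hsz : (Encode.code (s, k)).size = s.size + (Encode.code k).size + 1 := rfl
  set N := (Encode.code (s, k)).size
  have hN : s.size ≤ N := by omega
  obtain ⟨t, ht, he⟩ := htime N (N + N * q.eval N) s k hN
    (Nat.add_le_add (by omega) (Nat.mul_le_mul_right _ hN))
  simp only [X, Polynomial.eval_add, Polynomial.eval_mul, Polynomial.eval_comp,
    Polynomial.eval_X, Polynomial.eval_ofNat]
  refine ⟨⟨t, ht.trans ((Nat.mul_le_mul_right _ hN).trans (Nat.le_add_right _ _)), he⟩, ?_⟩
  exact (size_bool_le _).trans (Nat.le_add_left _ _)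

end core
end KC

namespace KC
open Encode (code)

section lib

variable {α β γ σ : Type} [Encode α] [Encode β] [Encode γ] [Encode σ]

/-! ### Booleans -/

@[fun_prop]
theorem PT.and {f g : α → Bool} (hf : PT f) (hg : PT g) : PT (fun a => f a && g a) := by
  have : (fun a => f a && g a) = fun a => cond (f a) (g a) false := by
    funext a; cases f a <;> rfl
  rw [this]; fun_prop

@[fun_prop]
theorem PT.or {f g : α → Bool} (hf : PT f) (hg : PT g) : PT (fun a => f a || g a) := by
  have : (fun a => f a || g a) = fun a => cond (f a) true (g a) := by
    funext a; cases f a <;> rfl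
  rw [this]; fun_prop

@[fun_prop]
theorem PT.not {f : α → Bool} (hf : PT f) : PT (fun a => !f a) := by
  have : (fun a => !f a) = fun a => cond (f a) false true := by
    funext a; cases f a <;> rfl
  rw [this]; fun_prop

@[fun_prop]
theorem PT.xor {f g : α → Bool} (hf : PT f) (hg : PT g) : PT (fun a => f a ^^ g a) := by
  have : (fun a => f a ^^ g a) = fun a => cond (f a) (!g a) (g a) := by
    funext a; cases f a <;> simp
  rw [this]; fun_prop

@[fun_prop]
theorem PT.bool_beq {f g : α → Bool} (hf : PT f) (hg : PT g) : PT (fun a => f a == g a) := by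
  have : (fun a => f a == g a) = fun a => cond (f a) (g a) (!g a) := by
    funext a; cases f a <;> simp
  rw [this]; fun_prop

/-! ### Options -/

@[fun_prop]
theorem PT.some {f : α → β} (hf : PT f) : PT (fun a => some (f a)) :=
  (PT.sexp_cons (PT.const SExp.nil) (PT.toSExp.comp hf)).congr_code fun _ => rfl

@[fun_prop]
theorem PT.isSome {f : α → Option β} (hf : PT f) : PT (fun a => (f a).isSome) :=
  (PT.isCons.comp (PT.toSExp.comp hf)).congr_code fun a => by cases f a <;> rfl

@[fun_prop]
theorem PT.getD {f : α → Option β} {g : α → β} (hf : PT f) (hg : PT g) :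
    PT (fun a => (f a).getD (g a)) := by
  refine PT.congr_code (g := fun a => cond (f a).isSome (SExp.tl (code (f a))) (code (g a)))
    (by fun_prop) fun a => ?_
  cases f a <;> rfl

/-! ### Lists -/

@[fun_prop]
theorem PT.list_cons {f : α → β} {g : α → List β} (hf : PT f) (hg : PT g) :
    PT (fun a => f a :: g a) :=
  (PT.sexp_cons (PT.toSExp.comp hf) (PT.toSExp.comp hg)).congr_code fun _ => rfl

@[fun_prop]
theorem PT.tail {f : α → List β} (hf : PT f) : PT (fun a => (f a).tail) :=
  (PT.tl.comp (PT.toSExp.comp hf)).congr_code fun a => by cases f a <;> rfl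

@[fun_prop]
theorem PT.headD {f : α → List β} {g : α → β} (hf : PT f) (hg : PT g) :
    PT (fun a => (f a).headD (g a)) := by
  refine PT.congr_code (g := fun a => cond (SExp.isCons (code (f a)))
    (SExp.hd (code (f a))) (code (g a))) (by fun_prop) fun a => ?_
  cases f a <;> rfl

theorem PT.foldr {init : α → σ} {step : α → β → σ → σ} {l : α → List β} (hi : PT init)
    (hs : PT (fun p : α × β × σ => step p.1 p.2.1 p.2.2)) (hl : PT l)
    (q : Polynomial ℕ)
    (hq : ∀ a b s, (Encode.code (step a b s)).size ≤ (Encode.code s).size +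
      q.eval ((Encode.code a).size + (Encode.code b).size)) :
    PT (fun a => (l a).foldr (step a) (init a)) := by
  have h := PT.listRecursion (step := fun a b _ s => step a b s) hi
    (hs.comp (g := fun p : α × β × σ => step p.1 p.2.1 p.2.2)
      (f := fun p : α × β × List β × σ => (p.1, p.2.1, p.2.2.2)) (by fun_prop)) hl q
    (fun a b t s => (hq a b s).trans (Nat.add_le_add_left
      (polyEval_mono q (by rw [size_code_cons]; omega)) _))
  simpa only [listRec_foldr] using h

/-- The size condition is void for values of bounded size. -/
theorem PT.foldr_bool {init : α → Bool} {step : α → β → Bool → Bool} {l : α → List β}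
    (hi : PT init) (hs : PT (fun p : α × β × Bool => step p.1 p.2.1 p.2.2)) (hl : PT l) :
    PT (fun a => (l a).foldr (step a) (init a)) :=
  PT.foldr hi hs hl 3 fun a b s => by
    have := size_bool_le (step a b s)
    simp; omega

@[fun_prop]
theorem PT.any {f : α → β → Bool} {l : α → List β}
    (hf : PT (fun p : α × β => f p.1 p.2)) (hl : PT l) : PT (fun a => (l a).any (f a)) := by
  have h := PT.foldr_bool (α := α) (step := fun a b s => f a b || s) (PT.const false)
    (PT.or (hf.comp (f := fun p : α × β × Bool => (p.1, p.2.1)) (by fun_prop)) (by fun_prop)) hl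
  have e : (fun a => (l a).any (f a)) =
      fun a => (l a).foldr (fun b s => f a b || s) false := by
    funext a; induction l a <;> simp_all
  rw [e]; exact h

@[fun_prop]
theorem PT.all {f : α → β → Bool} {l : α → List β}
    (hf : PT (fun p : α × β => f p.1 p.2)) (hl : PT l) : PT (fun a => (l a).all (f a)) := by
  have h : PT (fun a => !(l a).any (fun b => !f a b)) := by fun_prop
  have e : (fun a => (l a).all (f a)) = fun a => !(l a).any (fun b => !f a b) := by
    funext a; induction l a <;> simp_all
  rw [e]; exact h

@[fun_prop]
theorem PT.append {f g : α → List β} (hf : PT f) (hg : PT g) : PT (fun a => f a ++ g a) := by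
  have h := PT.foldr (α := α) (step := fun _ b s => b :: s) hg (by fun_prop) hf
    (Polynomial.X + 1) (fun a b s => by rw [size_code_cons]; simp; omega)
  have e : (fun a => f a ++ g a) = fun a => (f a).foldr (fun b s => b :: s) (g a) := by
    funext a; simp
  rw [e]; exact h

theorem size_code_append (l l' : List β) :
    (code (l ++ l')).size + 1 = (code l).size + (code l').size := by
  induction l with
  | nil => simp [Encode.code, codeList, SExp.size]; omega
  | cons b l ih => simp only [List.cons_append, size_code_cons]; omega

@[fun_prop]
theorem PT.map {f : α → β → γ} {l : α → List β}
    (hf : PT (fun p : α × β => f p.1 p.2)) (hl : PT l) : PT (fun a => (l a).map (f a)) := by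
  obtain ⟨q, hq⟩ := hf.size_bound
  have h := PT.foldr (α := α) (step := fun a b s => f a b :: s) (PT.const [])
    (PT.list_cons (hf.comp (f := fun p : α × β × List γ => (p.1, p.2.1)) (by fun_prop))
      (by fun_prop)) hl (q.comp (Polynomial.X + 1) + 1) (fun a b s => by
      have := hq (a, b)
      rw [size_code_pair] at this
      simp only at this
      rw [size_code_cons]; simp; omega)
  have e : (fun a => (l a).map (f a)) = fun a => (l a).foldr (fun b s => f a b :: s) [] := by
    funext a; induction l a <;> simp_all
  rw [e]; exact h

@[fun_prop]
theorem PT.filter {f : α → β → Bool} {l : α → List β}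
    (hf : PT (fun p : α × β => f p.1 p.2)) (hl : PT l) : PT (fun a => (l a).filter (f a)) := by
  have h := PT.foldr (α := α) (step := fun a b s => cond (f a b) (b :: s) s) (PT.const [])
    (PT.bcond (hf.comp (f := fun p : α × β × List β => (p.1, p.2.1)) (by fun_prop))
      (by fun_prop) (by fun_prop)) hl (Polynomial.X + 1) (fun a b s => by
      cases f a b
      · simp
      · simp only [Bool.cond_true]; rw [size_code_cons]; simp; omega)
  have e : (fun a => (l a).filter (f a)) =
      fun a => (l a).foldr (fun b s => cond (f a b) (b :: s) s) [] := by
    funext a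
    induction l a with
    | nil => rfl
    | cons b l ih => simp only [List.filter_cons, List.foldr_cons, ih]; cases f a b <;> simp
  rw [e]; exact h

/-! ### Natural numbers -/

theorem code_replicate (n : ℕ) : code (List.replicate n false) = code n := by
  induction n with
  | zero => rfl
  | succ n ih => rw [List.replicate_succ]; exact congrArg (SExp.cons SExp.nil) ih

theorem size_code_nat (n : ℕ) : (code n).size = 2 * n + 1 := by
  induction n with
  | zero => rfl
  | succ n ih =>
    have : (code (n + 1)).size = 1 + (code n).size + 1 := rfl
    omega

theorem PT.unary : PT (fun n : ℕ => List.replicate n false) := PT.of_code_eq code_replicate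

@[fun_prop]
theorem PT.replicate {f : α → ℕ} {g : α → β} (hf : PT f) (hg : PT g) :
    PT (fun a => List.replicate (f a) (g a)) := by
  have h : PT (fun a => (List.replicate (f a) false).map (fun _ => g a)) := by
    have := PT.unary.comp hf
    fun_prop
  simpa only [List.map_replicate] using h

/-- Iteration. -/
theorem PT.iterate {n : α → ℕ} {init : α → σ} {step : α → σ → σ} (hn : PT n) (hi : PT init)
    (hs : PT (fun p : α × σ => step p.1 p.2)) (q : Polynomial ℕ)
    (hq : ∀ a s, (Encode.code (step a s)).size ≤ (Encode.code s).size +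
      q.eval (Encode.code a).size) :
    PT (fun a => (step a)^[n a] (init a)) := by
  have h := PT.foldr (α := α) (β := Bool) (l := fun a => List.replicate (n a) false)
    (step := fun a _ s => step a s) hi
    (hs.comp (f := fun p : α × Bool × σ => (p.1, p.2.2)) (by fun_prop)) (PT.unary.comp hn) q
    (fun a b s => (hq a s).trans (Nat.add_le_add_left (polyEval_mono q (by omega)) _))
  have e : (fun a => (step a)^[n a] (init a)) =
      fun a => (List.replicate (n a) false).foldr (fun _ s => step a s) (init a) := by
    funext a
    induction n a with
    | zero => rfl
    | succ k ih => rw [Function.iterate_succ_apply', ih, List.replicate_succ, List.foldr_cons]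
  rw [e]; exact h

/-- Iteration, if all values have polynomial size. -/
theorem PT.iterate_of_bound {n : α → ℕ} {init : α → σ} {step : α → σ → σ} (hn : PT n)
    (hi : PT init) (hs : PT (fun p : α × σ => step p.1 p.2)) (q : Polynomial ℕ)
    (hq : ∀ a k, (Encode.code ((step a)^[k] (init a))).size ≤ q.eval (Encode.code a).size) :
    PT (fun a => (step a)^[n a] (init a)) := by
  have e : ∀ a (t : List Bool),
      listRec (init a) (fun _ _ s => step a s) t = (step a)^[t.length] (init a) := by
    intro a t
    induction t with
    | nil => rfl
    | cons b t ih => rw [listRec, ih, List.length_cons, Function.iterate_succ_apply']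
  have h := PT.listRecursion_of_bound (β := Bool) (l := fun a => List.replicate (n a) false)
    (step := fun a _ _ s => step a s) hi
    (hs.comp (f := fun p : α × Bool × List Bool × σ => (p.1, p.2.2.2)) (by fun_prop))
    (PT.unary.comp hn) q
    (fun a t => by rw [e]; exact (hq a _).trans (polyEval_mono q (by omega)))
  simpa only [e, List.length_replicate] using h

@[fun_prop]
theorem PT.nat_add {f g : α → ℕ} (hf : PT f) (hg : PT g) : PT (fun a => f a + g a) := by
  refine PT.congr_code (g := fun a => List.replicate (f a) false ++ List.replicate (g a) false)
    (by fun_prop) fun a => ?_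
  rw [← List.replicate_add, code_replicate]

@[fun_prop]
theorem PT.nat_sub {f g : α → ℕ} (hf : PT f) (hg : PT g) : PT (fun a => f a - g a) := by
  have hp : PT Nat.pred := (PT.tl.comp PT.toSExp).congr_code fun n => by cases n <;> rfl
  have h := PT.iterate (α := α) (step := fun _ s => Nat.pred s) hg hf (by fun_prop) 0
    (fun a s => by rw [size_code_nat, size_code_nat, Nat.pred_eq_sub_one]; omega)
  simpa only [Nat.pred_iterate] using h

@[fun_prop]
theorem PT.nat_mul {f g : α → ℕ} (hf : PT f) (hg : PT g) : PT (fun a => f a * g a) := by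
  have h := PT.iterate (α := α × ℕ) (n := fun p => p.2) (init := fun _ => 0)
    (step := fun p s => s + f p.1) (by fun_prop) (by fun_prop) (by fun_prop)
  obtain ⟨q, hq⟩ := hf.size_bound
  have h := (h q fun a s => by
    have h1 := hq a.1
    have h2 := polyEval_mono q (show (Encode.code a.1).size ≤ (Encode.code a).size by
      obtain ⟨a, n⟩ := a; rw [size_code_pair]; simp only; omega)
    rw [size_code_nat] at *; rw [size_code_nat]; omega).comp (PT.id.mk hg)
  have e : (fun a => f a * g a) = fun a => (fun s => s + f a)^[g a] 0 := by
    funext a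
    induction g a with
    | zero => rfl
    | succ k ih => rw [Function.iterate_succ_apply', ← ih]; rfl
  rw [e]; exact h

@[fun_prop]
theorem PT.nat_beq {f g : α → ℕ} (hf : PT f) (hg : PT g) : PT (fun a => f a == g a) := by
  refine PT.congr_code (g := fun a => !SExp.isCons (code ((f a - g a) + (g a - f a))))
    (by fun_prop) fun a => congrArg _ ?_
  rcases h : (f a - g a) + (g a - f a) with _ | k
  · simp only [show f a = g a by omega]; simp; rfl
  · rw [beq_false_of_ne (by omega)]; rfl

@[fun_prop]
theorem PT.nat_mod {f g : α → ℕ} (hf : PT f) (hg : PT g) : PT (fun a => f a % g a) := by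
  have h := PT.iterate (α := α) (step := fun a s => cond (s + 1 == g a) 0 (s + 1)) hf
    (PT.const 0) (by fun_prop) 2 (fun a s => by
      rw [size_code_nat]; cases (s + 1 == g a) <;> rw [size_code_nat] <;> simp; omega)
  have e : (fun a => f a % g a) = fun a => (fun s => cond (s + 1 == g a) 0 (s + 1))^[f a] 0 := by
    funext a
    induction f a with
    | zero => simp
    | succ k ih =>
      rw [Function.iterate_succ_apply', ← ih]
      rw [← Nat.mod_add_mod]
      by_cases hk : k % g a + 1 = g a
      · rw [beq_iff_eq.2 hk, Bool.cond_true, hk, Nat.mod_self]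
      · rw [beq_false_of_ne hk, Bool.cond_false]
        rcases Nat.eq_zero_or_pos (g a) with h0 | h0
        · simp [h0]
        · exact Nat.mod_eq_of_lt (by have := Nat.mod_lt k h0; omega)
  rw [e]; exact h

@[fun_prop]
theorem PT.length {f : α → List β} (hf : PT f) : PT (fun a => (f a).length) := by
  have h : PT (fun a => (f a).map (fun _ => false)) := by fun_prop
  refine h.congr_code fun a => ?_
  rw [List.map_const', code_replicate]

@[fun_prop]
theorem PT.range {f : α → ℕ} (hf : PT f) : PT (fun a => List.range (f a)) := by
  have h := PT.listRecursion (α := α) (step := fun _ (_ : Bool) t s => s ++ [t.length])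
    (l := fun a => List.replicate (f a) false) (PT.const []) (by fun_prop) (by fun_prop)
    (2 * Polynomial.X + 2) (fun a b t s => by
      have h1 := size_code_append s [t.length]
      have h2 : (code [t.length]).size = (code t.length).size + 1 + 1 := rfl
      have h3 := length_le_size t
      rw [size_code_nat] at h2
      rw [size_code_cons]; simp; omega)
  have e : (fun a => List.range (f a)) = fun a =>
      listRec [] (fun (_ : Bool) t s => s ++ [t.length]) (List.replicate (f a) false) := by
    funext a
    induction f a with
    | zero => rfl
    | succ k ih => rw [List.range_succ, List.replicate_succ, listRec, ← ih, List.length_replicate]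
  rw [e]; exact h

@[fun_prop]
theorem PT.drop {f : α → List β} {n : α → ℕ} (hf : PT f) (hn : PT n) :
    PT (fun a => (f a).drop (n a)) := by
  have h := PT.iterate (α := α) (step := fun _ s => List.tail s) hn hf (by fun_prop) 0
    (fun a s => by cases s <;> simp [Encode.code, codeList, SExp.size]; omega)
  have e : (fun a => (f a).drop (n a)) = fun a => List.tail^[n a] (f a) := by
    funext a
    induction n a with
    | zero => rfl
    | succ k ih => rw [Function.iterate_succ_apply', ← ih, List.tail_drop]
  rw [e]; exact h

@[fun_prop]
theorem PT.list_getD {f : α → List β} {n : α → ℕ} {g : α → β} (hf : PT f) (hn : PT n)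
    (hg : PT g) : PT (fun a => (f a).getD (n a) (g a)) := by
  have h : PT (fun a => ((f a).drop (n a)).headD (g a)) := by fun_prop
  have e : (fun a => (f a).getD (n a) (g a)) = fun a => ((f a).drop (n a)).headD (g a) := by
    funext a
    simp [List.headD_eq_head?_getD, List.head?_drop, List.getD_eq_getElem?_getD]
  rw [e]; exact h

/-! ### Decoding of trees -/

def SExp.toList : SExp → List SExp
  | nil => []
  | cons a b => a :: b.toList

theorem code_toList (s : SExp) : code s.toList = s := by
  induction s with
  | nil => rfl
  | cons a b _ ih => exact congrArg (SExp.cons a) ih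

@[fun_prop]
theorem PT.toList : PT SExp.toList := PT.of_code_eq code_toList

theorem toList_code (l : List β) : (code l).toList = l.map code := by
  induction l with
  | nil => rfl
  | cons b l ih => exact congrArg (code b :: ·) ih

def SExp.toNat (s : SExp) : ℕ := s.toList.length

theorem toNat_code (n : ℕ) : (code n).toNat = n := by
  rw [← code_replicate, SExp.toNat, toList_code]; simp

theorem toNat_code_fin {m : ℕ} (i : Fin m) : (code i).toNat = i := toNat_code _

@[fun_prop]
theorem PT.toNat : PT SExp.toNat := by unfold SExp.toNat; fun_prop

def SExp.toNats (s : SExp) : List ℕ := s.toList.map SExp.toNat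

theorem toNats_code (l : List ℕ) : (code l).toNats = l := by
  rw [SExp.toNats, toList_code, List.map_map]
  simpa [Function.comp_def] using List.map_congr_left (g := id) fun n _ => toNat_code n

@[fun_prop]
theorem PT.toNats : PT SExp.toNats := by unfold SExp.toNats; fun_prop

theorem isCons_code (b : Bool) : (code b).isCons = b := by cases b <;> rfl

def SExp.toLit (s : SExp) : ℕ × Bool := (s.hd.toNat, s.tl.isCons)

theorem toLit_code {m : ℕ} (l : Lit m) : (code l).toLit = ((l.1 : ℕ), l.2) :=
  Prod.ext (toNat_code _) (isCons_code _)

@[fun_prop]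
theorem PT.toLit : PT SExp.toLit := by unfold SExp.toLit; fun_prop

end lib
end KC

namespace KC
open Encode (code)

/-! ### Greedy computation of one AXp from a test for constant restrictions -/

/-- The point `x` lies in the subcube that is given by the partial assignment `c`. -/
def Agree {m : ℕ} (c : Fin m → Option Bool) (x : Fin m → Bool) : Prop :=
  ∀ i b, c i = some b → x i = b

/-- `κ` is constant on the subcube `c`. -/
def ConstOn {m : ℕ} (κ : BoolFn m) (c : Fin m → Option Bool) : Prop :=
  ∀ x y, Agree c x → Agree c y → κ x = κ y

/-- The subcube that arises from the point `v` by freeing the features in `D`. -/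
def freed (v : List Bool) (D : List ℕ) : List (Option Bool) :=
  (List.range v.length).map fun j => cond (D.any fun i => i == j) none (some (v.getD j false))

def greedyFreed (test : SExp × List (Option Bool) → Bool) (s : SExp) (v : List Bool)
    (l : List ℕ) : List ℕ :=
  l.foldr (fun i D => cond (test (s, freed v (i :: D))) (i :: D) D) []

def keptList (v : List Bool) (D : List ℕ) : List Bool :=
  (List.range v.length).map fun j => !D.any fun i => i == j

def greedy (test : SExp × List (Option Bool) → Bool) (p : SExp × List Bool) : List Bool :=
  keptList p.2 (greedyFreed test p.1 p.2 (List.range p.2.length))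

@[fun_prop]
theorem PT.freed {α : Type} [Encode α] {v : α → List Bool} {D : α → List ℕ} (hv : PT v)
    (hD : PT D) : PT (fun a => freed (v a) (D a)) := by
  unfold KC.freed; fun_prop

@[fun_prop]
theorem PT.keptList {α : Type} [Encode α] {v : α → List Bool} {D : α → List ℕ} (hv : PT v)
    (hD : PT D) : PT (fun a => keptList (v a) (D a)) := by
  unfold KC.keptList; fun_prop

theorem PT.greedyFreed {test : SExp × List (Option Bool) → Bool} (ht : PT test) :
    PT (fun p : (SExp × List Bool) => greedyFreed test p.1 p.2 (List.range p.2.length)) := by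
  unfold KC.greedyFreed
  refine PT.foldr (α := SExp × List Bool) (σ := List ℕ) (step := fun p i D => cond (test (p.1, KC.freed p.2 (i :: D))) (i :: D) D)
    (PT.const []) (by fun_prop) (by fun_prop) (Polynomial.X + 1) fun a b s => ?_
  cases test (a.1, KC.freed a.2 (b :: s))
  · simp
  · rw [Bool.cond_true, size_code_cons]; simp; omega

theorem PT.greedy {test : SExp × List (Option Bool) → Bool} (ht : PT test) :
    PT (greedy test) :=
  PT.keptList PT.snd (PT.greedyFreed ht)

theorem freed_ofFn {m : ℕ} (v : Fin m → Bool) (D : List ℕ) :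
    freed (List.ofFn v) D = List.ofFn fun i : Fin m => if (i : ℕ) ∈ D then none else some (v i) := by
  refine List.ext_getElem (by simp [freed]) fun n h₁ h₂ => ?_
  have hn : n < m := by simpa using h₂
  by_cases hD : n ∈ D <;> simp [freed, hD, hn, List.getD_eq_getElem?_getD, Bool.cond_eq_ite]

variable {m : ℕ}

def kept (D : List ℕ) : Finset (Fin m) := {i | (i : ℕ) ∉ D}

theorem constOn_freed (κ : BoolFn m) (v : Fin m → Bool) (D : List ℕ) :
    ConstOn κ (fun i : Fin m => if (i : ℕ) ∈ D then none else some (v i)) ↔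
      IsWeakAXp κ v (kept D) := by
  have h : ∀ x, Agree (fun i : Fin m => if (i : ℕ) ∈ D then none else some (v i)) x ↔
      ∀ i ∈ kept D, x i = v i := by
    intro x
    refine ⟨fun hx i hi => hx i _ ?_, fun hx i b hi => ?_⟩
    · simp only [kept, Finset.mem_filter_univ] at hi
      simp [hi]
    · by_cases hD : (i : ℕ) ∈ D <;> simp [hD] at hi
      rw [← hi]; exact hx i (by simpa [kept] using hD)
  simp only [ConstOn, h, IsWeakAXp]
  exact ⟨fun H x hx => H x v hx fun _ _ => rfl, fun H x y hx hy => (H x hx).trans (H y hy).symm⟩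

theorem IsWeakAXp.mono {κ : BoolFn m} {v : Fin m → Bool} {S T : Finset (Fin m)} (hST : S ⊆ T)
    (h : IsWeakAXp κ v S) : IsWeakAXp κ v T :=
  fun x hx => h x fun i hi => hx i (hST hi)

theorem isAXp_greedyFreed {κ : BoolFn m} {test : SExp × List (Option Bool) → Bool} {s : SExp}
    (ht : ∀ c : Fin m → Option Bool, test (s, List.ofFn c) = true ↔ ConstOn κ c)
    (v : Fin m → Bool) :
    IsAXp κ v (kept (greedyFreed test s (List.ofFn v) (List.range m))) := by
  have key : ∀ l : List ℕ,
      IsWeakAXp κ v (kept (greedyFreed test s (List.ofFn v) l)) ∧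
      ∀ i ∈ l, ∀ D, (greedyFreed test s (List.ofFn v) l) ⊆ D → i ∈ D →
        IsWeakAXp κ v (kept D) → i ∈ greedyFreed test s (List.ofFn v) l := by
    intro l
    induction l with
    | nil =>
      refine ⟨fun x hx => ?_, by simp⟩
      rw [show x = v from funext fun i => hx i (by simp [kept, greedyFreed])]
    | cons i l ih =>
      have e : greedyFreed test s (List.ofFn v) (i :: l) =
        cond (test (s, freed (List.ofFn v) (i :: greedyFreed test s (List.ofFn v) l)))
          (i :: greedyFreed test s (List.ofFn v) l) (greedyFreed test s (List.ofFn v) l) := rfl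
      rw [e]
      generalize greedyFreed test s (List.ofFn v) l = D at *
      rcases htest : test (s, freed (List.ofFn v) (i :: D)) with _ | _
      · rw [freed_ofFn, Bool.eq_false_iff, Ne, ht, constOn_freed] at htest
        refine ⟨ih.1, fun j hj E hDE hjE hE => ?_⟩
        rcases List.mem_cons.1 hj with rfl | hj
        · refine absurd (hE.mono fun k hk => ?_) htest
          simp only [kept, Finset.mem_filter_univ] at hk ⊢
          contrapose! hk
          rcases List.mem_cons.1 hk with h | h
          · rwa [h]
          · exact hDE h
        · exact ih.2 j hj E hDE hjE hE
      · rw [freed_ofFn, ht, constOn_freed] at htest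
        refine ⟨htest, fun j hj E hDE hjE hE => ?_⟩
        rcases List.mem_cons.1 hj with rfl | hj
        · exact List.mem_cons_self
        · exact List.mem_cons_of_mem _
            (ih.2 j hj E (fun k hk => hDE (List.mem_cons_of_mem _ hk)) hjE hE)
  obtain ⟨h₁, h₂⟩ := key (List.range m)
  refine ⟨h₁, fun T hT hTS i hi => ?_⟩
  by_contra hiT
  let D : List ℕ := (List.range m).filter fun j => decide (∀ h : j < m, (⟨j, h⟩ : Fin m) ∉ T)
  have hD : ∀ j : Fin m, (j : ℕ) ∈ D ↔ j ∉ T := by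
    intro j; simp [D]
  have := h₂ i (by simp) (D ++ greedyFreed test s (List.ofFn v) (List.range m)) (by simp)
    (List.mem_append_left _ ((hD i).2 hiT)) (IsWeakAXp.mono (fun j hj => ?_) hT)
  · exact (Finset.mem_filter_univ (p := fun i : Fin m => (i : ℕ) ∉ _) _).1 hi this
  · have h := hTS hj
    simp only [kept, Finset.mem_filter_univ] at h ⊢
    simp [hD, hj, h]

theorem oneAXp_of_test (L : Language) (test : SExp × List (Option Bool) → Bool) (ht : PT test)
    (h : ∀ (m : ℕ) (Δ : L.Rep m), L.Mem Δ → ∀ c : Fin m → Option Bool,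
      test (L.enc Δ, List.ofFn c) = true ↔ ConstOn (L.eval Δ) c) :
    OneAXpInPolyTime L := by
  obtain ⟨P, e, p, hP⟩ := PT.greedy ht
  refine ⟨e.shift 1 :: P.map (Code.shift 1), p + 2, fun m Δ hΔ v => ?_⟩
  obtain ⟨⟨t, ht, he⟩, -⟩ := hP (L.enc Δ, List.ofFn v)
  refine ⟨_, 1 + t + 1, isAXp_greedyFreed (h m Δ hΔ) v,
    .call (.arg _) (body := e.shift 1) rfl ?_, ?_⟩
  · have := he.shift (Q := e.shift 1 :: P.map (Code.shift 1)) (n := 1) (by simp_all)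
    convert this using 1
    · rfl
    refine congrArg (code (α := List Bool)) ?_
    simp only [greedy, keptList, List.length_ofFn]
    refine List.ext_getElem (by simp) fun n h₁ h₂ => ?_
    rw [Bool.eq_iff_iff]
    simp only [kept, List.getElem_ofFn, decide_eq_true_eq, Finset.mem_filter_univ,
      List.getElem_map, List.getElem_range, Bool.not_eq_true', List.any_eq_false, beq_iff_eq]
    exact ⟨fun h x hx e => h (e ▸ hx), fun h hn => h n hn rfl⟩
  · have : (axpInput L Δ v).size = (code (L.enc Δ, List.ofFn v)).size := rfl
    rw [this]; simp; omega

end KC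

namespace KC
open Encode (code)

/-! ### Sums of products modulo odd numbers -/

theorem two_pow_lt_of_odd_dvd {m D : ℕ} (hD : 0 < D) (h : ∀ r < m + 4, 2 * r + 1 ∣ D) :
    2 ^ m < D := by
  set n := m + 4 with hn
  set v := (n.centralBinom).factorization 2 with hv
  have h₁ : n.centralBinom ∣ 2 ^ v * D := by
    rw [Nat.dvd_iff_prime_pow_dvd_dvd]
    intro p k hp hk
    have hcb := Nat.centralBinom_ne_zero n
    have hk' : k ≤ (n.centralBinom).factorization p := (hp.pow_dvd_iff_le_factorization hcb).1 hk
    rcases hp.eq_two_or_odd' with rfl | hodd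
    · exact Dvd.dvd.mul_right (pow_dvd_pow 2 hk') _
    · obtain ⟨r, hr⟩ := hodd.pow (n := k)
      have hle : p ^ k ≤ 2 * n :=
        (Nat.pow_le_pow_right hp.pos hk').trans
          (by rw [Nat.centralBinom]; exact Nat.pow_factorization_choose_le (by omega))
      rw [hr] at hle ⊢
      exact Dvd.dvd.mul_left (h r (by omega)) _
  have h₂ : 2 ^ v ≤ 2 * n := by
    rw [hv, Nat.centralBinom]; exact Nat.pow_factorization_choose_le (by omega)
  have h₃ := Nat.four_pow_le_two_mul_self_mul_centralBinom n (by omega)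
  have h₄ : n.centralBinom ≤ 2 * n * D :=
    (Nat.le_of_dvd (by positivity) h₁).trans (Nat.mul_le_mul_right _ h₂)
  have h₅ : n ^ 2 ≤ 2 ^ n := by
    have : ∀ j : ℕ, (j + 4) ^ 2 ≤ 2 ^ (j + 4) := by
      intro j
      induction j with
      | zero => norm_num
      | succ j ih =>
        have h₁ : (j + 1 + 4) ^ 2 ≤ (j + 4) ^ 2 * 2 := by
          have : (j + 1 + 4) ^ 2 + (j * j + 6 * j + 7) = (j + 4) ^ 2 * 2 := by ring
          omega
        rw [show j + 1 + 4 = j + 4 + 1 by ring, pow_succ 2]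
        exact h₁.trans (Nat.mul_le_mul_right 2 ih)
    exact this m
  have h₆ : 4 ^ n = 16 * 2 ^ m * 2 ^ n := by
    rw [show (4 : ℕ) = 2 ^ 2 by norm_num, ← pow_mul, show 16 = 2 ^ 4 by norm_num, ← pow_add,
      ← pow_add]
    congr 1; omega
  have h₇ : 16 * 2 ^ m * 2 ^ n ≤ 4 * D * 2 ^ n := by
    calc 16 * 2 ^ m * 2 ^ n = 4 ^ n := h₆.symm
      _ ≤ 2 * n * n.centralBinom := h₃
      _ ≤ 2 * n * (2 * n * D) := Nat.mul_le_mul_left _ h₄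
      _ = 4 * D * n ^ 2 := by ring
      _ ≤ 4 * D * 2 ^ n := Nat.mul_le_mul_left _ h₅
  have := Nat.le_of_mul_le_mul_right h₇ (by positivity)
  have : 0 < 2 ^ m := by positivity
  omega

def sumMod (r : ℕ) (l : List ℕ) : ℕ := l.foldr (fun a s => (a + s) % (2 * r + 1)) 0

def prodMod (r : ℕ) (l : List ℕ) : ℕ := l.foldr (fun a s => (a * s) % (2 * r + 1)) 1

section pt

variable {α : Type} [Encode α]

@[fun_prop]
theorem PT.sumMod {r : α → ℕ} {l : α → List ℕ} (hr : PT r) (hl : PT l) :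
    PT (fun a => sumMod (r a) (l a)) := by
  suffices h : PT (fun p : ℕ × List ℕ => KC.sumMod p.1 p.2) from h.comp (hr.mk hl)
  refine PT.foldr (α := ℕ × List ℕ) (step := fun p a s => (a + s) % (2 * p.1 + 1))
    (PT.const 0) (by fun_prop) (by fun_prop) (4 * Polynomial.X) fun a b s => ?_
  have := Nat.mod_lt (b + s) (show 2 * a.1 + 1 > 0 by omega)
  have h1 := size_code_pos a.2
  obtain ⟨r, l⟩ := a
  simp [size_code_nat, size_code_pair] at *
  omega

@[fun_prop]
theorem PT.prodMod {r : α → ℕ} {l : α → List ℕ} (hr : PT r) (hl : PT l) :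
    PT (fun a => prodMod (r a) (l a)) := by
  suffices h : PT (fun p : ℕ × List ℕ => KC.prodMod p.1 p.2) from h.comp (hr.mk hl)
  refine PT.foldr (α := ℕ × List ℕ) (step := fun p a s => (a * s) % (2 * p.1 + 1))
    (PT.const 1) (by fun_prop) (by fun_prop) (4 * Polynomial.X) fun a b s => ?_
  have := Nat.mod_lt (b * s) (show 2 * a.1 + 1 > 0 by omega)
  have h1 := size_code_pos a.2
  obtain ⟨r, l⟩ := a
  simp [size_code_nat, size_code_pair] at *
  omega

end pt

theorem sumMod_lt (r : ℕ) (l : List ℕ) : sumMod r l < 2 * r + 1 := by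
  cases l with
  | nil => simp [sumMod]
  | cons a l => exact Nat.mod_lt _ (by omega)

theorem cast_sumMod (r : ℕ) (l : List ℕ) :
    ((sumMod r l : ℕ) : ZMod (2 * r + 1)) = (l.map (Nat.cast : ℕ → ZMod (2 * r + 1))).sum := by
  induction l with
  | nil => simp [sumMod]
  | cons a l ih =>
    rw [List.map_cons, List.sum_cons, ← ih]
    simp only [sumMod, List.foldr_cons, ZMod.natCast_mod, Nat.cast_add]

theorem cast_prodMod (r : ℕ) (l : List ℕ) :
    ((prodMod r l : ℕ) : ZMod (2 * r + 1)) = (l.map (Nat.cast : ℕ → ZMod (2 * r + 1))).prod := by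
  induction l with
  | nil => simp [prodMod]
  | cons a l ih =>
    rw [List.map_cons, List.prod_cons, ← ih]
    simp only [prodMod, List.foldr_cons, ZMod.natCast_mod, Nat.cast_mul]

/-! ### Gates: sums of products, possibly negated -/

/-- `(n, ts)` is the disjunction of the terms `ts`, negated if `n`. A term consists of literals
and of arcs. -/
abbrev NGate := Bool × List (List (ℕ × Bool) × List ℕ)

/-- The probability of a literal below the partial assignment `c`, modulo `2 * r + 1`. -/
def litWeight (r : ℕ) (c : List (Option Bool)) (l : ℕ × Bool) : ℕ :=
  cond (c.getD l.1 none).isSome (cond ((c.getD l.1 none).getD false == l.2) 1 0) (r + 1)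

def termWeight (r : ℕ) (c : List (Option Bool)) (t : List (ℕ × Bool) × List ℕ)
    (vs : List ℕ) : ℕ :=
  prodMod r (t.1.map (litWeight r c) ++ t.2.map fun k => vs.getD k 0)

def gateWeight (r : ℕ) (c : List (Option Bool)) (g : NGate) (vs : List ℕ) : ℕ :=
  cond g.1 (sumMod r [1, 2 * r * sumMod r (g.2.map fun t => termWeight r c t vs)])
    (sumMod r (g.2.map fun t => termWeight r c t vs))

def dagWeights (r : ℕ) (c : List (Option Bool)) (G : List NGate) : List ℕ :=
  G.foldr (fun g vs => gateWeight r c g vs :: vs) []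

def countTest (conv : SExp → NGate) (p : SExp × List (Option Bool)) : Bool :=
  ((List.range (p.2.length + 4)).all fun r =>
    (dagWeights r p.2 (p.1.toList.map conv)).headD 0 == 0) ||
  ((List.range (p.2.length + 4)).all fun r =>
    (dagWeights r p.2 (p.1.toList.map conv)).headD 0 == 1 % (2 * r + 1))

section pt

variable {α : Type} [Encode α]

@[fun_prop]
theorem PT.litWeight {r : α → ℕ} {c : α → List (Option Bool)} {l : α → ℕ × Bool} (hr : PT r)
    (hc : PT c) (hl : PT l) : PT (fun a => litWeight (r a) (c a) (l a)) := by
  unfold KC.litWeight; fun_prop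

@[fun_prop]
theorem PT.termWeight {r : α → ℕ} {c : α → List (Option Bool)}
    {t : α → List (ℕ × Bool) × List ℕ} {vs : α → List ℕ} (hr : PT r)
    (hc : PT c) (ht : PT t) (hvs : PT vs) :
    PT (fun a => termWeight (r a) (c a) (t a) (vs a)) := by
  unfold KC.termWeight; fun_prop

@[fun_prop]
theorem PT.gateWeight {r : α → ℕ} {c : α → List (Option Bool)}
    {g : α → NGate} {vs : α → List ℕ} (hr : PT r)
    (hc : PT c) (hg : PT g) (hvs : PT vs) :
    PT (fun a => gateWeight (r a) (c a) (g a) (vs a)) := by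
  unfold KC.gateWeight; fun_prop

theorem gateWeight_lt (r : ℕ) (c : List (Option Bool)) (g : NGate) (vs : List ℕ) :
    gateWeight r c g vs < 2 * r + 1 := by
  unfold gateWeight; cases g.1 <;> exact sumMod_lt _ _

@[fun_prop]
theorem PT.dagWeights {r : α → ℕ} {c : α → List (Option Bool)} {G : α → List NGate} (hr : PT r)
    (hc : PT c) (hG : PT G) : PT (fun a => dagWeights (r a) (c a) (G a)) := by
  suffices h : PT (fun p : ℕ × List (Option Bool) × List NGate =>
      KC.dagWeights p.1 p.2.1 p.2.2) from h.comp (hr.mk (hc.mk hG))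
  refine PT.foldr (α := ℕ × List (Option Bool) × List NGate)
    (step := fun p g vs => KC.gateWeight p.1 p.2.1 g vs :: vs)
    (PT.const []) (by fun_prop) (by fun_prop) (4 * Polynomial.X) fun a b s => ?_
  have := gateWeight_lt a.1 a.2.1 b s
  obtain ⟨r, c, l⟩ := a
  rw [size_code_cons]
  have h1 := size_code_pos (c, l)
  have h2 := size_code_pos b
  simp only [size_code_nat, size_code_pair] at *
  simp
  omega

theorem PT.countTest {conv : SExp → NGate} (h : PT conv) : PT (countTest conv) := by
  unfold KC.countTest; fun_prop

end pt
end KC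

namespace KC
open Encode (code)

/-! ### Counting of models in a subcube -/

section counting

variable {m : ℕ}

/-- The variables on which `f` depends. -/
def essVars (f : BoolFn m) : Set (Fin m) := {i | ∃ x b, f (Function.update x i b) ≠ f x}

theorem essVars_subset {f : BoolFn m} {A : Set (Fin m)} (h : DependsOn f A) : essVars f ⊆ A := by
  rintro i ⟨x, b, hb⟩
  by_contra hi
  refine hb (h fun j hj => Function.update_of_ne ?_ _ _)
  rintro rfl; exact hi hj

theorem dependsOn_essVars (f : BoolFn m) : DependsOn f (essVars f) := by
  intro x y hxy
  have key : ∀ s : Finset (Fin m), f (s.piecewise y x) = f x := by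
    intro s
    induction s using Finset.induction_on with
    | empty => simp
    | insert i s hi ih =>
      rw [Finset.piecewise_insert, ← ih]
      by_cases hif : i ∈ essVars f
      · rw [Function.update_eq_self_iff.2]
        simp [hi, hxy i hif]
      · by_contra h
        exact hif ⟨_, _, h⟩
  simpa using (key Finset.univ).symm

open Classical in
/-- The number of models of `f` in the subcube `c`. -/
noncomputable def modelCount (c : Fin m → Option Bool) (f : BoolFn m) : ℕ :=
  (Finset.univ.filter fun x => Agree c x ∧ f x = true).card

variable (c : Fin m → Option Bool)

theorem modelCount_and {f g : BoolFn m} (h : Disjoint (essVars f) (essVars g)) :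
    modelCount c (fun x => f x && g x) * modelCount c (fun _ => true) =
      modelCount c f * modelCount c g := by
  classical
  rw [modelCount, modelCount, modelCount, modelCount, ← Finset.card_product,
    ← Finset.card_product]
  have mix : ∀ x y : Fin m → Bool, Agree c x → Agree c y →
      Agree c ((essVars f).piecewise x y) := by
    intro x y hx hy i b hi
    by_cases hif : i ∈ essVars f
    · rw [Set.piecewise_eq_of_mem _ _ _ hif]; exact hx i b hi
    · rw [Set.piecewise_eq_of_notMem _ _ _ hif]; exact hy i b hi
  have hf : ∀ x y, f ((essVars f).piecewise x y) = f x := fun x y =>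
    dependsOn_essVars f fun i hi => Set.piecewise_eq_of_mem _ _ _ hi
  have hg : ∀ x y, g ((essVars f).piecewise x y) = g y := fun x y =>
    dependsOn_essVars g fun i hi => Set.piecewise_eq_of_notMem _ _ _ (h.notMem_of_mem_right hi)
  have inv : ∀ x y : Fin m → Bool,
      (essVars f).piecewise ((essVars f).piecewise x y) ((essVars f).piecewise y x) = x := by
    intro x y; funext i; by_cases hif : i ∈ essVars f <;> simp [hif]
  let φ : (Fin m → Bool) × (Fin m → Bool) → (Fin m → Bool) × (Fin m → Bool) := fun p =>
    ((essVars f).piecewise p.1 p.2, (essVars f).piecewise p.2 p.1)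
  refine Finset.card_bij' (fun p _ => φ p) (fun p _ => φ p) ?_ ?_ ?_ ?_
  · rintro ⟨x, y⟩ hp
    simp only [Finset.mem_product, Finset.mem_filter_univ, Bool.and_eq_true, and_true] at hp
    simp only [φ, Finset.mem_product, Finset.mem_filter_univ, hf, hg]
    exact ⟨⟨mix _ _ hp.1.1 hp.2, hp.1.2.1⟩, mix _ _ hp.2 hp.1.1, hp.1.2.2⟩
  · rintro ⟨x, y⟩ hp
    simp only [Finset.mem_product, Finset.mem_filter_univ] at hp
    simp only [φ, Finset.mem_product, Finset.mem_filter_univ, hf, hg, Bool.and_eq_true, and_true]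
    exact ⟨⟨mix _ _ hp.1.1 hp.2.1, hp.1.2, hp.2.2⟩, mix _ _ hp.2.1 hp.1.1⟩
  · rintro ⟨x, y⟩ -; simp only [φ, inv]
  · rintro ⟨x, y⟩ -; simp only [φ, inv]

theorem modelCount_or {f g : BoolFn m} (h : ∀ x, ¬ (f x = true ∧ g x = true)) :
    modelCount c (fun x => f x || g x) = modelCount c f + modelCount c g := by
  classical
  rw [modelCount, modelCount, modelCount, ← Finset.card_union_of_disjoint, ← Finset.filter_or]
  · congr 1; ext x; simp; tauto
  · rw [Finset.disjoint_filter]; exact fun x _ h₁ h₂ => h x ⟨h₁.2, h₂.2⟩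

theorem modelCount_not (f : BoolFn m) :
    modelCount c (fun x => !f x) + modelCount c f = modelCount c (fun _ => true) := by
  rw [← modelCount_or c (by simp)]
  congr 1; funext x; simp

theorem modelCount_false : modelCount c (fun _ => false) = 0 := by
  simp [modelCount]

theorem modelCount_congr {f g : BoolFn m} (h : ∀ x, Agree c x → f x = g x) :
    modelCount c f = modelCount c g := by
  classical
  rw [modelCount, modelCount]; congr 1; ext x; simp +contextual [h]

theorem modelCount_le (f : BoolFn m) : modelCount c f ≤ 2 ^ m := by
  classical
  refine (Finset.card_le_univ _).trans ?_
  simp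

theorem modelCount_eq_zero {f : BoolFn m} :
    modelCount c f = 0 ↔ ∀ x, Agree c x → f x = false := by
  classical
  simp [modelCount, Finset.filter_eq_empty_iff]

theorem modelCount_lit_none {i : Fin m} (hi : c i = none) (b : Bool) :
    2 * modelCount c (fun x => x i == b) = modelCount c (fun _ => true) := by
  classical
  rw [← modelCount_not c (fun x => x i == b), two_mul, Nat.add_right_cancel_iff]
  let φ : (Fin m → Bool) → (Fin m → Bool) := fun x => Function.update x i (!x i)
  have hφ : ∀ x, φ (φ x) = x := by intro x; simp [φ]
  have hA : ∀ x, Agree c x → Agree c (φ x) := by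
    intro x hx j d hj
    have : j ≠ i := by rintro rfl; simp [hi] at hj
    simp only [φ, Function.update_of_ne this]; exact hx j d hj
  refine Finset.card_bij' (fun x _ => φ x) (fun x _ => φ x) ?_ ?_ (fun x _ => hφ x)
    (fun x _ => hφ x)
  · intro x hx
    simp only [Finset.mem_filter_univ] at hx ⊢
    refine ⟨hA x hx.1, ?_⟩
    have := hx.2
    simp only [φ, Function.update_self]
    cases b <;> simp_all
  · intro x hx
    simp only [Finset.mem_filter_univ] at hx ⊢
    refine ⟨hA x hx.1, ?_⟩
    have := hx.2
    simp only [φ, Function.update_self]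
    cases b <;> simp_all

theorem modelCount_lit_some {i : Fin m} {a : Bool} (hi : c i = some a) (b : Bool) :
    modelCount c (fun x => x i == b) = if a == b then modelCount c (fun _ => true) else 0 := by
  rw [modelCount_congr c (g := fun _ => a == b) fun x hx => by rw [hx i a hi]]
  cases a == b <;> simp [modelCount_false]

theorem modelCount_true_coprime (r : ℕ) :
    Nat.Coprime (modelCount c (fun _ => true)) (2 * r + 1) := by
  classical
  have h : modelCount c (fun _ => true) =
      (Fintype.piFinset fun i => (c i).elim Finset.univ fun b => {b}).card := by
    rw [modelCount]; congr 1; ext x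
    simp only [and_true, Finset.mem_filter_univ, Fintype.mem_piFinset, Agree]
    refine forall_congr' fun i => ?_
    cases c i <;> simp
  rw [h, Fintype.card_piFinset]
  refine Nat.Coprime.prod_left fun i _ => ?_
  cases c i <;> simp

end counting
end KC

namespace KC
open Encode (code)

/-! ### Bottom-up computations on graphs -/

namespace Dag

variable {γ δ β : Type*}

theorem values_drop (step : γ → (ℕ → β) → β) (d : β) (G : List γ) (k : ℕ) :
    values step d (G.drop k) = (values step d G).drop k := by
  induction G generalizing k with
  | nil => simp [values]
  | cons g G ih => cases k <;> simp [values, ih]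

theorem value_drop (step : γ → (ℕ → β) → β) (d : β) (G : List γ) (k : ℕ) :
    value step d (G.drop k) = (values step d G).getD k d := by
  rw [value, values_drop, List.headD_eq_head?_getD, List.head?_drop, List.getD_eq_getElem?_getD]

theorem value_cons (step : γ → (ℕ → β) → β) (d : β) (g : γ) (G : List γ) :
    value step d (g :: G) = step g fun k => value step d (G.drop k) := by
  simp only [value_drop]; rfl

/-- A property of the values of two computations that is inherited by every node holds
everywhere. -/
theorem value_induction {β' : Type*} (Q : γ → List γ → Prop) {step : γ → (ℕ → β) → β} {d : β}
    {step' : γ → (ℕ → β') → β'} {d' : β'} (R : β → β' → Prop) (hd : R d d')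
    (h : ∀ g G, Q g G → (∀ k, R (value step d (G.drop k)) (value step' d' (G.drop k))) →
      R (value step d (g :: G)) (value step' d' (g :: G)))
    {G : List γ} (hG : EveryNode Q G) (k : ℕ) :
    R (value step d (G.drop k)) (value step' d' (G.drop k)) := by
  induction G generalizing k with
  | nil => simpa [value, values] using hd
  | cons g G ih =>
    cases k with
    | zero => exact h g G hG.1 (ih hG.2)
    | succ k => exact ih hG.2 k

theorem EveryNode.and {Q Q' : γ → List γ → Prop} {G : List γ}
    (hG : EveryNode Q G) (hG' : EveryNode Q' G) : EveryNode (fun g G => Q g G ∧ Q' g G) G := by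
  induction G with
  | nil => trivial
  | cons g G ih => exact ⟨⟨hG.1, hG'.1⟩, ih hG.2 hG'.2⟩

theorem EveryNode.true (G : List γ) : EveryNode (fun _ _ => True) G := by
  induction G with
  | nil => trivial
  | cons g G ih => exact ⟨trivial, ih⟩

theorem EveryNode.drop {Q : γ → List γ → Prop} {G : List γ} (hG : EveryNode Q G) (k : ℕ) :
    EveryNode Q (G.drop k) := by
  induction G generalizing k with
  | nil => simpa using hG
  | cons g G ih => cases k with
    | zero => exact hG
    | succ k => exact ih hG.2 k

end Dag

/-! ### Correctness of the counting test -/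

section countTest

variable {m : ℕ}

/-- A gate `NGate` whose literals are over `m` variables. -/
abbrev TGate (m : ℕ) := Bool × List (List (Lit m) × List ℕ)

def termFns (f : ℕ → BoolFn m) (t : List (Lit m) × List ℕ) : List (BoolFn m) :=
  t.1.map Lit.eval ++ t.2.map f

def conjFn (fs : List (BoolFn m)) : BoolFn m := fun x => fs.all fun f => f x

def disjFn (fs : List (BoolFn m)) : BoolFn m := fun x => fs.any fun f => f x

def TGate.eval (g : TGate m) (f : ℕ → BoolFn m) : BoolFn m := fun x =>
  g.1 ^^ disjFn (g.2.map fun t => conjFn (termFns f t)) x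

def TGate.Countable (g : TGate m) (f : ℕ → BoolFn m) : Prop :=
  (∀ t ∈ g.2, (termFns f t).Pairwise fun f g => Disjoint (essVars f) (essVars g)) ∧
  (g.2.map fun t => conjFn (termFns f t)).Pairwise fun f g => ∀ x, ¬ (f x = true ∧ g x = true)

def TGate.erase (g : TGate m) : NGate :=
  (g.1, g.2.map fun t => (t.1.map fun l => ((l.1 : ℕ), l.2), t.2))

theorem essVars_conjFn (fs : List (BoolFn m)) :
    essVars (conjFn fs) ⊆ {i | ∃ f ∈ fs, i ∈ essVars f} := by
  refine essVars_subset fun x y h => ?_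
  induction fs with
  | nil => rfl
  | cons f fs ih =>
    have h₁ : f x = f y := dependsOn_essVars f fun i hi => h i ⟨f, by simp, hi⟩
    have h₂ := ih fun i ⟨g, hg, hi⟩ => h i ⟨g, by simp [hg], hi⟩
    simp only [conjFn, List.all_cons, h₁] at h₂ ⊢; rw [h₂]

variable (c : Fin m → Option Bool) (r : ℕ)

/-- `n` is the proportion of models of `f` in the subcube `c`, modulo `2 * r + 1`. -/
def IsWeight (n : ℕ) (f : BoolFn m) : Prop :=
  (n : ZMod (2 * r + 1)) * modelCount c (fun _ => true) = modelCount c f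

theorem isUnit_modelCount_true :
    IsUnit ((modelCount c (fun _ => true) : ℕ) : ZMod (2 * r + 1)) :=
  (ZMod.isUnit_iff_coprime _ _).2 (modelCount_true_coprime c r)

variable {c r}

theorem isWeight_lit (l : Lit m) :
    IsWeight c r (litWeight r (List.ofFn c) ((l.1 : ℕ), l.2)) l.eval := by
  have e : (List.ofFn c).getD (l.1 : ℕ) none = c l.1 := by simp [List.getD_eq_getElem?_getD]
  unfold IsWeight litWeight Lit.eval
  simp only [e]
  cases h : c l.1 with
  | none =>
    rw [← modelCount_lit_none c h l.2]
    have h2 : (2 * r + 1 : ZMod (2 * r + 1)) = 0 := by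
      exact_mod_cast ZMod.natCast_self (2 * r + 1)
    simp only [Option.isSome_none, Bool.cond_false]
    push_cast
    linear_combination (modelCount c fun x => x l.1 == l.2 : ZMod (2 * r + 1)) * h2
  | some a =>
    rw [modelCount_lit_some c h]
    cases h' : a == l.2 <;> simp [h']

theorem isWeight_conj {ws : List ℕ} {fs : List (BoolFn m)}
    (hw : List.Forall₂ (IsWeight c r) ws fs)
    (h : fs.Pairwise fun f g => Disjoint (essVars f) (essVars g)) :
    IsWeight c r (prodMod r ws) (conjFn fs) := by
  unfold IsWeight
  rw [cast_prodMod]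
  induction hw with
  | nil =>
    rw [show conjFn ([] : List (BoolFn m)) = fun _ => true from rfl]; simp
  | @cons w f ws fs hwf _ ih =>
    rw [List.pairwise_cons] at h
    have hd : Disjoint (essVars f) (essVars (conjFn fs)) := by
      refine Disjoint.mono_right (essVars_conjFn fs) (Set.disjoint_left.2 ?_)
      rintro i hi ⟨g, hg, hig⟩
      exact Set.disjoint_left.1 (h.1 g hg) hi hig
    have h₁ := congrArg (Nat.cast : ℕ → ZMod (2 * r + 1)) (modelCount_and c hd)
    have h₂ := ih h.2
    unfold IsWeight at hwf
    refine (isUnit_modelCount_true c r).mul_left_inj.1 ?_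
    rw [List.map_cons, List.prod_cons]
    push_cast at h₁
    have e : conjFn (f :: fs) = fun x => f x && conjFn fs x := by funext x; simp [conjFn]
    rw [e, h₁, ← hwf, ← h₂]; ring

theorem isWeight_disj {ws : List ℕ} {fs : List (BoolFn m)}
    (hw : List.Forall₂ (IsWeight c r) ws fs)
    (h : fs.Pairwise fun f g => ∀ x, ¬ (f x = true ∧ g x = true)) :
    IsWeight c r (sumMod r ws) (disjFn fs) := by
  unfold IsWeight
  rw [cast_sumMod]
  induction hw with
  | nil =>
    rw [show disjFn ([] : List (BoolFn m)) = fun _ => false from rfl]; simp [modelCount_false]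
  | @cons w f ws fs hwf _ ih =>
    rw [List.pairwise_cons] at h
    have hd : ∀ x, ¬ (f x = true ∧ disjFn fs x = true) := by
      rintro x ⟨hx, hx'⟩
      obtain ⟨g, hg, hgx⟩ := List.any_eq_true.1 hx'
      exact h.1 g hg x ⟨hx, hgx⟩
    have e : disjFn (f :: fs) = fun x => f x || disjFn fs x := by funext x; simp [disjFn]
    unfold IsWeight at hwf
    rw [e, modelCount_or c hd, List.map_cons, List.sum_cons, Nat.cast_add, add_mul, ih h.2, hwf]

theorem isWeight_gate {g : TGate m} {f : ℕ → BoolFn m} {vs : List ℕ}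
    (hvs : ∀ t ∈ g.2, ∀ k ∈ t.2, IsWeight c r (vs.getD k 0) (f k)) (hg : g.Countable f) :
    IsWeight c r (gateWeight r (List.ofFn c) g.erase vs) (g.eval f) := by
  have h₁ : ∀ t ∈ g.2, IsWeight c r
      (termWeight r (List.ofFn c) (t.1.map fun l => ((l.1 : ℕ), l.2), t.2) vs)
      (conjFn (termFns f t)) := by
    intro t ht
    refine isWeight_conj ?_ (hg.1 t ht)
    rw [termFns, List.map_map]
    refine List.rel_append ?_ ?_
    · rw [List.forall₂_map_left_iff, List.forall₂_map_right_iff, List.forall₂_same]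
      exact fun l _ => isWeight_lit l
    · rw [List.forall₂_map_left_iff, List.forall₂_map_right_iff, List.forall₂_same]
      exact hvs t ht
  have h₂ : IsWeight c r (sumMod r (g.erase.2.map fun t => termWeight r (List.ofFn c) t vs))
      (disjFn (g.2.map fun t => conjFn (termFns f t))) := by
    refine isWeight_disj ?_ hg.2
    rw [TGate.erase, List.map_map, List.forall₂_map_left_iff, List.forall₂_map_right_iff,
      List.forall₂_same]
    exact h₁
  unfold gateWeight
  rcases hn : g.1 with _ | _
  · have e : g.eval f = disjFn (g.2.map fun t => conjFn (termFns f t)) := by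
      funext x; simp [TGate.eval, hn]
    rw [e, TGate.erase, hn]
    exact h₂
  · have e : g.eval f = fun x => !disjFn (g.2.map fun t => conjFn (termFns f t)) x := by
      funext x; simp [TGate.eval, hn]
    have h3 := modelCount_not c (disjFn (g.2.map fun t => conjFn (termFns f t)))
    have h4 := congrArg (Nat.cast : ℕ → ZMod (2 * r + 1)) h3
    have h2 : (2 * r + 1 : ZMod (2 * r + 1)) = 0 := by
      exact_mod_cast ZMod.natCast_self (2 * r + 1)
    rw [e]
    have e' : g.erase.1 = true := hn
    rw [e', Bool.cond_true]
    unfold IsWeight at h₂ ⊢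
    rw [cast_sumMod]
    push_cast at h4
    simp only [List.map_cons, List.map_nil, List.sum_cons, List.sum_nil, Nat.cast_mul]
    push_cast
    linear_combination -h4 + (2 * r : ZMod (2 * r + 1)) * h₂ +
      (modelCount c (disjFn (g.2.map fun t => conjFn (termFns f t))) : ZMod (2 * r + 1)) * h2

/-- `H` is a condition on the nodes that is inherited along arcs. -/
theorem isWeight_dag {γ : Type} {step : γ → (ℕ → BoolFn m) → BoolFn m} {toT : γ → TGate m}
    (hstep : ∀ g f, step g f = (toT g).eval f) {H : List γ → Prop}
    (hH : ∀ g G, H (g :: G) →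
      ((toT g).Countable fun k => Dag.value step (fun _ => false) (G.drop k)) ∧
      ∀ t ∈ (toT g).2, ∀ k ∈ t.2, H (G.drop k)) (G : List γ) (k : ℕ) (hG : H (G.drop k)) :
    IsWeight c r ((dagWeights r (List.ofFn c) (G.map fun g => (toT g).erase)).getD k 0)
      (Dag.value step (fun _ => false) (G.drop k)) := by
  induction G generalizing k with
  | nil => simp [IsWeight, dagWeights, Dag.value, Dag.values, modelCount_false]
  | cons g G ih =>
    cases k with
    | zero =>
      rw [List.drop_zero, Dag.value_cons, hstep]
      obtain ⟨h₁, h₂⟩ := hH g G hG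
      exact isWeight_gate (fun t ht k hk => ih k (h₂ t ht k hk)) h₁
    | succ k => exact ih k hG

theorem dagWeights_lt (c : List (Option Bool)) (G : List NGate) (k : ℕ) :
    (dagWeights r c G).getD k 0 < 2 * r + 1 := by
  induction G generalizing k with
  | nil => simp [dagWeights]
  | cons g G ih =>
    cases k with
    | zero => exact gateWeight_lt _ _ _ _
    | succ k => exact ih k

theorem modelCount_eq_zero_iff_weights {f : BoolFn m} {n : ℕ → ℕ}
    (hn : ∀ r, IsWeight c r (n r) f) (hlt : ∀ r, n r < 2 * r + 1) :
    (∀ r < m + 4, n r = 0) ↔ modelCount c f = 0 := by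
  constructor
  · intro h
    by_contra h0
    refine absurd (modelCount_le c f) (not_le.2 (two_pow_lt_of_odd_dvd (by omega) fun r hr => ?_))
    have := hn r
    rw [IsWeight, h r hr, Nat.cast_zero, zero_mul, eq_comm] at this
    exact (ZMod.natCast_eq_zero_iff _ _).1 this
  · intro h r _
    have := hn r
    rw [IsWeight, h, Nat.cast_zero, (isUnit_modelCount_true c r).mul_left_eq_zero] at this
    exact Nat.eq_zero_of_dvd_of_lt ((ZMod.natCast_eq_zero_iff _ _).1 this) (hlt r)

theorem modelCount_eq_iff_weights {f : BoolFn m} {n : ℕ → ℕ}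
    (hn : ∀ r, IsWeight c r (n r) f) (hlt : ∀ r, n r < 2 * r + 1) :
    (∀ r < m + 4, n r = 1 % (2 * r + 1)) ↔ modelCount c (fun x => !f x) = 0 := by
  have key : ∀ r, n r = 1 % (2 * r + 1) ↔ (n r : ZMod (2 * r + 1)) = 1 := by
    intro r
    have := ZMod.natCast_eq_natCast_iff (n r) 1 (2 * r + 1)
    rw [Nat.cast_one] at this
    rw [this, Nat.ModEq, Nat.mod_eq_of_lt (hlt r)]
  have key' : ∀ r, n r = 1 % (2 * r + 1) ↔ 2 * r + 1 ∣ modelCount c (fun x => !f x) := by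
    intro r
    have h := hn r
    rw [IsWeight, ← modelCount_not c f, Nat.cast_add] at h
    have hu := isUnit_modelCount_true c r
    rw [key, ← ZMod.natCast_eq_zero_iff]
    constructor
    · intro h1; rw [h1] at h; linear_combination h
    · intro h1
      refine hu.mul_left_inj.1 ?_
      rw [← modelCount_not c f, Nat.cast_add]
      linear_combination h - h1
  simp only [key']
  constructor
  · intro h
    by_contra h0
    exact absurd (modelCount_le c _) (not_le.2 (two_pow_lt_of_odd_dvd (by omega) h))
  · intro h r _; rw [h]; exact dvd_zero _

theorem constOn_iff {f : BoolFn m} :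
    ConstOn f c ↔ (∀ x, Agree c x → f x = false) ∨ (∀ x, Agree c x → f x = true) := by
  constructor
  · intro h
    let x₀ : Fin m → Bool := fun i => (c i).getD false
    have h₀ : Agree c x₀ := fun i b hi => by simp [x₀, hi]
    rcases hx : f x₀ with _ | _
    · exact Or.inl fun x hxc => (h x x₀ hxc h₀).trans hx
    · exact Or.inr fun x hxc => (h x x₀ hxc h₀).trans hx
  · rintro (h | h) x y hx hy <;> rw [h x hx, h y hy]

theorem countTest_iff {γ : Type} [Encode γ] {step : γ → (ℕ → BoolFn m) → BoolFn m}
    {toT : γ → TGate m} (hstep : ∀ g f, step g f = (toT g).eval f) {conv : SExp → NGate}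
    (hconv : ∀ g, conv (code g) = (toT g).erase) {H : List γ → Prop}
    (hH : ∀ g G, H (g :: G) →
      ((toT g).Countable fun k => Dag.value step (fun _ => false) (G.drop k)) ∧
      ∀ t ∈ (toT g).2, ∀ k ∈ t.2, H (G.drop k)) {G : List γ} (hG : H G) :
    countTest conv (code G, List.ofFn c) = true ↔
      ConstOn (Dag.value step (fun _ => false) G) c := by
  have hs : (code G).toList.map conv = G.map fun g => (toT g).erase := by
    rw [toList_code, List.map_map]
    exact List.map_congr_left fun g _ => hconv g
  have h₁ : ∀ r, IsWeight c r
      ((dagWeights r (List.ofFn c) (G.map fun g => (toT g).erase)).headD 0)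
      (Dag.value step (fun _ => false) G) := fun r => by
    have := isWeight_dag (c := c) (r := r) hstep hH G 0 hG
    rwa [List.drop_zero, List.getD_eq_getElem?_getD, ← List.head?_eq_getElem?,
      ← List.headD_eq_head?_getD] at this
  have h₂ : ∀ r, (dagWeights r (List.ofFn c) (G.map fun g => (toT g).erase)).headD 0 <
      2 * r + 1 := fun r => by
    have := dagWeights_lt (r := r) (List.ofFn c) (G.map fun g => (toT g).erase) 0
    rwa [List.getD_eq_getElem?_getD, ← List.head?_eq_getElem?, ← List.headD_eq_head?_getD] at this
  have h₃ := modelCount_eq_zero_iff_weights h₁ h₂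
  have h₄ := modelCount_eq_iff_weights h₁ h₂
  rw [modelCount_eq_zero] at h₃ h₄
  simp only [Bool.not_eq_false'] at h₄
  rw [constOn_iff, ← h₃, ← h₄]
  simp [countTest, hs]

end countTest
end KC

namespace KC
open Encode (code)

variable {m : ℕ}

/-! ### cd-PDAG -/

def PGate.toT : PGate m → TGate m
  | const b => (false, cond b [([], [])] [])
  | var i => (false, [([(i, true)], [])])
  | neg k => (true, [([], [k])])
  | conj ks => (false, [([], ks)])
  | disj ks => (false, ks.map fun k => ([], [k]))

def pgateConv (s : SExp) : NGate :=
  cond (s.hd.toNat == 0) (false, cond s.tl.isCons [([], [])] [])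
    (cond (s.hd.toNat == 1) (false, [([(s.tl.toNat, true)], [])])
      (cond (s.hd.toNat == 2) (true, [([], [s.tl.toNat])])
        (cond (s.hd.toNat == 3) (false, [([], s.tl.toNats)])
          (false, s.tl.toNats.map fun k => ([], [k])))))

theorem PT.pgateConv : PT pgateConv := by unfold KC.pgateConv; fun_prop

theorem hd_code_pair {α β : Type} [Encode α] [Encode β] (a : α) (b : β) :
    (code (a, b)).hd = code a := rfl

theorem tl_code_pair {α β : Type} [Encode α] [Encode β] (a : α) (b : β) :
    (code (a, b)).tl = code b := rfl

theorem pgateConv_code (g : PGate m) : pgateConv (code g) = g.toT.erase := by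
  cases g with
  | const b =>
    rw [show code (PGate.const b : PGate m) = code ((0 : ℕ), b) from rfl]
    simp only [pgateConv, hd_code_pair, tl_code_pair, toNat_code, isCons_code]
    cases b <;> rfl
  | var i =>
    rw [show code (PGate.var i : PGate m) = code ((1 : ℕ), i) from rfl]
    simp only [pgateConv, hd_code_pair, tl_code_pair, toNat_code, toNat_code_fin]
    rfl
  | neg k =>
    rw [show code (PGate.neg k : PGate m) = code ((2 : ℕ), k) from rfl]
    simp only [pgateConv, hd_code_pair, tl_code_pair, toNat_code]
    rfl
  | conj ks =>
    rw [show code (PGate.conj ks : PGate m) = code ((3 : ℕ), ks) from rfl]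
    simp only [pgateConv, hd_code_pair, tl_code_pair, toNat_code, toNats_code]
    rfl
  | disj ks =>
    rw [show code (PGate.disj ks : PGate m) = code ((4 : ℕ), ks) from rfl]
    simp only [pgateConv, hd_code_pair, tl_code_pair, toNat_code, toNats_code]
    simp [PGate.toT, TGate.erase, Function.comp_def]

theorem PGate.evalStep_eq (g : PGate m) (f : ℕ → BoolFn m) : g.evalStep f = g.toT.eval f := by
  funext x
  cases g with
  | const b => cases b <;> simp [evalStep, toT, TGate.eval, disjFn, conjFn, termFns]
  | _ => simp [evalStep, toT, TGate.eval, disjFn, conjFn, termFns, Lit.eval, Function.comp_def]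

theorem dependsOn_lit (l : Lit m) : DependsOn l.eval {l.1} := by
  intro x y h; simp [Lit.eval, h l.1 rfl]

theorem PDag.dependsOn_vars (G : PDag m) : DependsOn (PDag.eval G) (PDag.vars G) := by
  have := Dag.value_induction (fun _ _ => True) (step := PGate.evalStep (m := m))
    (d := fun _ => false) (step' := PGate.varsStep) (d' := ∅) DependsOn (fun x y _ => rfl) ?_
    (Dag.EveryNode.true G) 0
  · rw [List.drop_zero] at this; exact this
  · intro g G _ ih
    rw [Dag.value_cons, Dag.value_cons]
    intro x y h
    cases g with
    | const b => rfl
    | var i => exact h i rfl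
    | neg k => exact congrArg not (ih k h)
    | conj ks =>
      simp only [PGate.evalStep]
      rw [Bool.eq_iff_iff, List.all_eq_true, List.all_eq_true]
      refine forall₂_congr fun k hk => ?_
      rw [ih k fun i hi => h i ⟨k, hk, hi⟩]
    | disj ks =>
      simp only [PGate.evalStep]
      rw [Bool.eq_iff_iff, List.any_eq_true, List.any_eq_true]
      refine exists_congr fun k => and_congr_right fun hk => ?_
      rw [ih k fun i hi => h i ⟨k, hk, hi⟩]

theorem oneAXp_cdPDAG : OneAXpInPolyTime cdPDAG := by
  refine oneAXp_of_test _ _ (PT.countTest PT.pgateConv) fun m G hG c => ?_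
  obtain ⟨-, -, hdec, hdet⟩ := hG
  refine countTest_iff (toT := PGate.toT) PGate.evalStep_eq pgateConv_code
    (H := fun G => PDag.Decomposable G ∧ PDag.Deterministic G) (fun g G hG => ⟨?_, ?_⟩)
    ⟨hdec, hdet⟩
  · obtain ⟨⟨h₁, -⟩, ⟨h₂, -⟩⟩ := hG
    cases g with
    | const b => cases b <;> simp [TGate.Countable, PGate.toT, termFns]
    | var i => simp [TGate.Countable, PGate.toT, termFns]
    | neg k => simp [TGate.Countable, PGate.toT, termFns]
    | conj ks =>
      simp only [TGate.Countable, PGate.toT, termFns, List.mem_singleton, forall_eq,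
        List.map_nil, List.nil_append, List.map_cons, List.pairwise_singleton, and_true]
      rw [List.pairwise_map]
      exact (h₁ ks rfl).imp fun {k l} h => h.mono (essVars_subset (PDag.dependsOn_vars _))
        (essVars_subset (PDag.dependsOn_vars _))
    | disj ks =>
      simp only [TGate.Countable, PGate.toT, termFns, List.map_map, List.pairwise_map]
      refine ⟨by simp, (h₂ ks rfl).imp fun {k l} h x hx => h x ?_⟩
      simpa [conjFn, PDag.eval] using hx
  · intro t _ k _
    exact ⟨hG.1.2.drop k, hG.2.2.drop k⟩

/-! ### SDD -/

def SGate.toT : SGate m → TGate m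
  | const b => (false, cond b [([], [])] [])
  | lit i b => (false, [([(i, b)], [])])
  | decomp es => (false, es.map fun e => ([], [e.1, e.2]))

def sgateConv (s : SExp) : NGate :=
  cond (s.hd.toNat == 0) (false, cond s.tl.isCons [([], [])] [])
    (cond (s.hd.toNat == 1) (false, [([s.tl.toLit], [])])
      (false, s.tl.toList.map fun e => ([], [e.hd.toNat, e.tl.toNat])))

theorem PT.sgateConv : PT sgateConv := by unfold KC.sgateConv; fun_prop

theorem sgateConv_code (g : SGate m) : sgateConv (code g) = g.toT.erase := by
  cases g with
  | const b =>
    rw [show code (SGate.const b : SGate m) = code ((0 : ℕ), b) from rfl]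
    simp only [sgateConv, hd_code_pair, tl_code_pair, toNat_code, isCons_code]
    cases b <;> rfl
  | lit i b =>
    rw [show code (SGate.lit i b : SGate m) = code ((1 : ℕ), (i, b)) from rfl]
    simp only [sgateConv, hd_code_pair, tl_code_pair, toNat_code, toLit_code]
    rfl
  | decomp es =>
    rw [show code (SGate.decomp es : SGate m) = code ((2 : ℕ), es) from rfl]
    simp only [sgateConv, hd_code_pair, tl_code_pair, toNat_code, toList_code]
    simp [SGate.toT, TGate.erase, Function.comp_def, hd_code_pair, tl_code_pair, toNat_code]

theorem SGate.evalStep_eq (g : SGate m) (f : ℕ → BoolFn m) : g.evalStep f = g.toT.eval f := by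
  funext x
  cases g with
  | const b => cases b <;> simp [evalStep, toT, TGate.eval, disjFn, conjFn, termFns]
  | _ => simp [evalStep, toT, TGate.eval, disjFn, conjFn, termFns, Lit.eval, Function.comp_def]

theorem Vtree.leaves_subset {s t : Vtree m} (h : s.IsSub t) : s.leaves.Sublist t.leaves := by
  induction t with
  | leaf i => rw [show s = leaf i from h]
  | node l r ihl ihr =>
    rcases h with rfl | h | h
    · exact List.Sublist.refl _
    · exact (ihl h).trans (List.sublist_append_left _ _)
    · exact (ihr h).trans (List.sublist_append_right _ _)

theorem SDDag.dependsOn_leaves (G : SDDag m) (v : Vtree m) (hv : SDDag.Respects G v) :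
    DependsOn (SDDag.eval G) {i | i ∈ v.leaves} := by
  have := Dag.value_induction (fun _ _ => True) (step := SGate.evalStep (m := m))
    (d := fun _ => false) (step' := SGate.respectsStep) (d' := fun _ => False)
    (fun f R => ∀ v : Vtree m, R v → DependsOn f {i | i ∈ v.leaves})
    (fun _ h => h.elim) ?_ (Dag.EveryNode.true G) 0
  · rw [List.drop_zero] at this; exact this v hv
  · intro g G _ ih v hv
    rw [Dag.value_cons] at hv ⊢
    intro x y h
    cases g with
    | const b => rfl
    | lit i b =>
      obtain rfl : v = Vtree.leaf i := hv
      simp [SGate.evalStep, h i (by simp [Vtree.leaves])]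
    | decomp es =>
      obtain ⟨l, r, rfl, hes⟩ := hv
      simp only [SGate.evalStep]
      rw [Bool.eq_iff_iff, List.any_eq_true, List.any_eq_true]
      refine exists_congr fun e => and_congr_right fun he => ?_
      obtain ⟨⟨l', hl, hl'⟩, r', hr, hr'⟩ := hes e he
      rw [ih e.1 l' hl' fun i hi => h i ?_, ih e.2 r' hr' fun i hi => h i ?_]
      · exact List.mem_append_right _ ((Vtree.leaves_subset hr).subset hi)
      · exact List.mem_append_left _ ((Vtree.leaves_subset hl).subset hi)

theorem oneAXp_SDD : OneAXpInPolyTime SDD := by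
  refine oneAXp_of_test _ _ (PT.countTest PT.sgateConv) fun m G hG c => ?_
  obtain ⟨-, -, hpart, hresp⟩ := hG
  refine countTest_iff (toT := SGate.toT) SGate.evalStep_eq sgateConv_code
    (H := fun G => SDDag.Partitions G ∧ ∃ v : Vtree m, v.leaves.Nodup ∧ SDDag.Respects G v)
    (fun g G hG => ?_) ⟨hpart, hresp⟩
  obtain ⟨⟨h₁, h₁'⟩, v, hv, hgv⟩ := hG
  cases g with
  | const b => cases b <;> simp [TGate.Countable, SGate.toT, termFns]
  | lit i b => simp [TGate.Countable, SGate.toT, termFns]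
  | decomp es =>
    rw [SDDag.Respects, Dag.value_cons] at hgv
    obtain ⟨l, r, rfl, hes⟩ := hgv
    simp only [Vtree.leaves, List.nodup_append'] at hv
    simp only [TGate.Countable, SGate.toT, termFns, List.map_map, List.pairwise_map]
    refine ⟨⟨?_, ?_⟩, ?_⟩
    · simp only [List.mem_map, forall_exists_index, and_imp, forall_apply_eq_imp_iff₂,
        List.map_nil, List.nil_append, List.map_cons, List.pairwise_cons, List.mem_singleton,
        forall_eq, List.not_mem_nil, IsEmpty.forall_iff, implies_true, List.Pairwise.nil, and_true]
      intro e he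
      obtain ⟨⟨l', hl, hl'⟩, r', hr, hr'⟩ := hes e he
      refine Disjoint.mono (essVars_subset (SDDag.dependsOn_leaves _ l' hl'))
        (essVars_subset (SDDag.dependsOn_leaves _ r' hr')) (Set.disjoint_left.2 fun i hi hi' => ?_)
      exact hv.2.2 ((Vtree.leaves_subset hl).subset hi) ((Vtree.leaves_subset hr).subset hi')
    · refine (h₁ es rfl).2.1.imp fun {e e'} h x hx => h x ?_
      simp only [Function.comp_apply, conjFn, List.map_cons, List.map_nil, List.nil_append,
        List.all_cons, Bool.and_eq_true] at hx
      exact ⟨hx.1.1, hx.2.1⟩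
    · intro t ht k hk
      obtain ⟨e, he, rfl⟩ := List.mem_map.1 ht
      obtain ⟨⟨l', hl, hl'⟩, r', hr, hr'⟩ := hes e he
      refine ⟨h₁'.drop k, ?_⟩
      simp only [List.mem_cons, List.not_mem_nil, or_false] at hk
      rcases hk with rfl | rfl
      · exact ⟨l', hv.1.sublist (Vtree.leaves_subset hl), hl'⟩
      · exact ⟨r', hv.2.1.sublist (Vtree.leaves_subset hr), hr'⟩

/-! ### OBDD -/

def BGate.toT : BGate m → TGate m
  | const b => (false, cond b [([], [])] [])
  | dec i lo hi => (false, [([(i, false)], [lo]), ([(i, true)], [hi])])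

def bgateConv (s : SExp) : NGate :=
  cond (s.hd.toNat == 0) (false, cond s.tl.isCons [([], [])] [])
    (false, [([(s.tl.hd.toNat, false)], [s.tl.tl.hd.toNat]),
      ([(s.tl.hd.toNat, true)], [s.tl.tl.tl.toNat])])

theorem PT.bgateConv : PT bgateConv := by unfold KC.bgateConv; fun_prop

theorem bgateConv_code (g : BGate m) : bgateConv (code g) = g.toT.erase := by
  cases g with
  | const b =>
    rw [show code (BGate.const b : BGate m) = code ((0 : ℕ), b) from rfl]
    simp only [bgateConv, hd_code_pair, tl_code_pair, toNat_code, isCons_code]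
    cases b <;> rfl
  | dec i lo hi =>
    rw [show code (BGate.dec i lo hi : BGate m) = code ((1 : ℕ), (i, (lo, hi))) from rfl]
    simp only [bgateConv, hd_code_pair, tl_code_pair, toNat_code, toNat_code_fin]
    rfl

theorem BGate.evalStep_eq (g : BGate m) (f : ℕ → BoolFn m) : g.evalStep f = g.toT.eval f := by
  funext x
  cases g with
  | const b => cases b <;> simp [evalStep, toT, TGate.eval, disjFn, conjFn, termFns]
  | dec i lo hi =>
    cases h : x i <;> simp [evalStep, toT, TGate.eval, disjFn, conjFn, termFns, Lit.eval, h]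

theorem BDag.dependsOn_rank {r : Fin m → ℕ} {G : BDag m} (hG : G.OrderedBy r) :
    DependsOn (Dag.value BGate.evalStep (fun _ => false) G)
      {j | ∃ i lo hi, G[0]? = some (BGate.dec i lo hi) ∧ r i ≤ r j} := by
  have key : ∀ k, DependsOn (Dag.value BGate.evalStep (fun _ => false) (G.drop k))
      {j | ∃ i lo hi, G[k]? = some (BGate.dec i lo hi) ∧ r i ≤ r j} := by
    induction G with
    | nil => intro k x y _; simp [Dag.value, Dag.values]
    | cons g G ih =>
      intro k
      cases k with
      | succ k => exact ih hG.2 k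
      | zero =>
        rw [List.drop_zero, Dag.value_cons]
        intro x y h
        cases g with
        | const b => rfl
        | dec i lo hi =>
          have hk : ∀ k ∈ [lo, hi], Dag.value BGate.evalStep (fun _ => false) (G.drop k) x =
              Dag.value BGate.evalStep (fun _ => false) (G.drop k) y := by
            refine fun k hk => ih hG.2 k fun j hj => h j ?_
            obtain ⟨i', lo', hi', hk', hle⟩ := hj
            exact ⟨i, lo, hi, rfl, (hG.1 i lo hi rfl k hk i' lo' hi' hk').le.trans hle⟩
          simp only [BGate.evalStep]
          rw [hk lo (by simp), hk hi (by simp), h i ⟨i, lo, hi, rfl, le_rfl⟩]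
  simpa using key 0

theorem oneAXp_OBDD : OneAXpInPolyTime OBDD := by
  refine oneAXp_of_test _ _ (PT.countTest PT.bgateConv) fun m G hG c => ?_
  obtain ⟨-, -, r, -, hord⟩ := hG
  refine countTest_iff (toT := BGate.toT) BGate.evalStep_eq bgateConv_code
    (H := fun G => BDag.OrderedBy r G)
    (fun g G hG => ⟨?_, fun t _ k _ => Dag.EveryNode.drop hG.2 k⟩) hord
  cases g with
  | const b => cases b <;> simp [TGate.Countable, BGate.toT, termFns]
  | dec i lo hi =>
    have hd : ∀ b, ∀ k ∈ [lo, hi], Disjoint (essVars (Lit.eval (i, b)))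
        (essVars (Dag.value BGate.evalStep (fun _ => false) (G.drop k))) := by
      intro b k hk
      refine Disjoint.mono (essVars_subset (dependsOn_lit _))
        (essVars_subset (BDag.dependsOn_rank (Dag.EveryNode.drop hG.2 k)))
        (Set.disjoint_singleton_left.2 ?_)
      rintro ⟨j, lo', hi', hj, hle⟩
      rw [List.getElem?_drop, add_zero] at hj
      exact absurd (hG.1 i lo hi rfl k hk j lo' hi' hj) (not_lt.2 hle)
    refine ⟨?_, ?_⟩
    · simpa [BGate.toT, termFns] using ⟨hd false lo (by simp), hd true hi (by simp)⟩
    · simp +contextual [BGate.toT, termFns, conjFn, Lit.eval]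

end KC

namespace KC
open Encode (code)

/-! ### CNF formulas: a test by unit propagation -/

def litTrue (c : List (Option Bool)) (l : ℕ × Bool) : Bool :=
  (c.getD l.1 none).isSome && ((c.getD l.1 none).getD false == l.2)

def litFalse (c : List (Option Bool)) (l : ℕ × Bool) : Bool :=
  (c.getD l.1 none).isSome && ((c.getD l.1 none).getD false == !l.2)

def litEq (l l' : ℕ × Bool) : Bool := (l.1 == l'.1) && (l.2 == l'.2)

/-- Below `c`, the clause `C` enforces its literal `l`. -/
def enforces (c : List (Option Bool)) (C : List (ℕ × Bool)) (l : ℕ × Bool) : Bool :=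
  C.any (fun l' => litEq l' l) && C.all fun l' => litEq l' l || litFalse c l'

def propagate (Φ : List (List (ℕ × Bool))) (n : ℕ) (c : List (Option Bool)) :
    List (Option Bool) :=
  (List.range n).map fun j => cond (c.getD j none).isSome (c.getD j none)
    (cond (Φ.any fun C => enforces c C (j, true)) (some true)
      (cond (Φ.any fun C => enforces c C (j, false)) (some false) none))

def propagated (Φ : List (List (ℕ × Bool))) (c : List (Option Bool)) : List (Option Bool) :=
  (propagate Φ c.length)^[c.length] c

def hasConflict (Φ : List (List (ℕ × Bool))) (c : List (Option Bool)) : Bool :=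
  Φ.any fun C => C.all fun l => litFalse c l

def isFalsifiable (Φ : List (List (ℕ × Bool))) (c : List (Option Bool)) : Bool :=
  Φ.any fun C => (!C.any fun l => litTrue c l) &&
    !C.any fun l => C.any fun l' => (l.1 == l'.1) && !(l.2 == l'.2)

def cnfTest (Φ : List (List (ℕ × Bool))) (c : List (Option Bool)) : Bool :=
  hasConflict Φ (propagated Φ c) || !isFalsifiable Φ c

section pt

variable {α : Type} [Encode α]

@[fun_prop]
theorem PT.litTrue {c : α → List (Option Bool)} {l : α → ℕ × Bool} (hc : PT c) (hl : PT l) :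
    PT (fun a => litTrue (c a) (l a)) := by
  unfold KC.litTrue; fun_prop

@[fun_prop]
theorem PT.litFalse {c : α → List (Option Bool)} {l : α → ℕ × Bool} (hc : PT c) (hl : PT l) :
    PT (fun a => litFalse (c a) (l a)) := by
  unfold KC.litFalse; fun_prop

@[fun_prop]
theorem PT.litEq {l l' : α → ℕ × Bool} (hl : PT l) (hl' : PT l') :
    PT (fun a => litEq (l a) (l' a)) := by
  unfold KC.litEq; fun_prop

@[fun_prop]
theorem PT.enforces {c : α → List (Option Bool)} {C : α → List (ℕ × Bool)} {l : α → ℕ × Bool}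
    (hc : PT c) (hC : PT C) (hl : PT l) : PT (fun a => enforces (c a) (C a) (l a)) := by
  unfold KC.enforces; fun_prop

@[fun_prop]
theorem PT.propagate {Φ : α → List (List (ℕ × Bool))} {n : α → ℕ} {c : α → List (Option Bool)}
    (hΦ : PT Φ) (hn : PT n) (hc : PT c) : PT (fun a => propagate (Φ a) (n a) (c a)) := by
  unfold KC.propagate; fun_prop

theorem size_option_bool_list (c : List (Option Bool)) : (code c).size ≤ 6 * c.length + 1 := by
  induction c with
  | nil => simp [Encode.code, codeList, SExp.size]
  | cons o c ih =>
    have : (code o).size ≤ 5 := by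
      rcases o with _ | _ | _ <;> simp [Encode.code, SExp.size]
    rw [size_code_cons, List.length_cons]; omega

@[fun_prop]
theorem PT.propagated {Φ : α → List (List (ℕ × Bool))} {c : α → List (Option Bool)}
    (hΦ : PT Φ) (hc : PT c) : PT (fun a => propagated (Φ a) (c a)) := by
  suffices h : PT (fun p : List (List (ℕ × Bool)) × List (Option Bool) =>
    KC.propagated p.1 p.2) from h.comp (hΦ.mk hc)
  refine PT.iterate (α := List (List (ℕ × Bool)) × List (Option Bool))
    (step := fun p c => KC.propagate p.1 p.2.length c) (by fun_prop) (by fun_prop)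
    (by fun_prop) (6 * Polynomial.X) fun a s => ?_
  have h₁ := size_option_bool_list (KC.propagate a.1 a.2.length s)
  have h₂ : (KC.propagate a.1 a.2.length s).length = a.2.length := by simp [KC.propagate]
  have h₃ := length_le_size a.2
  have h₄ := size_code_pos a.1
  obtain ⟨Φ, c⟩ := a
  rw [size_code_pair]
  simp at *
  omega

@[fun_prop]
theorem PT.cnfTest {Φ : α → List (List (ℕ × Bool))} {c : α → List (Option Bool)}
    (hΦ : PT Φ) (hc : PT c) : PT (fun a => cnfTest (Φ a) (c a)) := by
  unfold KC.cnfTest hasConflict isFalsifiable; fun_prop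

end pt

section correctness

variable {m : ℕ}

def eraseLit (l : Lit m) : ℕ × Bool := ((l.1 : ℕ), l.2)

def eraseCnf (Φ : List (List (Lit m))) : List (List (ℕ × Bool)) := Φ.map (List.map eraseLit)

variable (c : Fin m → Option Bool)

theorem getD_ofFn (i : Fin m) : (List.ofFn c).getD (i : ℕ) none = c i := by
  simp [List.getD_eq_getElem?_getD]

theorem litTrue_iff (l : Lit m) : litTrue (List.ofFn c) (eraseLit l) = true ↔ c l.1 = some l.2 := by
  simp only [litTrue, eraseLit, getD_ofFn]
  rcases c l.1 with _ | _ <;> simp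

theorem litFalse_iff (l : Lit m) :
    litFalse (List.ofFn c) (eraseLit l) = true ↔ c l.1 = some (!l.2) := by
  simp only [litFalse, eraseLit, getD_ofFn]
  rcases c l.1 with _ | _ <;> simp

theorem litEq_iff (l l' : Lit m) : litEq (eraseLit l) (eraseLit l') = true ↔ l = l' := by
  simp [litEq, eraseLit, Prod.ext_iff, Fin.ext_iff]

def Enforces (C : List (Lit m)) (l : Lit m) : Prop :=
  l ∈ C ∧ ∀ l' ∈ C, l' = l ∨ c l'.1 = some (!l'.2)

theorem enforces_iff (C : List (Lit m)) (l : Lit m) :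
    enforces (List.ofFn c) (C.map eraseLit) (eraseLit l) = true ↔ Enforces c C l := by
  simp only [enforces, Enforces, List.any_map, List.all_map, Bool.and_eq_true, List.any_eq_true,
    List.all_eq_true, Function.comp_apply, Bool.or_eq_true, litEq_iff, litFalse_iff]
  simp

variable (Φ : List (List (Lit m)))

open Classical in
noncomputable def unitStep : Fin m → Option Bool := fun j =>
  if (c j).isSome then c j else
    if ∃ C ∈ Φ, Enforces c C (j, true) then some true else
      if ∃ C ∈ Φ, Enforces c C (j, false) then some false else none

theorem any_enforces_iff (l : Lit m) :
    ((eraseCnf Φ).any fun C => enforces (List.ofFn c) C (eraseLit l)) = true ↔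
      ∃ C ∈ Φ, Enforces c C l := by
  simp only [eraseCnf, List.any_map, List.any_eq_true, Function.comp_apply, enforces_iff]

theorem propagate_ofFn : propagate (eraseCnf Φ) m (List.ofFn c) = List.ofFn (unitStep c Φ) := by
  refine List.ext_getElem (by simp [propagate]) fun n h₁ h₂ => ?_
  have hn : n < m := by simpa using h₂
  have h₃ := any_enforces_iff c Φ (⟨n, hn⟩, true)
  have h₄ := any_enforces_iff c Φ (⟨n, hn⟩, false)
  have h₅ := getD_ofFn c ⟨n, hn⟩
  simp only [eraseLit] at h₃ h₄ h₅
  simp only [propagate, List.getElem_map, List.getElem_range, List.getElem_ofFn]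
  simp only [unitStep, Bool.cond_eq_ite, h₅]
  classical
  exact if_congr Iff.rfl rfl (if_congr h₃ rfl (if_congr h₄ rfl rfl))

theorem propagate_iterate_ofFn (k : ℕ) : (propagate (eraseCnf Φ) m)^[k] (List.ofFn c) =
    List.ofFn ((fun c => unitStep c Φ)^[k] c) := by
  induction k generalizing c with
  | zero => rfl
  | succ k ih => rw [Function.iterate_succ_apply, propagate_ofFn, ih]; rfl

variable {c Φ}

theorem unitStep_extends {i : Fin m} {b : Bool} (h : c i = some b) : unitStep c Φ i = some b := by
  simp [unitStep, h]

theorem cnfEval_iff {x : Fin m → Bool} :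
    cnfEval Φ x = true ↔ ∀ C ∈ Φ, ∃ l ∈ C, x l.1 = l.2 := by
  simp [cnfEval, clauseEval, Lit.eval]

theorem agree_unitStep {x : Fin m → Bool} (hx : Agree c x) (hΦ : cnfEval Φ x = true) :
    Agree (unitStep c Φ) x := by
  have key : ∀ l : Lit m, (∃ C ∈ Φ, Enforces c C l) → x l.1 = l.2 := by
    rintro l ⟨C, hC, -, hl⟩
    obtain ⟨l', hl', hxl'⟩ := cnfEval_iff.1 hΦ C hC
    rcases hl l' hl' with rfl | h
    · exact hxl'
    · have := hx _ _ h; rw [hxl'] at this; cases h : l'.2 <;> simp [h] at this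
  intro i b h
  unfold unitStep at h
  split_ifs at h with h₁ h₂ h₃
  · exact hx i b h
  · rw [key _ h₂]; simpa using h
  · rw [key _ h₃]; simpa using h

theorem iterate_fixed_of_measure {α : Type*} (f : α → α) (μ : α → ℕ)
    (h : ∀ a, f a = a ∨ μ (f a) < μ a) (n : ℕ) (a : α) (ha : μ a ≤ n) :
    f (f^[n] a) = f^[n] a := by
  induction n generalizing a with
  | zero => exact (h a).resolve_right (by omega)
  | succ n ih =>
    rcases h a with h' | h'
    · rw [Function.iterate_fixed h', h']
    · exact ih (f a) (by omega)

theorem unitStep_fixed_or_lt : unitStep c Φ = c ∨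
    (Finset.univ.filter fun i => unitStep c Φ i = none).card <
      (Finset.univ.filter fun i => c i = none).card := by
  by_cases h : unitStep c Φ = c
  · exact Or.inl h
  · obtain ⟨i, hi⟩ := Function.ne_iff.1 h
    refine Or.inr (Finset.card_lt_card (Finset.ssubset_iff_subset_ne.2 ⟨fun j hj => ?_, fun e => ?_⟩))
    · simp only [Finset.mem_filter_univ] at hj ⊢
      by_contra hc
      obtain ⟨b, hb⟩ := Option.ne_none_iff_exists'.1 hc
      rw [unitStep_extends hb] at hj; cases hj
    · have h₁ : c i = none := by
        by_contra hc
        obtain ⟨b, hb⟩ := Option.ne_none_iff_exists'.1 hc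
        exact hi (by rw [unitStep_extends hb, hb])
      have h₂ : i ∈ Finset.univ.filter fun i => unitStep c Φ i = none := by
        rw [e]; simpa using h₁
      rw [Finset.mem_filter_univ] at h₂
      exact hi (by rw [h₁, h₂])

variable (c Φ)

noncomputable def unitClosure : Fin m → Option Bool := (fun c => unitStep c Φ)^[m] c

theorem propagated_ofFn : propagated (eraseCnf Φ) (List.ofFn c) = List.ofFn (unitClosure c Φ) := by
  rw [propagated, List.length_ofFn, propagate_iterate_ofFn]; rfl

theorem unitStep_unitClosure : unitStep (unitClosure c Φ) Φ = unitClosure c Φ :=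
  iterate_fixed_of_measure (fun c => unitStep c Φ)
    (fun c => (Finset.univ.filter fun i => c i = none).card) (fun _ => unitStep_fixed_or_lt) m c
    ((Finset.card_le_univ _).trans (by simp))

variable {c Φ}

theorem unitClosure_extends {i : Fin m} {b : Bool} (h : c i = some b) :
    unitClosure c Φ i = some b := by
  have : ∀ k, (fun c => unitStep c Φ)^[k] c i = some b := by
    intro k
    induction k with
    | zero => exact h
    | succ k ih => rw [Function.iterate_succ_apply']; exact unitStep_extends ih
  exact this m

theorem agree_unitClosure {x : Fin m → Bool} (hx : Agree c x) (hΦ : cnfEval Φ x = true) :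
    Agree (unitClosure c Φ) x := by
  have : ∀ k, Agree ((fun c => unitStep c Φ)^[k] c) x := by
    intro k
    induction k with
    | zero => exact hx
    | succ k ih => rw [Function.iterate_succ_apply']; exact agree_unitStep ih hΦ
  exact this m

def Conflict (c : Fin m → Option Bool) (Φ : List (List (Lit m))) : Prop :=
  ∃ C ∈ Φ, ∀ l ∈ C, c l.1 = some (!l.2)

theorem hasConflict_iff : hasConflict (eraseCnf Φ) (List.ofFn c) = true ↔ Conflict c Φ := by
  simp only [hasConflict, Conflict, eraseCnf, List.any_map, List.any_eq_true, Function.comp_apply,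
    List.all_map, List.all_eq_true, litFalse_iff]

theorem Conflict.not_sat (h : Conflict (unitClosure c Φ) Φ) (x : Fin m → Bool)
    (hx : Agree c x) : cnfEval Φ x = false := by
  by_contra hΦ
  rw [Bool.not_eq_false] at hΦ
  obtain ⟨C, hC, hl⟩ := h
  obtain ⟨l, hlC, hxl⟩ := cnfEval_iff.1 hΦ C hC
  have := agree_unitClosure hx hΦ _ _ (hl l hlC)
  rw [hxl] at this; cases h : l.2 <;> simp [h] at this

theorem isFalsifiable_iff : isFalsifiable (eraseCnf Φ) (List.ofFn c) = true ↔
    ∃ x, Agree c x ∧ cnfEval Φ x = false := by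
  have h : isFalsifiable (eraseCnf Φ) (List.ofFn c) = true ↔
      ∃ C ∈ Φ, (∀ l ∈ C, c l.1 ≠ some l.2) ∧ ∀ l ∈ C, ∀ l' ∈ C, l.1 = l'.1 → l.2 = l'.2 := by
    simp only [isFalsifiable, eraseCnf, List.any_map, List.any_eq_true, Function.comp_apply,
      Bool.and_eq_true, Bool.not_eq_true', List.any_eq_false, litTrue_iff, ne_eq, not_exists,
      not_and]
    simp [eraseLit, Fin.ext_iff]
  rw [h]
  constructor
  · rintro ⟨C, hC, h₁, h₂⟩
    classical
    let x : Fin m → Bool := fun j => (c j).getD (decide ((j, false) ∈ C))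
    refine ⟨x, fun i b hi => by simp [x, hi], ?_⟩
    rw [← Bool.not_eq_true, cnfEval_iff]
    push Not
    refine ⟨C, hC, fun l hl hxl => ?_⟩
    simp only [x] at hxl
    obtain ⟨j, b⟩ := l
    rcases hcj : c j with _ | a
    · simp only [hcj, Option.getD_none] at hxl
      cases b with
      | false => simp [hl] at hxl
      | true => exact absurd (h₂ _ hl _ (of_decide_eq_true hxl) rfl) (by simp)
    · simp only [hcj, Option.getD_some] at hxl
      exact h₁ _ hl (by simp [hcj, hxl])
  · rintro ⟨x, hx, hΦ⟩
    rw [← Bool.not_eq_true, cnfEval_iff] at hΦ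
    push Not at hΦ
    obtain ⟨C, hC, hl⟩ := hΦ
    refine ⟨C, hC, fun l hlC h => hl l hlC (hx _ _ h), fun l h l' h' e => ?_⟩
    have h₁ := hl l h
    have h₂ := hl l' h'
    rw [e] at h₁
    revert h₁ h₂
    cases x l'.1 <;> cases l.2 <;> cases l'.2 <;> simp

theorem cnfTest_iff (h : ¬ Conflict (unitClosure c Φ) Φ → ∃ x, Agree c x ∧ cnfEval Φ x = true) :
    cnfTest (eraseCnf Φ) (List.ofFn c) = true ↔ ConstOn (cnfEval Φ) c := by
  rw [constOn_iff, cnfTest, Bool.or_eq_true, propagated_ofFn, hasConflict_iff, Bool.not_eq_true',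
    ← Bool.not_eq_true, isFalsifiable_iff]
  refine or_congr ⟨fun h' => h'.not_sat, fun h' => ?_⟩ ?_
  · by_contra hc
    obtain ⟨x, hx, hΦ⟩ := h hc
    rw [h' x hx] at hΦ; cases hΦ
  · simp

def toCnf (s : SExp) : List (List (ℕ × Bool)) := s.toList.map fun C => C.toList.map SExp.toLit

theorem toCnf_code (Φ : List (List (Lit m))) : toCnf (code Φ) = eraseCnf Φ := by
  rw [toCnf, toList_code, List.map_map, eraseCnf]
  refine List.map_congr_left fun C _ => ?_
  rw [Function.comp_apply, toList_code, List.map_map]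
  exact List.map_congr_left fun l _ => toLit_code l

theorem cnfTest_code
    (h : ¬ Conflict (unitClosure c Φ) Φ → ∃ x, Agree c x ∧ cnfEval Φ x = true) :
    cnfTest (toCnf (code Φ)) (List.ofFn c) = true ↔ ConstOn (cnfEval Φ) c := by
  rw [toCnf_code]; exact cnfTest_iff h

theorem PT.toCnf : PT toCnf := by unfold KC.toCnf; fun_prop

/-- Unit propagation is complete for renamable Horn formulas. -/
theorem exists_model_of_renamable {R : Set (Fin m)}
    (hR : ∀ C ∈ Φ, ∀ l ∈ C, ∀ l' ∈ C, (l.2 = true ↔ l.1 ∉ R) → (l'.2 = true ↔ l'.1 ∉ R) → l = l')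
    (hc : ¬ Conflict (unitClosure c Φ) Φ) : ∃ x, Agree c x ∧ cnfEval Φ x = true := by
  classical
  let c' := unitClosure c Φ
  let x : Fin m → Bool := fun j => (c' j).getD (decide (j ∈ R))
  refine ⟨x, fun i b hi => by simp [x, c', unitClosure_extends hi], cnfEval_iff.2 fun C hC => ?_⟩
  by_contra! hl
  have h₁ : ∀ l ∈ C, c' l.1 = some (!l.2) ∨ c' l.1 = none ∧ (l.2 = true ↔ l.1 ∉ R) := by
    intro l hlC
    have := hl l hlC
    simp only [x] at this
    rcases h : c' l.1 with _ | a
    · refine Or.inr ⟨rfl, ?_⟩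
      rw [h, Option.getD_none] at this
      by_cases hlR : l.1 ∈ R <;> cases h2 : l.2 <;> simp_all
    · left
      rw [h, Option.getD_some] at this
      cases a <;> cases h2 : l.2 <;> simp_all
  obtain ⟨l, hlC, hlf⟩ : ∃ l ∈ C, c' l.1 ≠ some (!l.2) := by
    by_contra! h; exact hc ⟨C, hC, h⟩
  obtain ⟨hn, hpos⟩ := (h₁ l hlC).resolve_left hlf
  have hen : Enforces c' C l := ⟨hlC, fun l' hl' => (h₁ l' hl').symm.imp_left fun h =>
    hR C hC l' hl' l hlC h.2 hpos⟩
  have hfix := congrFun (unitStep_unitClosure c Φ) l.1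
  change unitStep c' Φ l.1 = c' l.1 at hfix
  have hex : ∃ C ∈ Φ, Enforces c' C (l.1, l.2) := ⟨C, hC, hen⟩
  rw [hn] at hfix
  unfold unitStep at hfix
  rw [hn] at hfix
  cases h2 : l.2 <;> rw [h2] at hex <;>
    simp only [Option.isSome_none, Bool.false_eq_true, if_false, if_pos hex] at hfix
  · split_ifs at hfix
  · cases hfix

theorem oneAXp_renHC : OneAXpInPolyTime renHC :=
  oneAXp_of_test _ (fun p => cnfTest (toCnf p.1) p.2)
    (PT.cnfTest (PT.toCnf.comp PT.fst) PT.snd)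
    fun _ _ hΦ _ => cnfTest_code (exists_model_of_renamable hΦ.choose_spec)

/-- Unit propagation is complete for formulas that contain their prime implicates. -/
theorem exists_model_of_prime {m : ℕ} {Φ : List (List (Lit m))} {c : Fin m → Option Bool}
    (hΦ : ∀ D, Simple D → (∀ x, cnfEval Φ x = true → clauseEval D x = true) → ∃ C ∈ Φ, C ⊆ D)
    (hc : ¬ Conflict (unitClosure c Φ) Φ) : ∃ x, Agree c x ∧ cnfEval Φ x = true := by
  by_contra! h
  let D : List (Lit m) := (List.finRange m).filterMap fun i => (c i).map fun b => (i, !b)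
  have hD : ∀ l : Lit m, l ∈ D ↔ c l.1 = some (!l.2) := by
    rintro ⟨i, b⟩
    simp only [D, List.mem_filterMap, List.mem_finRange, true_and, Option.map_eq_some_iff,
      Prod.mk.injEq]
    constructor
    · rintro ⟨_, b', hb', rfl, rfl⟩; simpa using hb'
    · intro h; exact ⟨i, !b, h, rfl, by simp⟩
  suffices h : Simple D ∧ ∀ x, cnfEval Φ x = true → clauseEval D x = true by
    obtain ⟨C, hC, hCD⟩ := hΦ D h.1 h.2
    exact hc ⟨C, hC, fun l hl => unitClosure_extends ((hD l).1 (hCD hl))⟩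
  constructor
  · have : (D.map Prod.fst).Sublist (List.finRange m) := by
      have e : D.map Prod.fst = (List.finRange m).filter fun i => (c i).isSome := by
        rw [← List.filterMap_eq_filter, List.map_filterMap]
        refine List.filterMap_congr fun i _ => ?_
        cases h : c i <;> simp [h, Option.guard]
      rw [e]; exact List.filter_sublist
    exact (List.nodup_finRange m).sublist this
  · intro x hx
    have : ¬ Agree c x := fun hA => h x hA hx
    simp only [Agree, not_forall] at this
    obtain ⟨i, b, hi, hxi⟩ := this
    refine List.any_eq_true.2 ⟨(i, !b), (hD _).2 (by simpa using hi), ?_⟩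
    cases b <;> simp_all [Lit.eval]

theorem oneAXp_PI : OneAXpInPolyTime PI := by
  refine oneAXp_of_test _ (fun p => cnfTest (toCnf p.1) p.2)
    (PT.cnfTest (PT.toCnf.comp PT.fst) PT.snd) fun m Φ hΦ c => ?_
  exact cnfTest_code (exists_model_of_prime hΦ.2.1)

def flipLit (l : Lit m) : Lit m := (l.1, !l.2)

theorem flipLit_flipLit (l : Lit m) : flipLit (flipLit l) = l := by simp [flipLit]

theorem termEval_flip (T : List (Lit m)) (x : Fin m → Bool) :
    termEval (T.map flipLit) x = !clauseEval T x := by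
  induction T with
  | nil => rfl
  | cons l T ih =>
    simp only [termEval, clauseEval, List.map_cons, List.all_cons, List.any_cons] at ih ⊢
    rw [ih, Bool.not_or]; congr 1
    simp only [Lit.eval, flipLit]; cases x l.1 <;> cases l.2 <;> rfl

theorem dnfEval_eq_not_cnfEval (Φ : List (List (Lit m))) (x : Fin m → Bool) :
    dnfEval Φ x = !cnfEval (Φ.map (List.map flipLit)) x := by
  induction Φ with
  | nil => rfl
  | cons T Φ ih =>
    simp only [dnfEval, cnfEval, List.map_cons, List.all_cons, List.any_cons] at ih ⊢
    rw [ih, Bool.not_and]; congr 1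
    rw [← termEval_flip, List.map_map]
    simp [Function.comp_def, flipLit_flipLit]

theorem constOn_not {κ : BoolFn m} {c : Fin m → Option Bool} :
    ConstOn (fun x => !κ x) c ↔ ConstOn κ c := by
  simp [ConstOn]

def flipCnf (Φ : List (List (ℕ × Bool))) : List (List (ℕ × Bool)) :=
  Φ.map fun C => C.map fun l => (l.1, !l.2)

theorem PT.flipCnf : PT flipCnf := by unfold KC.flipCnf; fun_prop

theorem flipCnf_eraseCnf (Φ : List (List (Lit m))) :
    flipCnf (eraseCnf Φ) = eraseCnf (Φ.map (List.map flipLit)) := by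
  simp [flipCnf, eraseCnf, Function.comp_def, eraseLit, flipLit]

theorem cnfTest_flip_code
    (hΦ : ∀ U, Simple U → (∀ x, termEval U x = true → dnfEval Φ x = true) → ∃ T ∈ Φ, T ⊆ U) :
    cnfTest (flipCnf (toCnf (code Φ))) (List.ofFn c) = true ↔ ConstOn (dnfEval Φ) c := by
  have e : dnfEval Φ = fun x => !cnfEval (Φ.map (List.map flipLit)) x :=
    funext fun x => dnfEval_eq_not_cnfEval Φ x
  rw [toCnf_code, flipCnf_eraseCnf, e, constOn_not]
  refine cnfTest_iff (exists_model_of_prime fun D hD h => ?_)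
  have h' : ∀ x, termEval (D.map flipLit) x = true → dnfEval Φ x = true := by
    intro x hx
    rw [termEval_flip, Bool.not_eq_true'] at hx
    rw [dnfEval_eq_not_cnfEval, Bool.not_eq_true', ← Bool.not_eq_true]
    intro h'; rw [h x h'] at hx; cases hx
  obtain ⟨T, hT, hTD⟩ :=
    hΦ (D.map flipLit) (by simpa [Simple, Function.comp_def, flipLit] using hD) h'
  refine ⟨T.map flipLit, List.mem_map_of_mem hT, fun l hl => ?_⟩
  obtain ⟨l', hl', rfl⟩ := List.mem_map.1 hl
  obtain ⟨l'', hl'', rfl⟩ := List.mem_map.1 (hTD hl')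
  rwa [flipLit_flipLit]

theorem oneAXp_IP : OneAXpInPolyTime IP :=
  oneAXp_of_test _ (fun p => cnfTest (flipCnf (toCnf p.1)) p.2)
    (PT.cnfTest (PT.flipCnf.comp (PT.toCnf.comp PT.fst)) PT.snd)
    fun _ _ hΦ _ => cnfTest_flip_code hΦ.2.1

end correctness
end KC

namespace KC
open Encode (code)

/-! ### dFSD -/

section raw

/-- A node: whether it is an inner one, its label, and its edges. -/
abbrev RawFGate := Bool × Option ℕ × List ((Bool × Bool) × ℕ)

def hasValue (p : Bool × Bool) (b : Bool) : Bool := cond b p.2 p.1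

/-- Without a target, the sink is accepting. With the target `(i, b)`, those nodes are accepting
at which all points with the value `b` of the variable `i` are stuck. -/
def rawAccepting (τ : Option (ℕ × Bool)) (g : RawFGate) : Bool :=
  cond τ.isSome
    (g.1 && cond g.2.1.isSome
      ((g.2.1.getD 0 == (τ.getD (0, false)).1) &&
        g.2.2.all fun e => !hasValue e.1 (τ.getD (0, false)).2)
      (g.2.2.all fun e => !(e.1.1 || e.1.2)))
    (!g.1)

def rawPassable (c : List (Option Bool)) (lab : Option ℕ) (p : Bool × Bool) : Bool :=
  cond (lab.isSome && (c.getD (lab.getD 0) none).isSome)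
    (hasValue p ((c.getD (lab.getD 0) none).getD false)) (p.1 || p.2)

def rawReach (τ : Option (ℕ × Bool)) (c : List (Option Bool)) (g : RawFGate)
    (vs : List Bool) : Bool :=
  rawAccepting τ g ||
    (g.1 && g.2.2.any fun e => rawPassable c g.2.1 e.1 && vs.getD e.2 τ.isSome)

def rawReaches (τ : Option (ℕ × Bool)) (c : List (Option Bool)) (G : List RawFGate) : List Bool :=
  G.foldr (fun g vs => rawReach τ c g vs :: vs) []

def toFGate (s : SExp) : RawFGate :=
  (s.hd.toNat == 1, cond s.tl.hd.isCons (some s.tl.hd.tl.toNat) none,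
    s.tl.tl.toList.map fun e => ((e.hd.hd.isCons, e.hd.tl.isCons), e.tl.toNat))

def extendCube (c : List (Option Bool)) (i : ℕ) (b : Bool) : List (Option Bool) :=
  (List.range c.length).map fun j => cond (j == i) (some b) (c.getD j none)

def rawStuck (c : List (Option Bool)) (G : List RawFGate) : Bool :=
  (List.range c.length).any fun i => [false, true].any fun b =>
    (!(c.getD i none).isSome || ((c.getD i none).getD false == b)) &&
      (rawReaches (some (i, b)) (extendCube c i b) G).headD true

def fsdTest (p : SExp × List (Option Bool)) : Bool :=
  !(rawReaches none p.2 (p.1.toList.map toFGate)).headD false ||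
    !rawStuck p.2 (p.1.toList.map toFGate)

variable {α : Type} [Encode α]

@[fun_prop]
theorem PT.hasValue {p : α → Bool × Bool} {b : α → Bool} (hp : PT p) (hb : PT b) :
    PT (fun a => hasValue (p a) (b a)) := by
  unfold KC.hasValue; fun_prop

@[fun_prop]
theorem PT.rawAccepting {τ : α → Option (ℕ × Bool)} {g : α → RawFGate} (hτ : PT τ) (hg : PT g) :
    PT (fun a => rawAccepting (τ a) (g a)) := by
  unfold KC.rawAccepting; fun_prop

@[fun_prop]
theorem PT.rawPassable {c : α → List (Option Bool)} {lab : α → Option ℕ} {p : α → Bool × Bool}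
    (hc : PT c) (hl : PT lab) (hp : PT p) : PT (fun a => rawPassable (c a) (lab a) (p a)) := by
  unfold KC.rawPassable; fun_prop

@[fun_prop]
theorem PT.rawReach {τ : α → Option (ℕ × Bool)} {c : α → List (Option Bool)} {g : α → RawFGate}
    {vs : α → List Bool} (hτ : PT τ) (hc : PT c) (hg : PT g) (hvs : PT vs) :
    PT (fun a => rawReach (τ a) (c a) (g a) (vs a)) := by
  unfold KC.rawReach; fun_prop

@[fun_prop]
theorem PT.rawReaches {τ : α → Option (ℕ × Bool)} {c : α → List (Option Bool)}
    {G : α → List RawFGate} (hτ : PT τ) (hc : PT c) (hG : PT G) :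
    PT (fun a => rawReaches (τ a) (c a) (G a)) := by
  suffices h : PT (fun p : Option (ℕ × Bool) × List (Option Bool) × List RawFGate =>
    KC.rawReaches p.1 p.2.1 p.2.2) from h.comp (hτ.mk (hc.mk hG))
  refine PT.foldr (α := Option (ℕ × Bool) × List (Option Bool) × List RawFGate)
    (step := fun p g vs => KC.rawReach p.1 p.2.1 g vs :: vs)
    (PT.const []) (by fun_prop) (by fun_prop) 4 fun a b s => ?_
  have := size_bool_le (KC.rawReach a.1 a.2.1 b s)
  rw [size_code_cons]; simp; omega

theorem PT.toFGate : PT toFGate := by unfold KC.toFGate; fun_prop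

@[fun_prop]
theorem PT.extendCube {c : α → List (Option Bool)} {i : α → ℕ} {b : α → Bool}
    (hc : PT c) (hi : PT i) (hb : PT b) : PT (fun a => extendCube (c a) (i a) (b a)) := by
  unfold KC.extendCube; fun_prop

@[fun_prop]
theorem PT.rawStuck {c : α → List (Option Bool)} {G : α → List RawFGate} (hc : PT c) (hG : PT G) :
    PT (fun a => rawStuck (c a) (G a)) := by
  unfold KC.rawStuck; fun_prop

theorem PT.fsdTest : PT fsdTest := by
  have := PT.toFGate
  unfold KC.fsdTest; fun_prop

end raw

section typed

variable {m : ℕ}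

def accepting (τ : Option (Fin m × Bool)) : FGate m → Bool
  | .sink => τ.isNone
  | .inner (some i) es => match τ with
    | some (j, b) => (i == j) && es.all fun e => decide (b ∉ e.1)
    | none => false
  | .inner none es => τ.isSome && es.all fun e => decide (e.1 = ∅)

def edgeOK (x : Fin m → Bool) : Option (Fin m) → Finset Bool → Bool
  | some i, S => decide (x i ∈ S)
  | none, S => decide (S ≠ ∅)

/-- The point `x` reaches an accepting node. -/
def reachStep (τ : Option (Fin m × Bool)) (g : FGate m) (f : ℕ → BoolFn m) : BoolFn m := fun x =>
  accepting τ g || match g with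
    | .sink => false
    | .inner lab es => es.any fun e => edgeOK x lab e.1 && f e.2 x

def edgePassable (c : Fin m → Option Bool) : Option (Fin m) → Finset Bool → Bool
  | some i, S => match c i with
    | some b => decide (b ∈ S)
    | none => decide (S ≠ ∅)
  | none, S => decide (S ≠ ∅)

/-- Some point of the subcube `c` reaches an accepting node. -/
def passStep (τ : Option (Fin m × Bool)) (c : Fin m → Option Bool) (g : FGate m)
    (f : ℕ → Bool) : Bool :=
  accepting τ g || match g with
    | .sink => false
    | .inner lab es => es.any fun e => edgePassable c lab e.1 && f e.2

variable {τ : Option (Fin m × Bool)} {c : Fin m → Option Bool}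

theorem reach_update {G : FDag m} {i : Fin m} {x : Fin m → Bool} {d : Bool}
    (h : Dag.value (reachStep τ) (fun _ => d) G x = true) :
    (∃ S, (i, S) ∈ FDag.tests G ∧ x i ∈ S) ∨
      ∀ b, Dag.value (reachStep τ) (fun _ => d) G (Function.update x i b) = true := by
  have := Dag.value_induction (fun _ _ => True) (step := reachStep τ) (d := fun _ => d)
    (step' := FGate.testsStep) (d' := ∅) (G := G)
    (fun f T => f x = true → (∃ S, (i, S) ∈ T ∧ x i ∈ S) ∨ ∀ b, f (Function.update x i b) = true)
    (fun h => Or.inr fun _ => h) ?_ (Dag.EveryNode.true G) 0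
  · rw [List.drop_zero] at this; exact this h
  · intro g G _ ih h
    rw [Dag.value_cons] at h
    simp only [Dag.value_cons]
    rcases Bool.or_eq_true _ _ ▸ h with h | h
    · exact Or.inr fun b => by simp [reachStep, h]
    · cases g with
      | sink => cases h
      | inner lab es =>
        obtain ⟨e, he, h'⟩ := List.any_eq_true.1 h
        obtain ⟨h₁, h₂⟩ := Bool.and_eq_true _ _ ▸ h'
        by_cases hlab : lab = some i
        · subst hlab
          exact Or.inl ⟨e.1, ⟨e, he, Or.inl ⟨rfl, rfl⟩⟩, by simpa [edgeOK] using h₁⟩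
        · rcases ih e.2 h₂ with ⟨S, hS, hx⟩ | hb
          · exact Or.inl ⟨S, ⟨e, he, Or.inr hS⟩, hx⟩
          · refine Or.inr fun b => ?_
            simp only [reachStep, Bool.or_eq_true, List.any_eq_true, Bool.and_eq_true]
            refine Or.inr ⟨e, he, ?_, hb b⟩
            cases lab with
            | none => exact h₁
            | some j =>
              have : j ≠ i := fun e => hlab (e ▸ rfl)
              simpa [edgeOK, Function.update_of_ne this] using h₁

theorem pass_iff_reach {G : FDag m} (hG : G.Focusing) (d : Bool) :
    Dag.value (passStep τ c) d G = true ↔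
      ∃ x, Agree c x ∧ Dag.value (reachStep τ) (fun _ => d) G x = true := by
  let x₀ : Fin m → Bool := fun i => (c i).getD false
  have h₀ : Agree c x₀ := fun i b hi => by simp [x₀, hi]
  have := Dag.value_induction (G := G) _ (step := passStep τ c) (d := d)
    (step' := reachStep τ) (d' := fun _ => d)
    (fun v f => v = true ↔ ∃ x, Agree c x ∧ f x = true)
    ⟨fun h => ⟨x₀, h₀, h⟩, fun ⟨_, _, h⟩ => h⟩ ?_ hG 0
  · rwa [List.drop_zero] at this
  · intro g G hgG ih
    rw [Dag.value_cons, Dag.value_cons]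
    simp only [passStep, reachStep, Bool.or_eq_true]
    by_cases hacc : accepting τ g = true
    · simp only [hacc, true_or, and_true]
      exact ⟨fun _ => ⟨x₀, h₀⟩, fun _ => trivial⟩
    · simp only [hacc, Bool.false_eq_true, false_or]
      cases g with
      | sink => simp
      | inner lab es =>
        simp only [List.any_eq_true, Bool.and_eq_true]
        constructor
        · rintro ⟨e, he, h₁, h₂⟩
          obtain ⟨x, hx, hr⟩ := (ih e.2).1 h₂
          cases lab with
          | none => exact ⟨x, hx, e, he, h₁, hr⟩
          | some i =>
            rcases hci : c i with _ | b
            · rcases reach_update (i := i) hr with ⟨S, hS, hxS⟩ | hb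
              · have := hgG i es rfl e he S hS hxS
                exact ⟨x, hx, e, he, by simpa [edgeOK] using this, hr⟩
              · simp only [edgePassable, hci, decide_eq_true_eq] at h₁
                obtain ⟨b, hbS⟩ := Finset.nonempty_iff_ne_empty.2 h₁
                refine ⟨Function.update x i b, fun j b' hj => ?_, e, he, by simpa [edgeOK], hb b⟩
                have : j ≠ i := by rintro rfl; simp [hci] at hj
                rw [Function.update_of_ne this]; exact hx j b' hj
            · simp only [edgePassable, hci] at h₁
              exact ⟨x, hx, e, he, by rw [edgeOK, hx i b hci]; exact h₁, hr⟩
        · rintro ⟨x, hx, e, he, h₁, h₂⟩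
          refine ⟨e, he, ?_, (ih e.2).2 ⟨x, hx, h₂⟩⟩
          cases lab with
          | none => exact h₁
          | some i =>
            simp only [edgeOK, decide_eq_true_eq] at h₁
            rcases hci : c i with _ | b
            · simp only [edgePassable, hci, decide_eq_true_eq]
              exact Finset.ne_empty_of_mem h₁
            · simp only [edgePassable, hci, decide_eq_true_eq]
              rwa [← hx i b hci]

theorem FGate.evalStep_eq (g : FGate m) (f : ℕ → BoolFn m) : g.evalStep f = reachStep none g f := by
  funext x
  cases g with
  | sink => rfl
  | inner lab es => cases lab <;> simp [evalStep, reachStep, accepting, edgeOK]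

theorem FDag.eval_eq (G : FDag m) : G.eval = Dag.value (reachStep none) (fun _ => false) G := by
  rw [FDag.eval]; congr 1; funext g f; exact FGate.evalStep_eq g f

/-- A point is rejected if it gets stuck. -/
theorem eval_eq_false_of_stuck {G : FDag m} (hG : G.Deterministic) (hG' : G.LabelsOK) {x : Fin m → Bool} {i : Fin m}
    (h : Dag.value (reachStep (some (i, x i))) (fun _ => true) G x = true) : G.eval x = false := by
  rw [FDag.eval]
  have := Dag.value_induction (G := G) _ (step := reachStep (some (i, x i))) (d := fun _ => true)
    (step' := FGate.evalStep) (d' := fun _ => false)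
    (fun f g => f x = true → g x = false) (fun _ => rfl) ?_ (Dag.EveryNode.and hG hG') 0
  · rw [List.drop_zero] at this; exact this h
  · intro g G hgG ih h
    rw [Dag.value_cons, FGate.evalStep_eq, ← Bool.not_eq_true]
    rw [Dag.value_cons] at h
    intro h'
    simp only [reachStep, Bool.or_eq_true] at h h'
    cases g with
    | sink => simp [accepting] at h
    | inner lab es =>
      have hacc : accepting none (FGate.inner lab es) = false := by cases lab <;> rfl
      rw [hacc] at h'
      simp only [Bool.false_eq_true, false_or, List.any_eq_true, Bool.and_eq_true] at h h'
      obtain ⟨e, he, he₁, he₂⟩ := h'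
      rcases h with h | ⟨e', he', he₁', he₂'⟩
      · cases lab with
        | none =>
          simp only [accepting, Option.isSome_some, Bool.true_and, List.all_eq_true,
            decide_eq_true_eq] at h
          simp only [edgeOK, decide_eq_true_eq] at he₁
          exact he₁ (h e he)
        | some j =>
          simp only [accepting, Bool.and_eq_true, beq_iff_eq, List.all_eq_true,
            decide_eq_true_eq] at h
          obtain ⟨rfl, h⟩ := h
          simp only [edgeOK, decide_eq_true_eq] at he₁
          exact h e he he₁
      · by_cases hee : e = e'
        · subst hee
          rw [ih e.2 he₂'] at he₂; cases he₂
        · have hsymm : Std.Symm fun e e' : Finset Bool × ℕ => Disjoint e.1 e'.1 :=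
            ⟨fun _ _ h => h.symm⟩
          have hd : Disjoint e.1 e'.1 := (hgG.1 lab es rfl).forall he he' hee
          cases lab with
          | none =>
            simp only [edgeOK, decide_eq_true_eq] at he₁ he₁'
            rw [(hgG.2 es rfl e he).resolve_left he₁,
              (hgG.2 es rfl e' he').resolve_left he₁'] at hd
            simp at hd
          | some j =>
            simp only [edgeOK, decide_eq_true_eq] at he₁ he₁'
            exact Finset.disjoint_left.1 hd he₁ he₁'

theorem exists_stuck_of_eval_eq_false [Nonempty (Fin m)] {G : FDag m} {x : Fin m → Bool}
    (h : G.eval x = false) :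
    ∃ i, Dag.value (reachStep (some (i, x i))) (fun _ => true) G x = true := by
  rw [FDag.eval] at h
  have key : ∀ k, Dag.value FGate.evalStep (fun _ => false) (G.drop k) x = false →
      ∃ i, Dag.value (reachStep (some (i, x i))) (fun _ => true) (G.drop k) x = true := by
    clear h
    induction G with
    | nil => intro k _; exact ⟨Classical.arbitrary _, by simp [Dag.value, Dag.values]⟩
    | cons g G ih =>
      intro k
      cases k with
      | succ k => exact ih k
      | zero =>
        simp only [List.drop_zero, Dag.value_cons]
        intro h
        simp only [reachStep, Bool.or_eq_true]
        cases g with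
        | sink => cases h
        | inner lab es =>
          by_cases hex : ∃ e ∈ es, edgeOK x lab e.1 = true
          · obtain ⟨e, he, heS⟩ := hex
            obtain ⟨i, hi⟩ := ih e.2 (by
              cases lab with
              | none =>
                simp only [FGate.evalStep, List.any_eq_false, Bool.and_eq_true, not_and] at h
                exact Bool.eq_false_iff.2 (h e he heS)
              | some j =>
                simp only [FGate.evalStep, List.any_eq_false, Bool.and_eq_true, not_and] at h
                exact Bool.eq_false_iff.2 (h e he heS))
            refine ⟨i, Or.inr ?_⟩
            simp only [List.any_eq_true, Bool.and_eq_true]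
            exact ⟨e, he, heS, hi⟩
          · push Not at hex
            cases lab with
            | none => exact ⟨Classical.arbitrary _, Or.inl (by simpa [accepting, edgeOK] using hex)⟩
            | some j => exact ⟨j, Or.inl (by simpa [accepting, edgeOK] using hex)⟩
  simpa using key 0 (by simpa using h)

/-! Correctness of the computation. -/

def FGate.erase : FGate m → RawFGate
  | sink => (false, none, [])
  | inner lab es => (true, lab.map Fin.val,
      es.map fun e => ((decide (false ∈ e.1), decide (true ∈ e.1)), e.2))

theorem toFGate_code (g : FGate m) : toFGate (code g) = g.erase := by
  cases g with
  | sink => rfl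
  | inner lab es =>
    rw [show code (FGate.inner lab es : FGate m) = code ((1 : ℕ), (lab, es)) from rfl]
    simp only [toFGate, hd_code_pair, tl_code_pair, toNat_code, toList_code, FGate.erase,
      List.map_map]
    refine Prod.ext rfl (Prod.ext ?_ (List.map_congr_left fun e _ => ?_))
    · cases lab with
      | none => rfl
      | some i => exact congrArg some (toNat_code_fin i)
    · obtain ⟨S, k⟩ := e
      simp only [Function.comp_apply, hd_code_pair, tl_code_pair, toNat_code]
      rw [show code S = code (decide (false ∈ S), decide (true ∈ S)) from rfl]
      simp only [hd_code_pair, tl_code_pair, isCons_code]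

theorem ne_empty_iff_or (S : Finset Bool) :
    decide (S ≠ ∅) = (decide (false ∈ S) || decide (true ∈ S)) := by
  revert S; decide

def eraseTarget (τ : Option (Fin m × Bool)) : Option (ℕ × Bool) := τ.map eraseLit

theorem rawAccepting_erase (g : FGate m) :
    rawAccepting (eraseTarget τ) g.erase = accepting τ g := by
  cases g with
  | sink => cases τ <;> rfl
  | inner lab es =>
    rcases lab with _ | i <;> rcases τ with _ | ⟨j, b⟩ <;>
      simp only [rawAccepting, FGate.erase, accepting, eraseTarget, eraseLit, Option.map_none,
        Option.map_some, Option.isSome_none, Option.isSome_some, Bool.cond_false, Bool.cond_true,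
        Bool.not_true, Bool.true_and, Option.getD_some, List.all_map, Bool.false_and]
    · congr 1; funext e
      have := ne_empty_iff_or e.1
      simp only [Function.comp_apply, ← this, decide_not, Bool.not_not]
    · congr 1
      · rw [Bool.eq_iff_iff, beq_iff_eq, beq_iff_eq, Fin.ext_iff]
      · congr 1; funext e; cases b <;> simp [hasValue]

theorem rawPassable_erase (lab : Option (Fin m)) (S : Finset Bool) :
    rawPassable (List.ofFn c) (lab.map Fin.val) (decide (false ∈ S), decide (true ∈ S)) =
      edgePassable c lab S := by
  rcases lab with _ | i
  · simp only [rawPassable, edgePassable, ne_empty_iff_or]; rfl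
  · simp only [rawPassable, edgePassable, Option.map_some, Option.getD_some, getD_ofFn,
      Option.isSome_some, Bool.true_and, ne_empty_iff_or]
    rcases c i with _ | _ | _ <;> rfl

theorem rawReaches_eq (G : FDag m) :
    rawReaches (eraseTarget τ) (List.ofFn c) (G.map FGate.erase) =
      Dag.values (passStep τ c) τ.isSome G := by
  induction G with
  | nil => rfl
  | cons g G ih =>
    rw [rawReaches] at ih ⊢
    rw [List.map_cons, List.foldr_cons, ih, Dag.values]
    congr 1
    have hτ : (eraseTarget τ).isSome = τ.isSome := by cases τ <;> rfl
    unfold rawReach passStep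
    rw [rawAccepting_erase, hτ]
    congr 1
    cases g with
    | sink => rfl
    | inner lab es =>
      simp only [FGate.erase, Bool.true_and, List.any_map, Function.comp_def, rawPassable_erase]

theorem extendCube_ofFn (i : Fin m) (b : Bool) :
    extendCube (List.ofFn c) i b = List.ofFn (Function.update c i (some b)) := by
  refine List.ext_getElem (by simp [extendCube]) fun n h₁ h₂ => ?_
  have hn : n < m := by simpa using h₂
  have := getD_ofFn c ⟨n, hn⟩
  simp only at this
  simp only [extendCube, List.getElem_map, List.getElem_range, List.getElem_ofFn, this,
    Function.update_apply, Bool.cond_eq_ite, beq_iff_eq, Fin.ext_iff]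

theorem fsdTest_iff {G : FDag m} (hlab : G.LabelsOK) (hdet : G.Deterministic) (hfoc : G.Focusing) :
    fsdTest (code G, List.ofFn c) = true ↔ ConstOn (FDag.eval G) c := by
  have hs : (code G).toList.map toFGate = G.map FGate.erase := by
    rw [toList_code, List.map_map]
    exact List.map_congr_left fun g _ => toFGate_code g
  have hreach : ∀ (τ : Option (Fin m × Bool)) (c : Fin m → Option Bool),
      (rawReaches (eraseTarget τ) (List.ofFn c) (G.map FGate.erase)).headD τ.isSome = true ↔
        ∃ x, Agree c x ∧ Dag.value (reachStep τ) (fun _ => τ.isSome) G x = true := fun τ c => by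
    rw [rawReaches_eq]; exact pass_iff_reach hfoc _
  have hsat := hreach none c
  rw [show eraseTarget (none : Option (Fin m × Bool)) = none from rfl, Option.isSome_none,
    ← FDag.eval_eq] at hsat
  have hstuck : rawStuck (List.ofFn c) (G.map FGate.erase) = true ↔
      ∃ x, Agree c x ∧ ∃ i, Dag.value (reachStep (some (i, x i))) (fun _ => true) G x = true := by
    have h : rawStuck (List.ofFn c) (G.map FGate.erase) = true ↔
        ∃ (i : Fin m) (b : Bool), (c i = none ∨ c i = some b) ∧
          (rawReaches (some ((i : ℕ), b)) (extendCube (List.ofFn c) i b)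
            (G.map FGate.erase)).headD true = true := by
      have hc : ∀ (i : Fin m) (b : Bool), (!((List.ofFn c).getD (i : ℕ) none).isSome ||
          (((List.ofFn c).getD (i : ℕ) none).getD false == b)) = true ↔
            (c i = none ∨ c i = some b) := by
        intro i b; rw [getD_ofFn]; rcases c i with _ | a <;> simp
      simp only [rawStuck, List.any_eq_true, List.mem_range, List.length_ofFn, Bool.and_eq_true]
      constructor
      · rintro ⟨i, hi, b, -, h₁, h₂⟩
        exact ⟨⟨i, hi⟩, b, (hc ⟨i, hi⟩ b).1 h₁, h₂⟩
      · rintro ⟨i, b, h₁, h₂⟩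
        exact ⟨i, i.2, b, by cases b <;> simp, (hc i b).2 h₁, h₂⟩
    rw [h]
    constructor
    · rintro ⟨i, b, hcb, h⟩
      rw [extendCube_ofFn] at h
      obtain ⟨x, hx, hr⟩ := (hreach (some (i, b)) _).1 h
      have hxi : x i = b := hx i b (by simp)
      refine ⟨x, fun j b' hj => hx j b' ?_, i, by rw [hxi]; exact hr⟩
      by_cases hji : j = i
      · subst hji
        rw [Function.update_self]
        rcases hcb with hcb | hcb <;> rw [hcb] at hj
        · cases hj
        · exact hj
      · rw [Function.update_of_ne hji]; exact hj
    · rintro ⟨x, hx, i, hr⟩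
      refine ⟨i, x i, ?_, ?_⟩
      · rcases hci : c i with _ | b
        · exact Or.inl rfl
        · rw [hx i b hci]; exact Or.inr rfl
      · rw [extendCube_ofFn]
        refine (hreach (some (i, x i)) _).2 ⟨x, fun j b hj => ?_, hr⟩
        by_cases hji : j = i
        · subst hji; simpa using hj
        · rw [Function.update_of_ne hji] at hj; exact hx j b hj
  rw [fsdTest, Bool.or_eq_true, Bool.not_eq_true', Bool.not_eq_true', ← Bool.not_eq_true,
    ← Bool.not_eq_true, hs, hsat, hstuck]
  rcases isEmpty_or_nonempty (Fin m) with hm | hm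
  · refine iff_of_true (Or.inr fun ⟨_, _, i, _⟩ => hm.elim i) fun x y _ _ => ?_
    rw [Subsingleton.elim x y]
  · rw [constOn_iff]
    refine or_congr (by simp) ⟨fun h x hx => ?_, fun h => ?_⟩
    · by_contra hf
      exact h ⟨x, hx, exists_stuck_of_eval_eq_false (Bool.eq_false_iff.2 hf)⟩
    · rintro ⟨x, hx, i, hi⟩
      have := eval_eq_false_of_stuck hdet hlab hi
      rw [h x hx] at this; cases this

theorem oneAXp_dFSD : OneAXpInPolyTime dFSD :=
  oneAXp_of_test _ _ PT.fsdTest fun _ _ hG _ => fsdTest_iff hG.2.1 hG.2.2.1 hG.2.2.2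

end typed
end KC

namespace KC
open Encode (code)

/-! ### Consistency of systems of linear equations modulo two -/

def parity (l : List Bool) : Bool := l.foldr xor false

/-- The sum of two rows. -/
def xorRow (r p : List Bool) : List Bool :=
  (List.range r.length).map fun j => r.getD j false ^^ p.getD j false

/-- Elimination of the first variable. -/
def elim (R : List (List Bool)) : List (List Bool) :=
  R.map fun r => cond (r.headD false)
    (xorRow r ((R.filter fun r => r.headD false).headD [])).tail r.tail

/-- The equation, with `m` variables and the right-hand side, that says that the clause is true. -/
def rowOf (m : ℕ) (δ : List (ℕ × Bool) × Bool) : List Bool :=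
  ((List.range m).map fun i => parity (δ.1.map fun l => l.1 == i)) ++
    [!(parity (δ.1.map fun l => !l.2) ^^ δ.2)]

def consistent (m : ℕ) (A : List (List (ℕ × Bool) × Bool)) : Bool :=
  (elim^[m] (A.map (rowOf m))).all fun r => !r.headD false

section pt

variable {α : Type} [Encode α]

@[fun_prop]
theorem PT.parity {l : α → List Bool} (hl : PT l) : PT (fun a => parity (l a)) :=
  PT.foldr_bool (step := fun _ b s => b ^^ s) (PT.const false) (by fun_prop) hl

@[fun_prop]
theorem PT.xorRow {r p : α → List Bool} (hr : PT r) (hp : PT p) :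
    PT (fun a => xorRow (r a) (p a)) := by
  unfold KC.xorRow; fun_prop

theorem PT.elim : PT elim := by unfold KC.elim; fun_prop

@[fun_prop]
theorem PT.rowOf {m : α → ℕ} {δ : α → List (ℕ × Bool) × Bool} (hm : PT m) (hδ : PT δ) :
    PT (fun a => rowOf (m a) (δ a)) := by
  unfold KC.rowOf; fun_prop

theorem size_bool_list (r : List Bool) : (code r).size ≤ 4 * r.length + 1 := by
  induction r with
  | nil => simp [Encode.code, codeList, SExp.size]
  | cons b r ih =>
    have := size_bool_le b
    rw [size_code_cons, List.length_cons]; omega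

theorem size_rows {L : ℕ} {R : List (List Bool)} (h : ∀ r ∈ R, r.length ≤ L) :
    (code R).size ≤ R.length * (4 * L + 2) + 1 := by
  induction R with
  | nil => simp [Encode.code, codeList, SExp.size]
  | cons r R ih =>
    have h₁ := size_bool_list r
    have h₂ := h r (by simp)
    have h₃ := ih fun r hr => h r (by simp [hr])
    rw [size_code_cons, List.length_cons, Nat.add_mul]; omega

theorem length_elim {n : ℕ} {R : List (List Bool)} (h : ∀ r ∈ R, r.length = n) :
    ∀ r ∈ elim R, r.length = n - 1 := by
  intro r' hr'
  obtain ⟨r, hr, rfl⟩ := List.mem_map.1 hr'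
  cases r.headD false <;> simp [xorRow, h r hr]

theorem length_elim_iterate {n : ℕ} {R : List (List Bool)} (h : ∀ r ∈ R, r.length = n) (k : ℕ) :
    (elim^[k] R).length = R.length ∧ ∀ r ∈ elim^[k] R, r.length = n - k := by
  induction k with
  | zero => exact ⟨rfl, h⟩
  | succ k ih =>
    rw [Function.iterate_succ_apply']
    refine ⟨by simp [elim, ih.1], ?_⟩
    rw [← Nat.sub_sub]
    exact length_elim ih.2

theorem length_rowOf (m : ℕ) (δ : List (ℕ × Bool) × Bool) : (rowOf m δ).length = m + 1 := by
  simp [rowOf]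

@[fun_prop]
theorem PT.consistent {m : α → ℕ} {A : α → List (List (ℕ × Bool) × Bool)} (hm : PT m)
    (hA : PT A) : PT (fun a => consistent (m a) (A a)) := by
  suffices h : PT (fun p : ℕ × List (List (ℕ × Bool) × Bool) => KC.consistent p.1 p.2) from
    h.comp (hm.mk hA)
  have h : PT (fun p : ℕ × List (List (ℕ × Bool) × Bool) =>
      KC.elim^[p.1] (p.2.map (KC.rowOf p.1))) := by
    refine PT.iterate_of_bound (α := ℕ × List (List (ℕ × Bool) × Bool))
      (step := fun _ R => KC.elim R) (by fun_prop) (by fun_prop) (PT.elim.comp PT.snd)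
      (Polynomial.X * (4 * (Polynomial.X + 1) + 2) + 1) fun a k => ?_
    have hl : ∀ r ∈ a.2.map (KC.rowOf a.1), r.length = a.1 + 1 := by
      intro r hr
      obtain ⟨δ, -, rfl⟩ := List.mem_map.1 hr
      exact length_rowOf _ _
    obtain ⟨h₁, h₂⟩ := length_elim_iterate hl k
    have h₃ := size_rows (L := a.1 + 1) (R := KC.elim^[k] (a.2.map (KC.rowOf a.1)))
      (fun r hr => by rw [h₂ r hr]; omega)
    refine h₃.trans ?_
    have h₄ := length_le_size a.2
    rw [h₁, List.length_map]
    obtain ⟨n, A⟩ := a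
    simp only [size_code_pair, size_code_nat, Polynomial.eval_add, Polynomial.eval_mul,
      Polynomial.eval_X, Polynomial.eval_one, Polynomial.eval_ofNat] at *
    exact Nat.add_le_add_right (Nat.mul_le_mul (by omega) (by omega)) _
  unfold KC.consistent
  exact PT.all (f := fun _ r => !r.headD false) (by fun_prop) h

end pt

/-! Correctness of the elimination. -/

def dot : List Bool → List Bool → Bool
  | a :: r, b :: y => (a && b) ^^ dot r y
  | _, _ => false

theorem dot_nil_right (r : List Bool) : dot r [] = false := by cases r <;> rfl

theorem dot_zipWith_xor {r p : List Bool} (h : r.length = p.length) (y : List Bool) :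
    dot (List.zipWith xor r p) y = (dot r y ^^ dot p y) := by
  induction r generalizing p y with
  | nil =>
    cases p with
    | nil => simp [dot]
    | cons => simp at h
  | cons a r ih =>
    cases p with
    | nil => simp at h
    | cons b p =>
      cases y with
      | nil => simp [dot_nil_right]
      | cons c y =>
        simp only [List.zipWith_cons_cons, dot, ih (by simpa using h)]
        cases a <;> cases b <;> cases c <;> cases dot r y <;> cases dot p y <;> rfl

theorem xorRow_eq_zipWith {r p : List Bool} (h : r.length = p.length) :
    xorRow r p = List.zipWith xor r p := by
  refine List.ext_getElem (by simp [xorRow, h]) fun n h₁ h₂ => ?_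
  simp only [xorRow, List.length_map, List.length_range] at h₁
  simp [xorRow, List.getD_eq_getElem?_getD, h₁, h ▸ h₁]

def Solvable (n : ℕ) (R : List (List Bool)) : Prop :=
  ∃ x : List Bool, x.length = n ∧ ∀ r ∈ R, dot r (x ++ [true]) = false

theorem solvable_elim {n : ℕ} {R : List (List Bool)} (h : ∀ r ∈ R, r.length = n + 2) :
    Solvable n (elim R) ↔ Solvable (n + 1) R := by
  set p := (R.filter fun r => r.headD false).headD [] with hp
  have hpR : ∀ r ∈ R, r.headD false = true → p ∈ R ∧ p.headD false = true := by
    intro r hr hrh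
    have hmem : r ∈ R.filter fun r => r.headD false := List.mem_filter.2 ⟨hr, hrh⟩
    have : p ∈ R.filter fun r => r.headD false := by
      rw [hp]
      cases hf : R.filter fun r => r.headD false with
      | nil => rw [hf] at hmem; simp at hmem
      | cons q l => simp
    exact List.mem_filter.1 this
  have hcons : ∀ r ∈ R, r = r.headD false :: r.tail := by
    intro r hr
    have := h r hr
    cases r with
    | nil => simp at this
    | cons a r => rfl
  have hdot : ∀ r ∈ R, ∀ b y, dot r (b :: y) = ((r.headD false && b) ^^ dot r.tail y) := by
    intro r hr b y
    conv_lhs => rw [hcons r hr]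
    rfl
  have htail : ∀ r ∈ R, r.headD false = true → ∀ y,
      dot (xorRow r p).tail y = (dot r.tail y ^^ dot p.tail y) := by
    intro r hr hrh y
    obtain ⟨hpm, hph⟩ := hpR r hr hrh
    have hl : r.length = p.length := (h r hr).trans (h p hpm).symm
    rw [xorRow_eq_zipWith hl, List.tail_zipWith, dot_zipWith_xor (by simp [hl])]
  constructor
  · rintro ⟨x, hx, hR⟩
    refine ⟨dot p.tail (x ++ [true]) :: x, by simp [hx], fun r hr => ?_⟩
    have h' := hR _ (List.mem_map_of_mem hr)
    rw [List.cons_append, hdot r hr]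
    cases hrh : r.headD false with
    | false => rw [hrh, Bool.cond_false] at h'; simp [h']
    | true =>
      rw [hrh, Bool.cond_true, htail r hr hrh] at h'
      rw [Bool.true_and, Bool.xor_comm]; exact h'
  · rintro ⟨x, hx, hR⟩
    cases x with
    | nil => simp at hx
    | cons b x =>
      refine ⟨x, by simpa using hx, fun r' hr' => ?_⟩
      obtain ⟨r, hr, rfl⟩ := List.mem_map.1 hr'
      have h' := hR r hr
      rw [List.cons_append, hdot r hr] at h'
      cases hrh : r.headD false with
      | false => rw [hrh] at h'; simpa using h'
      | true =>
        obtain ⟨hpm, hph⟩ := hpR r hr hrh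
        have h'' := hR p hpm
        rw [List.cons_append, hdot p hpm, hph] at h''
        rw [hrh] at h'
        rw [Bool.cond_true, htail r hr hrh]
        revert h' h''
        cases b <;> cases dot r.tail (x ++ [true]) <;> cases dot p.tail (x ++ [true]) <;> simp

theorem solvable_elim_iterate {n : ℕ} {R : List (List Bool)} (h : ∀ r ∈ R, r.length = n + 1) :
    Solvable n R ↔ ((elim^[n] R).all fun r => !r.headD false) = true := by
  induction n generalizing R with
  | zero =>
    have : ∀ r ∈ R, dot r [true] = r.headD false := by
      intro r hr
      have := h r hr
      rcases r with _ | ⟨a, _ | _⟩ <;> simp_all [dot]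
    simp only [Solvable, List.length_eq_zero_iff, exists_eq_left, List.nil_append,
      Function.iterate_zero, id, List.all_eq_true, Bool.not_eq_true']
    exact forall₂_congr fun r hr => by rw [this r hr]
  | succ n ih =>
    rw [← solvable_elim h, ih (fun r hr => length_elim h r hr), Function.iterate_succ_apply]

variable {m : ℕ}

def eraseXor (δ : XorClause m) : List (ℕ × Bool) × Bool := (δ.1.map eraseLit, δ.2)

theorem dot_append {r y : List Bool} (h : r.length = y.length) (a b : Bool) :
    dot (r ++ [a]) (y ++ [b]) = (dot r y ^^ (a && b)) := by
  induction r generalizing y with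
  | nil =>
    cases y with
    | nil => simp [dot]
    | cons => simp at h
  | cons c r ih =>
    cases y with
    | nil => simp at h
    | cons d y =>
      simp only [List.cons_append, dot, ih (show r.length = y.length by simpa using h),
        Bool.xor_assoc]

theorem dot_map {ι : Type} (f g : ι → Bool) (l : List ι) :
    dot (l.map f) (l.map g) = parity (l.map fun i => f i && g i) := by
  induction l with
  | nil => rfl
  | cons i l ih => simp only [List.map_cons, dot, ih]; rfl

theorem parity_xor {ι : Type} (f g : ι → Bool) (l : List ι) :
    parity (l.map fun i => f i ^^ g i) = (parity (l.map f) ^^ parity (l.map g)) := by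
  induction l with
  | nil => rfl
  | cons i l ih =>
    simp only [List.map_cons, parity, List.foldr_cons] at ih ⊢
    rw [ih]
    cases f i <;> cases g i <;> simp

theorem parity_single {ι : Type} [DecidableEq ι] (x : ι → Bool) {l : List ι} (hl : l.Nodup)
    (a : ι) : parity (l.map fun i => (a == i) && x i) = (decide (a ∈ l) && x a) := by
  induction l with
  | nil => rfl
  | cons i l ih =>
    rw [List.nodup_cons] at hl
    simp only [List.map_cons, parity, List.foldr_cons] at ih ⊢
    rw [ih hl.2]
    by_cases h : a = i
    · subst h; simp [hl.1]
    · simp [h, beq_false_of_ne h]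

theorem dot_rowOf (δ : XorClause m) (x : Fin m → Bool) :
    dot (rowOf m (eraseXor δ)) (List.ofFn x ++ [true]) = !δ.eval x := by
  obtain ⟨ls, b⟩ := δ
  rw [rowOf, dot_append (by simp), List.ofFn_eq_map, ← List.map_coe_finRange_eq_range, List.map_map, dot_map]
  simp only [eraseXor, Function.comp_def, List.map_map, Bool.and_true, XorClause.eval]
  induction ls with
  | nil =>
    have : ∀ l : List (Fin m), parity (l.map fun i => parity [] && x i) = false := by
      intro l
      induction l with
      | nil => rfl
      | cons i l ih => exact (congrArg _ ih).trans (by simp [parity])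
    simp [this]; simp [parity]
  | cons l ls ih =>
    have h₁ : ∀ i : Fin m, (parity ((l :: ls).map fun l => (eraseLit l).1 == (i : ℕ)) && x i) =
        (((l.1 == i) && x i) ^^ (parity (ls.map fun l => (eraseLit l).1 == (i : ℕ)) && x i)) := by
      intro i
      have : ((eraseLit l).1 == (i : ℕ)) = (l.1 == i) := by
        rw [Bool.eq_iff_iff, beq_iff_eq, beq_iff_eq, Fin.ext_iff]; rfl
      simp only [List.map_cons, parity, List.foldr_cons, this]
      rw [← Bool.and_xor_distrib_right]
    simp only [h₁]
    rw [parity_xor, parity_single x (List.nodup_finRange m)]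
    simp only [List.mem_finRange, decide_true, Bool.true_and, List.foldr_cons]
    have h₂ : parity ((l :: ls).map fun l => !(eraseLit l).2) =
      ((!l.2) ^^ parity (ls.map fun l => !(eraseLit l).2)) := rfl
    rw [h₂, Bool.xor_assoc, Bool.xor_assoc]
    have h₃ : (l.eval x) = (x l.1 ^^ !l.2) := by
      unfold Lit.eval; cases x l.1 <;> cases l.2 <;> rfl
    rw [h₃]
    revert ih
    generalize parity (List.map _ (List.finRange m)) = u
    generalize parity (List.map _ ls) = v
    generalize List.foldr _ _ _ = w
    cases u <;> cases v <;> cases w <;> cases x l.1 <;> cases l.2 <;> cases b <;> simp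

theorem consistent_iff (A : List (XorClause m)) :
    consistent m (A.map eraseXor) = true ↔ ∃ x : Fin m → Bool, ∀ δ ∈ A, δ.eval x = true := by
  rw [consistent, ← solvable_elim_iterate]
  · constructor
    · rintro ⟨x, hx, h⟩
      obtain ⟨x, rfl⟩ : ∃ x' : Fin m → Bool, x = List.ofFn x' := by
        subst hx; exact ⟨x.get, (List.ofFn_get x).symm⟩
      refine ⟨x, fun δ hδ => ?_⟩
      have := h _ (List.mem_map_of_mem (List.mem_map_of_mem hδ))
      rwa [dot_rowOf, Bool.not_eq_false'] at this
    · rintro ⟨x, h⟩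
      refine ⟨List.ofFn x, by simp, fun r hr => ?_⟩
      simp only [List.map_map, List.mem_map, Function.comp_apply] at hr
      obtain ⟨δ, hδ, rfl⟩ := hr
      rw [dot_rowOf, h δ hδ]; rfl
  · intro r hr
    obtain ⟨δ, -, rfl⟩ := List.mem_map.1 hr
    exact length_rowOf _ _

end KC

namespace KC
open Encode (code)

/-! ### Extended affine decision trees -/

def SExp.toXor (s : SExp) : List (ℕ × Bool) × Bool := (s.hd.toList.map SExp.toLit, s.tl.isCons)

def flipXor (δ : List (ℕ × Bool) × Bool) : List (ℕ × Bool) × Bool := (δ.1, !δ.2)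

/-- The context of the recursion: the value that is asked for, the number of variables, the kind
of the subterm (0 for a tree, 1 for what follows the tag of a decision node, 2 for the branches of
a decision node, 3 and 4 for lists of children all or one of which must take the value), and the
clauses that have to be true. -/
abbrev EContext := (Bool × ℕ) × ℕ × List (List (ℕ × Bool) × Bool)

def modeOfTag (pol : Bool) (t : ℕ) : ℕ :=
  cond (t == 1) 1 (cond (t == 2) (cond pol 3 4) (cond (t == 3) (cond pol 4 3) 0))

def eadtLeft (k : EContext) (_ _ : SExp) : EContext :=
  cond (k.2.1 == 2) (k.1, 0, flipXor (k.2.2.headD ([], false)) :: k.2.2.tail) (k.1, 0, k.2.2)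

def eadtRight (k : EContext) (a _ : SExp) : EContext :=
  cond (k.2.1 == 0) (k.1, modeOfTag k.1.1 a.toNat, k.2.2)
    (cond (k.2.1 == 1) (k.1, 2, a.toXor :: k.2.2) (cond (k.2.1 == 2) (k.1, 0, k.2.2) k))

def eadtComb (k : EContext) (a b : SExp) (r₁ r₂ : Bool) : Bool :=
  cond (k.2.1 == 0)
    (cond (a.toNat == 0) ((b.isCons == k.1.1) && consistent k.1.2 k.2.2)
      (cond (modeOfTag k.1.1 a.toNat == 3) (consistent k.1.2 k.2.2 && r₂) r₂))
    (cond (k.2.1 == 1) r₂ (cond (k.2.1 == 3) (r₁ && r₂) (r₁ || r₂)))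

def eadtRec (s : SExp) (k : EContext) : Bool :=
  treeRec (fun k => k.2.1 == 3) eadtLeft eadtRight eadtComb s k

section pt

variable {α : Type} [Encode α]

@[fun_prop]
theorem PT.toXor {s : α → SExp} (hs : PT s) : PT (fun a => (s a).toXor) := by
  unfold KC.SExp.toXor
  exact PT.mk (PT.map (f := fun _ l => SExp.toLit l) (by fun_prop) (PT.toList.comp (by fun_prop)))
    (by fun_prop)

@[fun_prop]
theorem PT.flipXor {δ : α → List (ℕ × Bool) × Bool} (h : PT δ) :
    PT (fun a => flipXor (δ a)) := by
  unfold KC.flipXor; fun_prop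

@[fun_prop]
theorem PT.modeOfTag {p : α → Bool} {t : α → ℕ} (hp : PT p) (ht : PT t) :
    PT (fun a => modeOfTag (p a) (t a)) := by
  unfold KC.modeOfTag; fun_prop

theorem modeOfTag_le (p : Bool) (t : ℕ) : modeOfTag p t ≤ 4 := by
  unfold modeOfTag
  cases t == 1 <;> cases t == 2 <;> cases t == 3 <;> cases p <;> simp

theorem PT.eadtRec : PT (fun p : SExp × EContext => eadtRec p.1 p.2) := by
  obtain ⟨q, hq⟩ := PT.size_bound (f := KC.SExp.toXor) (by fun_prop)
  refine PT.treeRecursion (by fun_prop) (by unfold KC.eadtLeft; fun_prop)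
    (by unfold KC.eadtRight; fun_prop) (by unfold KC.eadtComb; fun_prop) (q + 20) ?_ ?_
  · rintro ⟨⟨p, n⟩, d, A⟩ a b
    have h : (Encode.code (KC.flipXor (A.headD ([], false)) :: A.tail)).size ≤
        (Encode.code A).size + 20 := by
      rcases A with _ | ⟨⟨l, c⟩, A⟩
      · decide
      · have := size_bool_le c
        have := size_bool_le (!c)
        simp only [KC.flipXor, List.headD_cons, List.tail_cons, size_code_cons, size_code_pair]
        omega
    have h₀ := (Encode.code A).size
    simp only [KC.eadtLeft]
    cases d == 2 <;>
      simp only [Bool.cond_false, Bool.cond_true, size_code_pair, size_code_nat,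
        Polynomial.eval_add, Polynomial.eval_ofNat] <;> omega
  · rintro ⟨⟨p, n⟩, d, A⟩ a b
    have h₁ := modeOfTag_le p a.toNat
    have h₂ := (hq a).trans (polyEval_mono q (show a.size ≤ a.size + b.size by omega))
    simp only [KC.eadtRight]
    cases d == 0 <;> cases d == 1 <;> cases d == 2 <;>
      simp only [Bool.cond_false, Bool.cond_true, size_code_pair, size_code_nat, size_code_cons,
        Polynomial.eval_add, Polynomial.eval_ofNat] at * <;> omega

end pt

variable {m : ℕ}

theorem toXor_code (δ : XorClause m) : (code δ).toXor = eraseXor δ := by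
  refine Prod.ext ?_ (isCons_code _)
  show (SExp.toList (code δ.1)).map SExp.toLit = _
  rw [toList_code, List.map_map]
  exact List.map_congr_left fun l _ => toLit_code l

namespace XorClause

theorem eval_congr {δ : XorClause m} {x y : Fin m → Bool} (h : ∀ i ∈ vars δ, x i = y i) :
    δ.eval x = δ.eval y := by
  obtain ⟨ls, b⟩ := δ
  simp only [eval]
  induction ls with
  | nil => rfl
  | cons l ls ih =>
    simp only [List.foldr_cons]
    rw [ih fun i ⟨l', hl', hi⟩ => h i ⟨l', List.mem_cons_of_mem _ hl', hi⟩]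
    simp only [Lit.eval]
    rw [h l.1 ⟨l, List.mem_cons_self, rfl⟩]

theorem eval_flip (ls : List (Lit m)) (b : Bool) (x : Fin m → Bool) :
    XorClause.eval (ls, !b) x = !XorClause.eval (ls, b) x := by
  simp only [eval]
  induction ls with
  | nil => rfl
  | cons l ls ih => simp only [List.foldr_cons]; rw [ih, Bool.xor_not]

end XorClause

namespace ATree

mutual

theorem eval_congr {x y : Fin m → Bool} : ∀ T : ATree m, (∀ i ∈ T.vars, x i = y i) →
    T.eval x = T.eval y
  | leaf _, _ => rfl
  | dec δ lo hi, h => by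
    simp only [vars, Set.mem_union, or_imp, forall_and] at h
    simp only [eval, XorClause.eval_congr h.1.1, eval_congr lo h.1.2, eval_congr hi h.2]
  | conj cs, h => (eval_congr_list cs h).1
  | disj cs, h => (eval_congr_list cs h).2

theorem eval_congr_list {x y : Fin m → Bool} : ∀ cs : List (ATree m),
    (∀ i ∈ varsList cs, x i = y i) → evalAll cs x = evalAll cs y ∧ evalAny cs x = evalAny cs y
  | [], _ => ⟨rfl, rfl⟩
  | c :: cs, h => by
    simp only [varsList, Set.mem_union, or_imp, forall_and] at h
    have ih := eval_congr_list cs h.2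
    simp only [evalAll, evalAny, eval_congr c h.1, ih.1, ih.2, and_self]

end

theorem evalAll_eq (cs : List (ATree m)) (x : Fin m → Bool) :
    evalAll cs x = cs.all fun c => c.eval x := by
  induction cs with
  | nil => rfl
  | cons c cs ih => simp only [evalAll, ih, List.all_cons]

theorem evalAny_eq (cs : List (ATree m)) (x : Fin m → Bool) :
    evalAny cs x = cs.any fun c => c.eval x := by
  induction cs with
  | nil => rfl
  | cons c cs ih => simp only [evalAny, ih, List.any_cons]

/-- All clauses of `A` are true at `x`. -/
def Models (A : List (XorClause m)) (x : Fin m → Bool) : Prop := ∀ δ ∈ A, δ.eval x = true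

/-- The tree takes the value `pol` at some point where the clauses of `A` are true. -/
def Sat (pol : Bool) (A : List (XorClause m)) (T : ATree m) : Prop :=
  ∃ x, Models A x ∧ T.eval x = pol

/-- Each clause of `A` has the variables of some clause of `anc`, or at most one variable. -/
def Compat (A anc : List (XorClause m)) : Prop :=
  ∀ δ ∈ A, (∃ δ' ∈ anc, δ.vars = δ'.vars) ∨ δ.vars.Subsingleton

theorem Compat.cons {A anc : List (XorClause m)} (h : Compat A anc) {δ δ' : XorClause m}
    (hδ : δ.vars = δ'.vars) : Compat (δ :: A) (δ' :: anc) := by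
  intro ε hε
  rcases List.mem_cons.1 hε with rfl | hε
  · exact Or.inl ⟨δ', List.mem_cons_self, hδ⟩
  · exact (h ε hε).imp_left fun ⟨ε', h₁, h₂⟩ => ⟨ε', List.mem_cons_of_mem _ h₁, h₂⟩

theorem exists_forall_eval {A anc : List (XorClause m)} (hA : Compat A anc)
    {cs : List (ATree m)} (hcs : AffineDecomposable anc cs) (pol : Bool) :
    (∃ x, Models A x ∧ ∀ c ∈ cs, c.eval x = pol) ↔
      (∃ x, Models A x) ∧ ∀ c ∈ cs, Sat pol A c := by
  constructor
  · rintro ⟨x, hx, h⟩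
    exact ⟨⟨x, hx⟩, fun c hc => ⟨x, hx, h c hc⟩⟩
  rintro ⟨⟨x₀, hx₀⟩, h⟩
  obtain ⟨block, h₁, h₂⟩ := hcs
  have h₃ : ∀ j : ℕ, ∃ x, Models A x ∧ ∀ c, cs[j]? = some c → c.eval x = pol := by
    intro j
    cases hj : cs[j]? with
    | none => exact ⟨x₀, hx₀, by simp⟩
    | some c =>
      obtain ⟨x, hx, hc⟩ := h c (List.mem_of_getElem? hj)
      exact ⟨x, hx, by rintro _ ⟨⟩; exact hc⟩
  choose xs hxs hc using h₃
  refine ⟨fun i => xs (block i) i, fun δ hδ => ?_, fun c hcm => ?_⟩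
  · have h₄ : ∀ i ∈ δ.vars, ∀ i' ∈ δ.vars, block i = block i' := by
      rcases hA δ hδ with ⟨δ', hδ', he⟩ | hs
      · rw [he]; exact h₂ δ' hδ'
      · intro i hi i' hi'; rw [hs hi hi']
    by_cases hne : ∃ i, i ∈ δ.vars
    · obtain ⟨i, hi⟩ := hne
      rw [XorClause.eval_congr (y := xs (block i)) fun i' hi' => by rw [h₄ i hi i' hi']]
      exact hxs _ δ hδ
    · rw [XorClause.eval_congr (y := x₀) fun i' hi' => absurd ⟨i', hi'⟩ hne]
      exact hx₀ δ hδ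
  · obtain ⟨j, hj⟩ := List.mem_iff_getElem?.1 hcm
    rw [eval_congr (y := xs j) c fun i hi => by rw [h₁ j c hj i hi]]
    exact hc j c hj

theorem exists_exists_eval {A : List (XorClause m)} {cs : List (ATree m)} {pol : Bool} :
    (∃ x, Models A x ∧ ∃ c ∈ cs, c.eval x = pol) ↔ ∃ c ∈ cs, Sat pol A c := by
  constructor
  · rintro ⟨x, hx, c, hc, h⟩; exact ⟨c, hc, x, hx, h⟩
  · rintro ⟨c, hc, x, hx, h⟩; exact ⟨x, hx, c, hc, h⟩

theorem sat_dec {A : List (XorClause m)} {δ : XorClause m} {lo hi : ATree m} {pol : Bool} :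
    Sat pol A (dec δ lo hi) ↔ Sat pol ((δ.1, !δ.2) :: A) lo ∨ Sat pol (δ :: A) hi := by
  simp only [Sat, Models, ← exists_or, List.forall_mem_cons]
  refine exists_congr fun x => ?_
  have : XorClause.eval (δ.1, !δ.2) x = !δ.eval x := XorClause.eval_flip _ _ _
  have h : (dec δ lo hi).eval x = if XorClause.eval δ x then hi.eval x else lo.eval x := rfl
  rw [this, h]
  cases XorClause.eval δ x <;> simp only [Bool.not_true, Bool.not_false, if_true, if_false,
    true_and, false_and, or_false, false_or, Bool.false_eq_true]

mutual

theorem eadtRec_enc {A anc : List (XorClause m)} (hA : Compat A anc) (pol : Bool) :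
    ∀ T : ATree m, T.Extended anc →
      (eadtRec T.enc ((pol, m), 0, A.map eraseXor) = true ↔ Sat pol A T)
  | leaf b, _ => by
    have h : eadtRec (leaf b : ATree m).enc ((pol, m), 0, A.map eraseXor) =
        ((b == pol) && consistent m (A.map eraseXor)) := by
      cases b <;> rfl
    rw [h, Bool.and_eq_true, consistent_iff, beq_iff_eq]
    simp only [Sat, Models, eval, exists_and_right]
    exact and_comm
  | dec δ lo hi, hT => by
    have h : eadtRec (dec δ lo hi).enc ((pol, m), 0, A.map eraseXor) =
        (eadtRec lo.enc ((pol, m), 0, flipXor (code δ).toXor :: A.map eraseXor) ||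
          eadtRec hi.enc ((pol, m), 0, (code δ).toXor :: A.map eraseXor)) := rfl
    have hf : flipXor (eraseXor δ) = eraseXor ((δ.1, !δ.2) : XorClause m) := rfl
    rw [h, toXor_code, hf, ← List.map_cons, ← List.map_cons, Bool.or_eq_true,
      eadtRec_enc (hA.cons (δ := (δ.1, !δ.2)) (δ' := δ) rfl) pol lo hT.1,
      eadtRec_enc (hA.cons rfl) pol hi hT.2, sat_dec]
  | conj cs, hT => by
    have ih := eadtRec_encList hA pol cs hT.2
    cases pol with
    | true =>
      have h : eadtRec (conj cs).enc ((true, m), 0, A.map eraseXor) =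
          (consistent m (A.map eraseXor) &&
            eadtRec (encList cs) ((true, m), 3, A.map eraseXor)) := rfl
      rw [h, Bool.and_eq_true, consistent_iff, ih.1]
      refine (exists_forall_eval hA hT.1 true).symm.trans ?_
      simp [Sat, eval, evalAll_eq]
    | false =>
      have h : eadtRec (conj cs).enc ((false, m), 0, A.map eraseXor) =
          eadtRec (encList cs) ((false, m), 4, A.map eraseXor) := rfl
      rw [h, ih.2, ← exists_exists_eval]
      simp [Sat, eval, evalAll_eq]
  | disj cs, hT => by
    have ih := eadtRec_encList hA pol cs hT.2
    cases pol with
    | true =>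
      have h : eadtRec (disj cs).enc ((true, m), 0, A.map eraseXor) =
          eadtRec (encList cs) ((true, m), 4, A.map eraseXor) := rfl
      rw [h, ih.2, ← exists_exists_eval]
      simp [Sat, eval, evalAny_eq]
    | false =>
      have h : eadtRec (disj cs).enc ((false, m), 0, A.map eraseXor) =
          (consistent m (A.map eraseXor) &&
            eadtRec (encList cs) ((false, m), 3, A.map eraseXor)) := rfl
      rw [h, Bool.and_eq_true, consistent_iff, ih.1]
      refine (exists_forall_eval hA hT.1 false).symm.trans ?_
      simp [Sat, eval, evalAny_eq]

theorem eadtRec_encList {A anc : List (XorClause m)} (hA : Compat A anc) (pol : Bool) :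
    ∀ cs : List (ATree m), ExtendedList anc cs →
      (eadtRec (encList cs) ((pol, m), 3, A.map eraseXor) = true ↔ ∀ c ∈ cs, Sat pol A c) ∧
      (eadtRec (encList cs) ((pol, m), 4, A.map eraseXor) = true ↔ ∃ c ∈ cs, Sat pol A c)
  | [], _ => ⟨by simp [encList, eadtRec, treeRec], by simp [encList, eadtRec, treeRec]⟩
  | c :: cs, h => by
    have h₁ := eadtRec_enc hA pol c h.1
    have h₂ := eadtRec_encList hA pol cs h.2
    have h₃ : eadtRec (encList (c :: cs)) ((pol, m), 3, A.map eraseXor) =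
      (eadtRec c.enc ((pol, m), 0, A.map eraseXor) &&
        eadtRec (encList cs) ((pol, m), 3, A.map eraseXor)) := rfl
    have h₄ : eadtRec (encList (c :: cs)) ((pol, m), 4, A.map eraseXor) =
      (eadtRec c.enc ((pol, m), 0, A.map eraseXor) ||
        eadtRec (encList cs) ((pol, m), 4, A.map eraseXor)) := rfl
    rw [h₃, h₄, Bool.and_eq_true, Bool.or_eq_true, h₁, h₂.1, h₂.2, List.forall_mem_cons,
      List.exists_mem_cons_iff]
    exact ⟨Iff.rfl, Iff.rfl⟩

end

end ATree

/-- The clauses that fix the values prescribed by the cube. -/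
def cubeClauses (c : List (Option Bool)) : List (List (ℕ × Bool) × Bool) :=
  ((List.range c.length).filter fun i => (c.getD i none).isSome).map fun i =>
    ([(i, true)], !(c.getD i none).getD false)

def eadtTest (p : SExp × List (Option Bool)) : Bool :=
  !eadtRec p.1 ((false, p.2.length), 0, cubeClauses p.2) ||
    !eadtRec p.1 ((true, p.2.length), 0, cubeClauses p.2)

theorem PT.cubeClauses : PT cubeClauses := by unfold KC.cubeClauses; fun_prop

theorem PT.eadtTest : PT eadtTest := by
  have h := PT.cubeClauses.comp (PT.snd (α := SExp) (β := List (Option Bool)))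
  have h' : ∀ b : Bool, PT (fun p : SExp × List (Option Bool) =>
      KC.eadtRec p.1 ((b, p.2.length), 0, KC.cubeClauses p.2)) := fun b =>
    PT.eadtRec.comp (f := fun p : SExp × List (Option Bool) =>
      (p.1, ((b, p.2.length), 0, KC.cubeClauses p.2))) (by fun_prop)
  have h₀ := h' false
  have h₁ := h' true
  unfold KC.eadtTest; fun_prop

theorem exists_cubeClauses (c : Fin m → Option Bool) :
    ∃ A : List (XorClause m), cubeClauses (List.ofFn c) = A.map eraseXor ∧
      (∀ δ ∈ A, δ.vars.Subsingleton) ∧ ∀ x, ATree.Models A x ↔ Agree c x := by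
  refine ⟨((List.finRange m).filter fun i => (c i).isSome).map fun i =>
    ([(i, true)], !(c i).getD false), ?_, ?_, ?_⟩
  · rw [cubeClauses, List.length_ofFn, ← List.map_coe_finRange_eq_range, List.filter_map,
      List.map_map, List.map_map]
    simp [Function.comp_def, eraseXor, eraseLit]
  · intro δ hδ
    obtain ⟨i, -, rfl⟩ := List.mem_map.1 hδ
    rintro _ ⟨l, hl, rfl⟩ _ ⟨l', hl', rfl⟩
    rw [List.mem_singleton.1 hl, List.mem_singleton.1 hl']
  · intro x
    simp only [ATree.Models, List.forall_mem_map, List.mem_filter, List.mem_finRange, true_and,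
      Agree]
    refine forall_congr' fun i => ?_
    cases hi : c i with
    | none => simp
    | some b => cases b <;> cases hx : x i <;> simp [XorClause.eval, Lit.eval, hx]

theorem eadtTest_enc {T : ATree m} (hT : T.Extended []) (c : Fin m → Option Bool) :
    eadtTest (T.enc, List.ofFn c) = true ↔ ConstOn T.eval c := by
  obtain ⟨A, h₁, h₂, h₃⟩ := exists_cubeClauses c
  have h := fun pol => ATree.eadtRec_enc (A := A) (anc := []) (fun δ hδ => Or.inr (h₂ δ hδ))
    pol T hT
  have h' : ∀ pol, eadtRec T.enc ((pol, m), 0, A.map eraseXor) = false ↔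
      ∀ x, Agree c x → T.eval x = !pol := by
    intro pol
    rw [← Bool.not_eq_true, h]
    simp only [ATree.Sat, h₃, not_exists, not_and, Bool.eq_not]
  rw [constOn_iff, eadtTest, List.length_ofFn, h₁, Bool.or_eq_true, Bool.not_eq_true',
    Bool.not_eq_true', h', h', or_comm]
  rfl

theorem oneAXp_EADT : OneAXpInPolyTime EADT :=
  oneAXp_of_test _ eadtTest PT.eadtTest fun _ _ hT c => eadtTest_enc hT c

/-! ### Affine formulas as decision trees -/

/-- The tree that decides on the clauses one after the other. -/
def chain (Φ : List (XorClause m)) : ATree m :=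
  Φ.foldr (fun δ T => ATree.dec δ (ATree.leaf false) T) (ATree.leaf true)

theorem eval_chain (Φ : List (XorClause m)) (x : Fin m → Bool) :
    (chain Φ).eval x = Φ.all fun δ => XorClause.eval δ x := by
  induction Φ with
  | nil => rfl
  | cons δ Φ ih =>
    have h : (chain (δ :: Φ)).eval x =
        if XorClause.eval δ x then (chain Φ).eval x else false := rfl
    rw [List.all_cons, ← ih, h]
    cases XorClause.eval δ x <;> rfl

theorem extended_chain (anc Φ : List (XorClause m)) : (chain Φ).Extended anc := by
  induction Φ generalizing anc with
  | nil => trivial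
  | cons δ Φ ih => exact ⟨trivial, ih _⟩

def encChain (s : SExp) : SExp :=
  s.toList.foldr (fun δ t => SExp.cons (code (1 : ℕ)) (SExp.cons δ
    (SExp.cons (code ((0 : ℕ), false)) t))) (code ((0 : ℕ), true))

theorem PT.encChain : PT encChain := by
  unfold KC.encChain
  refine PT.foldr (step := fun _ (δ t : SExp) => SExp.cons (Encode.code (1 : ℕ)) (SExp.cons δ
    (SExp.cons (Encode.code ((0 : ℕ), false)) t))) (PT.const _) (by fun_prop) PT.toList
    (Polynomial.X + 20) fun a b s => ?_
  have h₁ : (Encode.code (1 : ℕ)).size ≤ 8 := by decide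
  have h₂ : (Encode.code ((0 : ℕ), false)).size ≤ 8 := by decide
  have h₃ : (Encode.code (SExp.cons (Encode.code (1 : ℕ)) (SExp.cons b
      (SExp.cons (Encode.code ((0 : ℕ), false)) s)))).size = (Encode.code (1 : ℕ)).size +
      ((Encode.code b).size + ((Encode.code ((0 : ℕ), false)).size +
        (Encode.code s).size + 1) + 1) + 1 := rfl
  rw [h₃, Polynomial.eval_add, Polynomial.eval_X, Polynomial.eval_ofNat]
  omega

theorem encChain_code (Φ : List (XorClause m)) : encChain (code Φ) = (chain Φ).enc := by
  rw [encChain, toList_code]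
  induction Φ with
  | nil => rfl
  | cons δ Φ ih => rw [List.map_cons, List.foldr_cons, ih]; rfl

theorem eadtTest_encChain (Φ : List (XorClause m)) (c : Fin m → Option Bool) :
    eadtTest (encChain (code Φ), List.ofFn c) = true ↔
      ConstOn (fun x => Φ.all fun δ => XorClause.eval δ x) c := by
  rw [encChain_code, eadtTest_enc (extended_chain _ _), funext (eval_chain Φ)]

theorem oneAXp_AFF : OneAXpInPolyTime AFF :=
  oneAXp_of_test _ (fun p => eadtTest (encChain p.1, p.2))
    (PT.eadtTest.comp ((PT.encChain.comp PT.fst).mk PT.snd)) fun _ Φ _ c => eadtTest_encChain Φ c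

end KC

theorem mainTheorem5 :
    KC.OneAXpInPolyTime KC.cdPDAG ∧
    KC.OneAXpInPolyTime KC.SDD ∧
    KC.OneAXpInPolyTime KC.OBDD ∧
    KC.OneAXpInPolyTime KC.PI ∧
    KC.OneAXpInPolyTime KC.IP ∧
    KC.OneAXpInPolyTime KC.renHC ∧
    KC.OneAXpInPolyTime KC.AFF ∧
    KC.OneAXpInPolyTime KC.dFSD ∧
    KC.OneAXpInPolyTime KC.EADT :=
  ⟨KC.oneAXp_cdPDAG, KC.oneAXp_SDD, KC.oneAXp_OBDD, KC.oneAXp_PI, KC.oneAXp_IP, KC.oneAXp_renHC,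
    KC.oneAXp_AFF, KC.oneAXp_dFSD, KC.oneAXp_EADT⟩
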